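/- **Setting.** Let $\varepsilon,\kappa,T>0$, $\theta_0\in\mathbb R$, $A,B\ge 0$, and let $\Omega=(\mathbb R/\mathbb Z)\times(0,1)$. Let $\Phi$ be a classical solution on $[0,T]\times\overline\Omega$ of the Cahn–Hilliard equation with dynamical boundary conditions $$\partial_t\Phi=\Delta\mu,\quad \mu=\ln(1+\Phi)-\ln(1-\Phi)-\theta_0\Phi-\varepsilon^2\Delta\Phi\ \text{ in }\Omega,\qquad \partial_n\mu=0\ \text{ at } y=0,1,$$ $$\partial_t\psi=\partial_x^2\mu_\Gamma,\quad \mu_\Gamma=\ln(1+\psi)-\ln(1-\psi)-\theta_0\psi-\kappa\varepsilon\,\partial_x^2\psi+\varepsilon^2\partial_n\Phi\quad\text{on each side } y=0 \text{ and } y=1,\ \ \psi=\Phi|_{y=0},\,\Phi|_{y=1},$$ with $1\pm\Phi\ge\epsilon_0$ on $[0,T]\times\overline\Omega$ for some $\epsilon_0>0$. **Grid.** Let $N=2K+1$, $h=1/N$. A grid function $f=(f_{i,j})$, $N$-periodic in $i$, $0\le j\le N$ (with ghost rows $j=-1,N+1$ where needed), has its values at $((i+\frac12)h,jh)$; $f^B=f_{\cdot,0}$,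 $f^T=f_{\cdot,N}$. Put $(f,g)=h^2\sum_{i=0}^{N-1}\sum_{j=0}^N\omega_jf_{i,j}g_{i,j}$ with $\omega_0=\omega_N=\frac12$ and $\omega_j=1$ otherwise, $\overline f=(f,1)$; on a side, $(f,g)_\Gamma=h\sum_{i=0}^{N-1}f_ig_i$, $\|f\|_{2,\Gamma}^2=(f,f)_\Gamma$ and $\overline f^\Gamma=(f,1)_\Gamma$. $\Delta_h$ is the five-point Laplacian, $D_x$ and $D_x^2$ are the usual first (half-point) and second differences in $x$, $\|\nabla_hf\|_2$ is the discrete norm of the half-point gradient, and $\tilde D_yf_{i,j}=(f_{i,j+1}-f_{i,j-1})/(2h)$. $L_h$ is $-\Delta_h$ for $0<j<N$, while $L_hf_{i,0}=-D_x^2f_{i,0}-2(f_{i,1}-f_{i,0})/h^2$ and $L_hf_{i,N}=-D_x^2f_{i,N}-2(f_{i,N-1}-f_{i,N})/h^2$. For mean-zero functions, $\|f\|_{-1}=(f,L_h^{-1}f)^{1/2}$ and, on a side, $\|f\|_{-1,\Gamma}=(f,(-D_x^2)^{-1}f)_\Gamma^{1/2}$, with mean-zero inverses. For a grid function $f$ put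 $\|f\|_{-1,\Gamma}^2=\|f^T\|_{-1,\Gamma}^2+\|f^B\|_{-1,\Gamma}^2$ and $\|D_xf\|_{2,\Gamma}^2=\|D_xf^T\|_{2,\Gamma}^2+\|D_xf^B\|_{2,\Gamma}^2$. **Scheme (modified BDF2).** Given $\phi^{n-1},\phi^n$, the grid function $\phi^{n+1}$ has values in $(-1,1)$ for $0\le j\le N$ and, with $\hat\phi^{n+1}=2\phi^n-\phi^{n-1}$ and some $\mu^{n+1},\mu_B^{n+1},\mu_T^{n+1}$, satisfies for all $i$ and $0\le j\le N$ $$\frac{3\phi^{n+1}-4\phi^n+\phi^{n-1}}{2\Delta t}=\Delta_h\mu^{n+1},\qquad \tilde D_y\mu^{n+1}_{i,0}=\tilde D_y\mu^{n+1}_{i,N}=0,$$ $$\mu^{n+1}=\ln(1+\phi^{n+1})-\ln(1-\phi^{n+1})-\theta_0\hat\phi^{n+1}-\varepsilon^2\Delta_h\phi^{n+1}-A\Delta t\,\Delta_h(\phi^{n+1}-\phi^n),$$ and on the sides, for $S\in\{B,T\}$, with $\tilde\partial_n=-\tilde D_y$ at $j=0$ $(S=B)$ and $\tilde\partial_n=+\tilde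 D_y$ at $j=N$ $(S=T)$, $$\frac{3\phi^{S,n+1}-4\phi^{S,n}+\phi^{S,n-1}}{2\Delta t}=D_x^2\mu_S^{n+1},$$ $$\mu_S^{n+1}=\ln(1+\phi^{S,n+1})-\ln(1-\phi^{S,n+1})-\theta_0\hat\phi^{S,n+1}-\varepsilon\kappa D_x^2\phi^{S,n+1}+\varepsilon^2\tilde\partial_n\phi^{n+1}+A\Delta t\,\tilde\partial_n(\phi^{n+1}-\phi^n)-B\Delta t\,D_x^2(\phi^{S,n+1}-\phi^{S,n}).$$ **Corrected error.** Let $\Phi_N$ be the Fourier projection of $\Phi$ in $x$ onto trigonometric polynomials of degree at most $K$, let $\delta\Phi(x,y,t)=(\overline{\Phi_N}(t)-\overline{\Phi_N}(0))(1-\cos 2\pi y)$, $t_n=n\Delta t$, and let $\tilde\phi^n=\Phi_N(t_n)-\delta\Phi(t_n)-\phi^n$ on the grid. **Theorem.** There is an $m\in\mathbb N$ such that the following holds for all parameters and all solutions $\Phi$ as above of class $C^m$ on $[0,T]\times\overline\Omega$ (up to the boundary). For every $C_0$ there are $C,\delta>0$, depending on $\varepsilon,\kappa,\theta_0,A,B,T,\Phi,C_0$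 but not on $\Delta t$ and $h$, such that: whenever $0<\Delta t\le\delta$, $h\le\delta$, $n\ge1$, $t_{n+1}\le T$, the starting values $\phi^0,\phi^1$ satisfy, for $k=0,1$, $$\overline{\tilde\phi^k}=\overline{\tilde\phi^{B,k}}^\Gamma=\overline{\tilde\phi^{T,k}}^\Gamma=0,\qquad \|\tilde\phi^k\|_{-1}+\|\tilde\phi^k\|_{-1,\Gamma}\le C_0(\Delta t^2+h^2),$$ $$\Delta t\left(\varepsilon^2\|\nabla_h\tilde\phi^1\|_2^2+\varepsilon\kappa\|D_x\tilde\phi^1\|_{2,\Gamma}^2\right)\le C_0(\Delta t^2+h^2)^2,$$ and $\phi^2,\dots,\phi^{n+1}$ are computed by the scheme, then $\tilde\phi^{n+1}$ has zero discrete mean in the bulk and on both sides, and $$\|\tilde\phi^{n+1}\|_{-1}+\|\tilde\phi^{n+1}\|_{-1,\Gamma}+\Delta t\sum_{k=1}^n\left(\varepsilon^2\|\nabla_h\tilde\phi^k\|_2^2+\varepsilon\kappa\|D_x\tilde\phi^k\|_{2,\Gamma}^2\right)\le C(\Delta t^2+h^2).$$ -/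

import Mathlib

noncomputable section

namespace CHDBC

/-! ### Grid functions on the unit square, periodic in `x` -/

/-- Grid functions `f i j`, attached to the points `((i + 1/2) h, j h)` with `h = 1 / N`. The first
index is periodic with period `N`. The second index ranges over `0, …, N` and, where normal
derivatives or the five-point Laplacian on the boundary rows are concerned, also over the ghost
rows `-1` and `N + 1`; no other value of `j` is ever used. -/
abbrev Grid (N : ℕ) : Type := ZMod N → ℤ → ℝ

/-- Grid functions on one of the two horizontal sides. -/
abbrev BdryGrid (N : ℕ) : Type := ZMod N → ℝ

/-- The mesh size `h = 1 / N`. -/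
def mesh (N : ℕ) : ℝ := 1 / (N : ℝ)

/-- The weights of the composite trapezoidal rule in `y`. -/
def weight (N : ℕ) (j : ℕ) : ℝ := if j = 0 ∨ j = N then 1 / 2 else 1

/-- The row `y = 0`. -/
def bot {N : ℕ} (f : Grid N) : BdryGrid N := fun i => f i 0

/-- The row `y = 1`. -/
def top {N : ℕ} (f : Grid N) : BdryGrid N := fun i => f i (N : ℤ)

section Discrete

variable {N : ℕ} [NeZero N]

/-- The bulk inner product `(f, g) = h² ∑_{i < N} ∑_{j ≤ N} ω_j f_{ij} g_{ij}`. -/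
def ip (f g : Grid N) : ℝ :=
  mesh N ^ 2 * ∑ i : ZMod N, ∑ j ∈ Finset.range (N + 1), weight N j * f i j * g i j

/-- The discrete bulk mean `(f, 1) / |Ω|`, where `|Ω| = 1`. -/
def mean (f : Grid N) : ℝ := ip f (fun _ _ => 1)

/-- The boundary inner product `(f, g)_Γ = h ∑_{i < N} f_i g_i`. -/
def ipΓ (f g : BdryGrid N) : ℝ := mesh N * ∑ i : ZMod N, f i * g i

/-- The discrete mean over one horizontal side (of length one). -/
def meanΓ (f : BdryGrid N) : ℝ := ipΓ f (fun _ => 1)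

/-- The second difference `D_x²` on a horizontal side. -/
def Dxx (f : BdryGrid N) : BdryGrid N :=
  fun i => (f (i + 1) - 2 * f i + f (i - 1)) / mesh N ^ 2

/-- The first difference `D_x` on a horizontal side; index `i` stands for `i + 1/2`. -/
def Dx (f : BdryGrid N) : BdryGrid N := fun i => (f (i + 1) - f i) / mesh N

/-- The five-point Laplacian `Δ_h` (on the rows `0` and `N` it uses the ghost rows). -/
def lapH (f : Grid N) : Grid N := fun i j =>
  Dxx (fun k => f k j) i + (f i (j + 1) - 2 * f i j + f i (j - 1)) / mesh N ^ 2

/-- The long-stencil difference `(f_{i,j+1} - f_{i,j-1}) / (2h)` in `y`. -/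
def Dy (f : Grid N) (j : ℤ) : BdryGrid N := fun i => (f i (j + 1) - f i (j - 1)) / (2 * mesh N)

/-- `‖∇_h f‖₂²`. The `x`-part is `(a_x (D_x f)², 1)` with the average `a_x` of the two neighbouring
half-points; the `y`-part is `h² ∑ (D_y f)²_{i, j+1/2}` over `0 ≤ j < N`. -/
def gradSq (f : Grid N) : ℝ :=
  ip (fun i j => (Dx (fun k => f k j) i ^ 2 + Dx (fun k => f k j) (i - 1) ^ 2) / 2) (fun _ _ => 1)
    + mesh N ^ 2 * ∑ i : ZMod N, ∑ j ∈ Finset.range N, ((f i (j + 1) - f i j) / mesh N) ^ 2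

/-- `‖D_x f‖²_{2,Γ}`, the sum of the contributions of the two sides. -/
def dxSqΓ (f : Grid N) : ℝ := ipΓ (Dx (top f)) (Dx (top f)) + ipΓ (Dx (bot f)) (Dx (bot f))

/-- The modified negative Laplacian `L_h`, which has the homogeneous Neumann condition at
`y = 0, 1` built in. -/
def Lh (f : Grid N) : Grid N := fun i j =>
  if j = 0 then - Dxx (fun k => f k 0) i - 2 * (f i 1 - f i 0) / mesh N ^ 2
  else if j = N then - Dxx (fun k => f k N) i - 2 * (f i (N - 1) - f i N) / mesh N ^ 2
  else - lapH f i j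

/-- `ψ` is mean-zero and solves `L_h ψ = f` on the rows `0, …, N`. -/
def SolvesLh (f ψ : Grid N) : Prop :=
  mean ψ = 0 ∧ ∀ i : ZMod N, ∀ j : ℕ, j ≤ N → Lh ψ i j = f i j

/-- `ψ` is mean-zero and solves `-D_x² ψ = f` on a side. -/
def SolvesDxx (f ψ : BdryGrid N) : Prop := meanΓ ψ = 0 ∧ ∀ i : ZMod N, - Dxx ψ i = f i

/-- The mean-zero solution of `L_h ψ = f` (for mean-zero `f`). -/
def invLh (f : Grid N) : Grid N := Classical.epsilon (SolvesLh f)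

/-- The mean-zero solution of `-D_x² ψ = f` on a side (for mean-zero `f`). -/
def invDxx (f : BdryGrid N) : BdryGrid N := Classical.epsilon (SolvesDxx f)

/-- The discrete norm `‖f‖_{-1} = (f, L_h⁻¹ f)^{1/2}` of a mean-zero grid function. -/
def normNeg (f : Grid N) : ℝ := Real.sqrt (ip f (invLh f))

/-- `‖f‖_{-1,Γ} = (f, (-D_x²)⁻¹ f)_Γ^{1/2}` on one side. -/
def normNegSide (f : BdryGrid N) : ℝ := Real.sqrt (ipΓ f (invDxx f))

/-- `‖f‖_{-1,Γ}`, the two sides together. -/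
def normNegΓ (f : Grid N) : ℝ :=
  Real.sqrt (normNegSide (top f) ^ 2 + normNegSide (bot f) ^ 2)

/-! ### The modified BDF2 scheme -/

/-- One step of the modified BDF2 scheme: `φ₀, φ₁, φ₂` are the approximations at the times
`t_{n-1}, t_n, t_{n+1}`, and `μ, μB, μT` are the chemical potentials at `t_{n+1}`. The values of `φ₂`
lie in `(-1, 1)`, where the logarithms make sense. -/
def BDF2Step (ε κ θ₀ A B dt : ℝ) (φ₀ φ₁ φ₂ : Grid N) : Prop :=
  (∀ i : ZMod N, ∀ j : ℕ, j ≤ N → -1 < φ₂ i j ∧ φ₂ i j < 1) ∧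
  ∃ (μ : Grid N) (μB μT : BdryGrid N),
    (∀ i : ZMod N, ∀ j : ℕ, j ≤ N →
      (3 * φ₂ i j - 4 * φ₁ i j + φ₀ i j) / (2 * dt) = lapH μ i j) ∧
    (∀ i : ZMod N, ∀ j : ℕ, j ≤ N →
      μ i j = Real.log (1 + φ₂ i j) - Real.log (1 - φ₂ i j) - θ₀ * (2 * φ₁ i j - φ₀ i j)
        - ε ^ 2 * lapH φ₂ i j - A * dt * lapH (φ₂ - φ₁) i j) ∧
    (∀ i : ZMod N, Dy μ 0 i = 0 ∧ Dy μ N i = 0) ∧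
    (∀ i : ZMod N, (3 * bot φ₂ i - 4 * bot φ₁ i + bot φ₀ i) / (2 * dt) = Dxx μB i) ∧
    (∀ i : ZMod N, (3 * top φ₂ i - 4 * top φ₁ i + top φ₀ i) / (2 * dt) = Dxx μT i) ∧
    (∀ i : ZMod N,
      μB i = Real.log (1 + bot φ₂ i) - Real.log (1 - bot φ₂ i) - θ₀ * (2 * bot φ₁ i - bot φ₀ i)
        - ε * κ * Dxx (bot φ₂) i - ε ^ 2 * Dy φ₂ 0 i
        - A * dt * Dy (φ₂ - φ₁) 0 i - B * dt * Dxx (bot φ₂ - bot φ₁) i) ∧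
    (∀ i : ZMod N,
      μT i = Real.log (1 + top φ₂ i) - Real.log (1 - top φ₂ i) - θ₀ * (2 * top φ₁ i - top φ₀ i)
        - ε * κ * Dxx (top φ₂) i + ε ^ 2 * Dy φ₂ N i
        + A * dt * Dy (φ₂ - φ₁) N i - B * dt * Dxx (top φ₂ - top φ₁) i)

end Discrete

/-! ### The exact solution -/

/-- The Laplacian of a function of `(x, y)`. -/
def laplacian (f : ℝ → ℝ → ℝ) (x y : ℝ) : ℝ :=
  iteratedDeriv 2 (fun s => f s y) x + iteratedDeriv 2 (fun s => f x s) y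

/-- The bulk chemical potential `μ = F'(φ) - ε² Δφ` with the Flory–Huggins potential. -/
def chemPot (ε θ₀ : ℝ) (φ : ℝ → ℝ → ℝ) (x y : ℝ) : ℝ :=
  Real.log (1 + φ x y) - Real.log (1 - φ x y) - θ₀ * φ x y - ε ^ 2 * laplacian φ x y

/-- The surface chemical potential `G'(ψ) - κ ε ψ_xx + ε² ∂_n φ` on the side `y = b`, where `ψ` is
the trace of `φ`, the outward normal is `σ e_y`, and `G = F` is the Flory–Huggins potential. -/
def chemPotΓ (ε κ θ₀ : ℝ) (φ : ℝ → ℝ → ℝ) (b σ : ℝ) (x : ℝ) : ℝ :=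
  Real.log (1 + φ x b) - Real.log (1 - φ x b) - θ₀ * φ x b
    - κ * ε * iteratedDeriv 2 (fun s => φ s b) x + ε ^ 2 * (σ * deriv (fun s => φ x s) b)

/-- `Φ t x y` is a classical solution on `[0, T] × (ℝ/ℤ) × [0, 1]` of the Cahn–Hilliard equation with
dynamical boundary conditions on `y = 0` and `y = 1`, of class `C^m` up to the boundary (that is, it
is the restriction of a `C^m` function, only whose values on `0 ≤ t ≤ T`, `0 ≤ y ≤ 1` matter), and
separated from the pure phases `±1`. -/
structure ExactSolution (ε κ θ₀ T : ℝ) (m : ℕ) (Φ : ℝ → ℝ → ℝ → ℝ) : Prop where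
  regular : ContDiff ℝ m (fun p : ℝ × ℝ × ℝ => Φ p.1 p.2.1 p.2.2)
  periodic : ∀ t x y, Φ t (x + 1) y = Φ t x y
  separated : ∃ ε₀ > 0, ∀ t ∈ Set.Icc 0 T, ∀ x, ∀ y ∈ Set.Icc (0 : ℝ) 1,
    ε₀ ≤ 1 + Φ t x y ∧ ε₀ ≤ 1 - Φ t x y
  bulk : ∀ t ∈ Set.Icc 0 T, ∀ x, ∀ y ∈ Set.Ioo (0 : ℝ) 1,
    deriv (fun s => Φ s x y) t = laplacian (chemPot ε θ₀ (Φ t)) x y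
  noFlux : ∀ t ∈ Set.Icc 0 T, ∀ x,
    deriv (fun s => chemPot ε θ₀ (Φ t) x s) 0 = 0 ∧ deriv (fun s => chemPot ε θ₀ (Φ t) x s) 1 = 0
  bottom : ∀ t ∈ Set.Icc 0 T, ∀ x,
    deriv (fun s => Φ s x 0) t = iteratedDeriv 2 (chemPotΓ ε κ θ₀ (Φ t) 0 (-1)) x
  top : ∀ t ∈ Set.Icc 0 T, ∀ x,
    deriv (fun s => Φ s x 1) t = iteratedDeriv 2 (chemPotΓ ε κ θ₀ (Φ t) 1 1) x

/-! ### The corrected exact solution and the error -/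

/-- The Fourier projection (period one) onto trigonometric polynomials of degree at most `K`. -/
def fourierProj (K : ℕ) (f : ℝ → ℝ) (x : ℝ) : ℝ :=
  (∑ k ∈ Finset.Icc (-(K : ℤ)) K,
    fourierCoeffOn (zero_lt_one' ℝ) (fun s => (f s : ℂ)) k
      * Complex.exp (2 * Real.pi * Complex.I * k * x)).re

/-- Grid values of `Φ_N(t)`, the projection in `x` of `Φ(t)`, for `N = 2 K + 1`. -/
def projGrid (K : ℕ) (Φ : ℝ → ℝ → ℝ → ℝ) (t : ℝ) : Grid (2 * K + 1) := fun i j =>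
  fourierProj K (fun s => Φ t s (j * mesh (2 * K + 1))) (((i.val : ℝ) + 1 / 2) * mesh (2 * K + 1))

/-- Grid values of `δΦ(t) = (mean Φ_N(t) - mean Φ_N(0)) (1 - cos (2 π y))`. -/
def corrGrid (K : ℕ) (Φ : ℝ → ℝ → ℝ → ℝ) (t : ℝ) : Grid (2 * K + 1) := fun _ j =>
  (mean (projGrid K Φ t) - mean (projGrid K Φ 0))
    * (1 - Real.cos (2 * Real.pi * (j * mesh (2 * K + 1))))

/-- The corrected error `Φ_N(t_n) - δΦ(t_n) - φⁿ`, where `t_n = n dt`. -/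
def err (K : ℕ) (Φ : ℝ → ℝ → ℝ → ℝ) (dt : ℝ) (φ : ℕ → Grid (2 * K + 1)) (n : ℕ) :
    Grid (2 * K + 1) :=
  projGrid K Φ (n * dt) - corrGrid K Φ (n * dt) - φ n

/-- All three discrete masses (bulk, top, bottom) of `f` vanish. -/
def MassFree {N : ℕ} [NeZero N] (f : Grid N) : Prop :=
  mean f = 0 ∧ meanΓ (top f) = 0 ∧ meanΓ (bot f) = 0

/-- The two starting values of the scheme carry the masses of the exact solution and are second
order accurate with constant `C₀`. -/
structure AccurateStart (ε κ C₀ : ℝ) (K : ℕ) (Φ : ℝ → ℝ → ℝ → ℝ) (dt : ℝ)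
    (φ : ℕ → Grid (2 * K + 1)) : Prop where
  mass₀ : MassFree (err K Φ dt φ 0)
  mass₁ : MassFree (err K Φ dt φ 1)
  acc₀ : normNeg (err K Φ dt φ 0) + normNegΓ (err K Φ dt φ 0)
    ≤ C₀ * (dt ^ 2 + mesh (2 * K + 1) ^ 2)
  acc₁ : normNeg (err K Φ dt φ 1) + normNegΓ (err K Φ dt φ 1)
    ≤ C₀ * (dt ^ 2 + mesh (2 * K + 1) ^ 2)
  grad₁ : dt * (ε ^ 2 * gradSq (err K Φ dt φ 1) + ε * κ * dxSqΓ (err K Φ dt φ 1))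
    ≤ C₀ * (dt ^ 2 + mesh (2 * K + 1) ^ 2) ^ 2

/-! ### Well-posedness of the two inverse operators used in the negative norms -/

section WellPosed

set_option linter.unusedSectionVars false

variable {N : ℕ} [NeZero N]

theorem mesh_pos : 0 < mesh N := by
  have : (0 : ℝ) < N := by exact_mod_cast Nat.pos_of_ne_zero (NeZero.ne N)
  unfold mesh; positivity

/-- Summation by parts on a horizontal side. -/
theorem sum_mul_Dxx (f g : BdryGrid N) :
    ∑ i : ZMod N, f i * (- Dxx g i) = ∑ i : ZMod N, Dx f i * Dx g i := by
  have h1 : ∑ i : ZMod N, f (i + 1) * (g (i + 1) - g i) = ∑ i : ZMod N, f i * (g i - g (i - 1)) := by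
    rw [← Equiv.sum_comp (Equiv.addRight (1 : ZMod N)) (fun i => f i * (g i - g (i - 1)))]
    simp
  have h2 : ∀ i : ZMod N, f i * (- Dxx g i)
      = (f i * (g i - g (i - 1)) - f i * (g (i + 1) - g i)) / mesh N ^ 2 := by
    intro i; simp only [Dxx]; ring
  have h3 : ∀ i : ZMod N, Dx f i * Dx g i
      = (f (i + 1) * (g (i + 1) - g i) - f i * (g (i + 1) - g i)) / mesh N ^ 2 := by
    intro i; simp only [Dx]; ring
  simp only [h2, h3]
  rw [← Finset.sum_div, ← Finset.sum_div, Finset.sum_sub_distrib, Finset.sum_sub_distrib, h1]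

theorem sum_parts_aux (a b : ℤ → ℝ) (M : ℕ) :
    ∑ j ∈ Finset.range (M + 1), (b (j + 1) - b j) * (a (j + 1) - a j)
      = b (M + 1) * (a (M + 1) - a M) - b 0 * (a 1 - a 0)
        - ∑ j ∈ Finset.range M, b (j + 1) * (a (j + 1 + 1) - 2 * a (j + 1) + a j) := by
  induction M with
  | zero => simp; ring
  | succ k ih =>
    rw [Finset.sum_range_succ, ih, Finset.sum_range_succ]
    push_cast
    ring

/-- Summation by parts for the modified negative Laplacian. -/
theorem ip_Lh (f g : Grid N) :
    ip f (Lh g) = mesh N ^ 2 * (∑ j ∈ Finset.range (N + 1), weight N j *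
        ∑ i : ZMod N, Dx (fun k => f k j) i * Dx (fun k => g k j) i
      + ∑ i : ZMod N, ∑ j ∈ Finset.range N,
        (f i (j + 1) - f i j) / mesh N * ((g i (j + 1) - g i j) / mesh N)) := by
  have hN : N ≠ 0 := NeZero.ne N
  set q : ZMod N → ℕ → ℝ := fun i j =>
    if j = 0 then - 2 * (g i 1 - g i 0) / mesh N ^ 2
    else if j = N then - 2 * (g i (N - 1) - g i N) / mesh N ^ 2
    else - (g i (j + 1) - 2 * g i j + g i (j - 1)) / mesh N ^ 2 with hq
  have hL : ∀ i, ∀ j : ℕ, Lh g i j = - Dxx (fun k => g k j) i + q i j := by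
    intro i j
    simp only [Lh, hq, lapH, Nat.cast_eq_zero, Nat.cast_inj]
    split_ifs with h1 h2
    · subst h1; simp; ring
    · subst h2; ring
    · ring
  have hy : ∀ i, ∑ j ∈ Finset.range (N + 1), weight N j * f i j * q i j
      = ∑ j ∈ Finset.range N, (f i (j + 1) - f i j) / mesh N * ((g i (j + 1) - g i j) / mesh N) := by
    intro i
    obtain ⟨M, rfl⟩ := Nat.exists_eq_succ_of_ne_zero hN
    have e := sum_parts_aux (g i) (f i) M
    have e2 : ∀ j ∈ Finset.range M, weight (M + 1) (j + 1) * f i ((j + 1 : ℕ) : ℤ) * q i (j + 1)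
        = - (f i (j + 1) * (g i (j + 1 + 1) - 2 * g i (j + 1) + g i j)) / mesh (M + 1) ^ 2 := by
      intro j hj
      have hj' : j ≠ M := (Finset.mem_range.mp hj).ne
      simp [weight, hq, hj']
      ring
    rw [Finset.sum_range_succ, Finset.sum_range_succ', Finset.sum_congr rfl e2]
    have e3 : ∀ j ∈ Finset.range (M + 1),
        (f i (j + 1) - f i j) / mesh (M + 1) * ((g i (j + 1) - g i j) / mesh (M + 1))
        = ((f i (j + 1) - f i j) * (g i (j + 1) - g i j)) / mesh (M + 1) ^ 2 := by
      intro j _; ring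
    simp only [Nat.succ_eq_add_one]
    rw [Finset.sum_congr rfl e3, ← Finset.sum_div, Finset.sum_neg_distrib, ← Finset.sum_div, e]
    simp [weight, hq]
    ring
  unfold ip
  congr 1
  have e4 : ∀ i, ∀ j : ℕ, weight N j * f i j * Lh g i j
      = weight N j * (f i j * (- Dxx (fun k => g k j) i)) + weight N j * f i j * q i j := by
    intro i j; rw [hL]; ring
  simp only [e4, Finset.sum_add_distrib, hy]
  congr 1
  rw [Finset.sum_comm]
  refine Finset.sum_congr rfl fun j _ => ?_
  rw [← Finset.mul_sum, sum_mul_Dxx (fun k => f k j) (fun k => g k j)]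

theorem const_of_Dx {f : BdryGrid N} (h : ∀ i, Dx f i = 0) (i : ZMod N) : f i = f 0 := by
  have hs : ∀ k : ZMod N, f (k + 1) = f k := by
    intro k
    have := h k
    simp only [Dx, div_eq_zero_iff, (mesh_pos (N := N)).ne', or_false] at this
    linarith
  have : ∀ n : ℕ, f (n : ZMod N) = f 0 := by
    intro n
    induction n with
    | zero => simp
    | succ n ih => push_cast; rw [hs, ih]
  simpa using this i.val

theorem weight_pos (j : ℕ) : 0 < weight N j := by
  unfold weight; split_ifs <;> norm_num

/-- A grid function in the kernel of `L_h` is constant. -/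
theorem const_of_Lh {f : Grid N} (h : ∀ i : ZMod N, ∀ j : ℕ, j ≤ N → Lh f i j = 0)
    (i : ZMod N) (j : ℕ) (hj : j ≤ N) : f i j = f 0 0 := by
  have h0 : ip f (Lh f) = 0 := by
    unfold ip
    rw [Finset.sum_eq_zero, mul_zero]
    intro i _
    refine Finset.sum_eq_zero fun j hj => ?_
    rw [h i j (Nat.lt_succ_iff.mp (Finset.mem_range.mp hj)), mul_zero]
  rw [ip_Lh, mul_eq_zero] at h0
  have hm : (mesh N) ≠ 0 := (mesh_pos (N := N)).ne'
  have h1 := h0.resolve_left (pow_ne_zero 2 hm)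
  have p1 : ∀ j ∈ Finset.range (N + 1), 0 ≤ weight N j *
      ∑ i : ZMod N, Dx (fun k => f k j) i * Dx (fun k => f k j) i := fun j _ =>
    mul_nonneg (weight_pos j).le (Finset.sum_nonneg fun i _ => mul_self_nonneg _)
  have p2 : ∀ i ∈ (Finset.univ : Finset (ZMod N)), 0 ≤ ∑ j ∈ Finset.range N,
      (f i (j + 1) - f i j) / mesh N * ((f i (j + 1) - f i j) / mesh N) := fun i _ =>
    Finset.sum_nonneg fun j _ => mul_self_nonneg _
  have h2 := (add_eq_zero_iff_of_nonneg (Finset.sum_nonneg p1) (Finset.sum_nonneg p2)).mp h1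
  have hx := (Finset.sum_eq_zero_iff_of_nonneg p1).mp h2.1 0 (by simp)
  have hy := (Finset.sum_eq_zero_iff_of_nonneg p2).mp h2.2 i (Finset.mem_univ i)
  have hy' := (Finset.sum_eq_zero_iff_of_nonneg (fun j _ => mul_self_nonneg _)).mp hy
  have hx' := (Finset.sum_eq_zero_iff_of_nonneg (fun i _ => mul_self_nonneg _)).mp
    ((mul_eq_zero.mp hx).resolve_left (weight_pos 0).ne')
  have hrow : f i 0 = f 0 0 := by
    have := const_of_Dx (f := fun k => f k ((0 : ℕ) : ℤ))
      (fun i => mul_self_eq_zero.mp (hx' i (Finset.mem_univ i))) i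
    simpa using this
  rw [← hrow]
  clear hx
  induction j with
  | zero => simp
  | succ k ih =>
    have := mul_self_eq_zero.mp (hy' k (Finset.mem_range.mpr (by omega)))
    simp only [div_eq_zero_iff, hm, or_false] at this
    push_cast
    linarith [ih (by omega)]

theorem mean_const (c : ℝ) : mean (N := N) (fun _ _ => c) = c := by
  have hN : N ≠ 0 := NeZero.ne N
  have hN' : (N : ℝ) ≠ 0 := by exact_mod_cast hN
  have : ∑ j ∈ Finset.range (N + 1), weight N j = N := by
    obtain ⟨M, rfl⟩ := Nat.exists_eq_succ_of_ne_zero hN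
    rw [Finset.sum_range_succ, Finset.sum_range_succ']
    have : ∀ j ∈ Finset.range M, weight (M + 1) (j + 1) = 1 := by
      intro j hj
      have hj' : j ≠ M := (Finset.mem_range.mp hj).ne
      simp [weight, hj']
    simp only [Nat.succ_eq_add_one]
    rw [Finset.sum_congr rfl this]
    simp [weight]
    ring
  simp only [mean, ip, mul_one, ← Finset.sum_mul, this]
  simp [mesh]
  field_simp

theorem mean_congr {f g : Grid N} (h : ∀ i : ZMod N, ∀ j : ℕ, j ≤ N → f i j = g i j) :
    mean f = mean g := by
  unfold mean ip
  congr 1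
  refine Finset.sum_congr rfl fun i _ => Finset.sum_congr rfl fun j hj => ?_
  rw [h i j (Nat.lt_succ_iff.mp (Finset.mem_range.mp hj))]

theorem ip_comm (f g : Grid N) : ip f g = ip g f := by
  unfold ip
  congr 1
  refine Finset.sum_congr rfl fun i _ => Finset.sum_congr rfl fun j hj => ?_
  ring

theorem mean_Lh (f : Grid N) : mean (Lh f) = 0 := by
  rw [mean, ip_comm, ip_Lh]
  simp [Dx]

theorem mean_add (f g : Grid N) : mean (f + g) = mean f + mean g := by
  simp only [mean, ip, Pi.add_apply, mul_one, mul_add, Finset.sum_add_distrib]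

theorem mean_smul (c : ℝ) (f : Grid N) : mean (c • f) = c * mean f := by
  simp only [mean, ip, Pi.smul_apply, smul_eq_mul, mul_one, Finset.mul_sum]
  refine Finset.sum_congr rfl fun i _ => Finset.sum_congr rfl fun j _ => ?_
  ring

theorem Lh_add (f g : Grid N) : Lh (f + g) = Lh f + Lh g := by
  funext i j
  simp only [Lh, lapH, Dxx, Pi.add_apply]
  split_ifs <;> ring

theorem Lh_smul (c : ℝ) (f : Grid N) : Lh (c • f) = c • Lh f := by
  funext i j
  simp only [Lh, lapH, Dxx, Pi.smul_apply, smul_eq_mul]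
  split_ifs <;> ring

/-- `L_h` is a bijection of the mean-zero grid functions: existence. -/
theorem exists_solvesLh {f : Grid N} (hf : mean f = 0) : ∃ ψ, SolvesLh f ψ := by
  let ext : (ZMod N → Fin (N + 1) → ℝ) →ₗ[ℝ] Grid N :=
    { toFun := fun w i j => if h : j.toNat < N + 1 then w i ⟨j.toNat, h⟩ else 0
      map_add' := by
        intro v w; funext i j; simp only [Pi.add_apply]; split_ifs <;> simp
      map_smul' := by
        intro c w; funext i j; simp only [Pi.smul_apply, RingHom.id_apply]; split_ifs <;> simp }
  have hext : ∀ w i, ∀ j : Fin (N + 1), ext w i (j : ℕ) = w i j := by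
    intro w i j
    simp [ext]
    intro h
    omega
  let R : (ZMod N → Fin (N + 1) → ℝ) →ₗ[ℝ] (ZMod N → Fin (N + 1) → ℝ) :=
    { toFun := fun w i j => Lh (ext w) i (j : ℕ) + mean (ext w)
      map_add' := by
        intro v w; funext i j
        simp only [map_add, Lh_add, mean_add, Pi.add_apply]; ring
      map_smul' := by
        intro c w; funext i j
        simp only [map_smul, Lh_smul, mean_smul, Pi.smul_apply, smul_eq_mul, RingHom.id_apply]
        ring }
  have key : ∀ w, ∀ g : Grid N, mean g = 0 → (∀ i, ∀ j : Fin (N + 1), R w i j = g i (j : ℕ)) →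
      SolvesLh g (ext w) := by
    intro w g hg hw
    have e : ∀ i : ZMod N, ∀ j : ℕ, j ≤ N →
        (Lh (ext w) + (fun _ _ => mean (ext w) : Grid N)) i j = g i j := by
      intro i j hj
      exact hw i ⟨j, Nat.lt_succ_of_le hj⟩
    have e2 := mean_congr e
    rw [mean_add, mean_Lh, mean_const, hg, zero_add] at e2
    refine ⟨e2, fun i j hj => ?_⟩
    have := e i j hj
    simpa [e2] using this
  have hinj : Function.Injective R := by
    rw [← LinearMap.ker_eq_bot, LinearMap.ker_eq_bot']
    intro w hw
    have hs := key w (fun _ _ => 0) (mean_const 0) (fun i j => by rw [hw]; rfl)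
    have hc := const_of_Lh hs.2
    have h0 : ext w 0 0 = 0 := by
      have := mean_congr (g := fun _ _ => ext w 0 0) hc
      rw [mean_const, hs.1] at this
      exact this.symm
    funext i j
    rw [← hext w i j, hc i j (Nat.lt_succ_iff.mp j.isLt), h0]
    rfl
  obtain ⟨w, hw⟩ := (LinearMap.injective_iff_surjective.mp hinj) (fun i j => f i (j : ℕ))
  exact ⟨ext w, key w f hf (fun i j => by rw [hw])⟩

/-- `L_h` is a bijection of the mean-zero grid functions: uniqueness. -/
theorem solvesLh_unique {f ψ χ : Grid N} (h₁ : SolvesLh f ψ) (h₂ : SolvesLh f χ)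
    (i : ZMod N) (j : ℕ) (hj : j ≤ N) : ψ i j = χ i j := by
  have hc := const_of_Lh (f := ψ + (-1 : ℝ) • χ) (fun i j hj => by
    rw [Lh_add, Lh_smul]; simp [h₁.2 i j hj, h₂.2 i j hj])
  have hm := mean_congr (g := fun _ _ => (ψ + (-1 : ℝ) • χ) 0 0) hc
  rw [mean_const, mean_add, mean_smul, h₁.1, h₂.1] at hm
  have := hc i j hj
  rw [← hm] at this
  simp at this
  linarith

theorem meanΓ_const (c : ℝ) : meanΓ (N := N) (fun _ => c) = c := by
  have hN' : (N : ℝ) ≠ 0 := by exact_mod_cast NeZero.ne N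
  simp [meanΓ, ipΓ, mesh]
  field_simp

/-- Uniqueness of the mean-zero solution of `-D_x² ψ = f`. -/
theorem solvesDxx_unique {f ψ χ : BdryGrid N} (h₁ : SolvesDxx f ψ) (h₂ : SolvesDxx f χ) :
    ψ = χ := by
  have hz : ∀ i, Dxx (ψ - χ) i = 0 := by
    intro i
    have e1 := h₁.2 i
    have e2 := h₂.2 i
    have : Dxx (ψ - χ) i = Dxx ψ i - Dxx χ i := by simp only [Dxx, Pi.sub_apply]; ring
    linarith
  have hs := sum_mul_Dxx (ψ - χ) (ψ - χ)
  simp only [hz, neg_zero, mul_zero, Finset.sum_const_zero] at hs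
  have hd := (Finset.sum_eq_zero_iff_of_nonneg (fun i _ => mul_self_nonneg _)).mp hs.symm
  have hc := const_of_Dx (f := ψ - χ) (fun i => mul_self_eq_zero.mp (hd i (Finset.mem_univ i)))
  have hm : meanΓ (ψ - χ) = (ψ - χ) 0 := by
    rw [show ψ - χ = fun _ => (ψ - χ) 0 from funext hc, meanΓ_const]
  have hm' : meanΓ (ψ - χ) = meanΓ ψ - meanΓ χ := by
    simp only [meanΓ, ipΓ, Pi.sub_apply, mul_one, Finset.sum_sub_distrib, mul_sub]
  rw [h₁.1, h₂.1] at hm'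
  funext i
  have := hc i
  rw [← hm, hm'] at this
  simp at this
  linarith

/-- Existence of the mean-zero solution of `-D_x² ψ = f` for mean-zero `f`. -/
theorem exists_solvesDxx {f : BdryGrid N} (hf : meanΓ f = 0) : ∃ ψ, SolvesDxx f ψ := by
  have hadd : ∀ v w : BdryGrid N, meanΓ (v + w) = meanΓ v + meanΓ w := by
    intro v w
    simp only [meanΓ, ipΓ, Pi.add_apply, mul_one, Finset.sum_add_distrib, mul_add]
  let R : BdryGrid N →ₗ[ℝ] BdryGrid N :=
    { toFun := fun w => (fun i => - Dxx w i) + fun _ => meanΓ w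
      map_add' := by
        intro v w; funext i
        simp only [hadd, Pi.add_apply, Dxx]; ring
      map_smul' := by
        intro c w; funext i
        have : meanΓ (c • w) = c * meanΓ w := by
          simp only [meanΓ, ipΓ, Pi.smul_apply, smul_eq_mul, mul_one, ← Finset.mul_sum]; ring
        simp only [this, Pi.add_apply, Pi.smul_apply, smul_eq_mul, Dxx, RingHom.id_apply]; ring }
  have hD : ∀ w : BdryGrid N, meanΓ (fun i => - Dxx w i) = 0 := by
    intro w
    have := sum_mul_Dxx (fun _ => (1 : ℝ)) w
    simp only [one_mul] at this
    simp only [meanΓ, ipΓ, mul_one, this]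
    simp [Dx]
  have key : ∀ w g : BdryGrid N, meanΓ g = 0 → R w = g → SolvesDxx g w := by
    intro w g hg hw
    have e : meanΓ (R w) = meanΓ w := by
      change meanΓ ((fun i => - Dxx w i) + fun _ => meanΓ w) = _
      rw [hadd, hD, meanΓ_const, zero_add]
    rw [hw, hg] at e
    refine ⟨e.symm, fun i => ?_⟩
    have := congrFun hw i
    change - Dxx w i + meanΓ w = g i at this
    rw [← e] at this
    simpa using this
  have hinj : Function.Injective R := by
    rw [← LinearMap.ker_eq_bot, LinearMap.ker_eq_bot']
    intro w hw
    refine solvesDxx_unique (key w 0 (meanΓ_const 0) hw) ⟨meanΓ_const 0, fun i => ?_⟩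
    simp [Dxx]
  obtain ⟨w, hw⟩ := (LinearMap.injective_iff_surjective.mp hinj) f
  exact ⟨w, key w f hf hw⟩

/-- For mean-zero `f`, `invLh f` is the mean-zero solution of `L_h ψ = f`. -/
theorem invLh_spec {f : Grid N} (hf : mean f = 0) : SolvesLh f (invLh f) :=
  Classical.epsilon_spec (exists_solvesLh hf)

/-- For mean-zero `f`, `invDxx f` is the mean-zero solution of `-D_x² ψ = f`. -/
theorem invDxx_spec {f : BdryGrid N} (hf : meanΓ f = 0) : SolvesDxx f (invDxx f) :=
  Classical.epsilon_spec (exists_solvesDxx hf)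

end WellPosed

end CHDBC

end

open CHDBC

noncomputable section

namespace CHDBC

open Finset

section DiscreteForms

set_option linter.unusedSectionVars false

variable {N : ℕ} [NeZero N]

/-! ### The discrete bilinear forms -/

/-! Let `P` be the corrected projection of the exact solution (`refGrid`) and `e = P - φ`. The proof
is an energy estimate in negative norms: the error equation is tested with `L_h⁻¹ e` in the bulk and
`(-D_x²)⁻¹ e` on each side, at the new time level. This needs the three masses of `e` to vanish.

Stability. In the weak form of the scheme (`BDF2Step.weak`) the normal derivatives in the bulk and
surface potentials cancel, so the ghost rows disappear and only Dirichlet energies of the bulk and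
of the sides remain. The logarithm is monotone, so its contribution has a good sign
(`logGrid_massForm_nonneg`); the numerical solution need not stay uniformly away from `±1`. The BDF2
difference telescopes up to a square (`form_bdf2_identity`), and so do the `A` and `B` terms. The
extrapolated `θ₀` term pairs old potentials with the new error: Young's inequality absorbs the new
factor in the dissipation and leaves only old levels, so a Gronwall argument closes
(`error_inequality`, `bdfEnergy_step`, `stability`).

Consistency. The sampled potentials of the exact solution satisfy the discrete equations to second
order in the interior. On the boundary rows `L_h` has an `O(h)` truncation error, which is harmless
because these rows carry an extra weight `h` and the traces are controlled by the energy
(`SmallResidual.abs_ip_le` with the Poincaré inequalities). The large term `(2/h) ∂_n Φ` that `L_h`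
produces there matches exactly the term `ε² ∂_n Φ` of the surface potentials
(`weak_residual_identity`). The projection error is `O(h³)`, so even its difference quotients are
`O(h²)` (`exists_fourierProj_bound`).

Mass. With `N = 2K + 1` points the grid mean of the projection is the exact integral, so the side
masses are conserved exactly. The trapezoidal rule in `y` conserves the bulk mass only up to
`O(h²)`; the correction `δΦ` removes this defect without touching the sides, and the defect is
Lipschitz in time with constant `O(h²)` (`exists_massExcess_bound`). Hence `δΦ` does not spoil
consistency, and `e` stays mass-free (`MassFree.step`). -/

theorem ip_add_left (f g v : Grid N) : ip (f + g) v = ip f v + ip g v := by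
  simp only [ip, Pi.add_apply, mul_add, add_mul, sum_add_distrib]

theorem ip_smul_left (c : ℝ) (f v : Grid N) : ip (c • f) v = c * ip f v := by
  simp only [ip, Pi.smul_apply, smul_eq_mul, mul_sum]
  refine sum_congr rfl fun i _ => sum_congr rfl fun j _ => ?_
  ring

theorem ip_congr {f f' g g' : Grid N}
    (h : ∀ i : ZMod N, ∀ j : ℕ, j ≤ N → f i j * g i j = f' i j * g' i j) : ip f g = ip f' g' := by
  unfold ip
  congr 1
  refine sum_congr rfl fun i _ => sum_congr rfl fun j hj => ?_
  rw [mul_assoc, h i j (Nat.lt_succ_iff.mp (mem_range.mp hj)), mul_assoc]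

theorem ipΓ_comm (f g : BdryGrid N) : ipΓ f g = ipΓ g f := by
  simp only [ipΓ, mul_comm]

/-- The bulk inner product as a bilinear form. -/
def ipForm (N : ℕ) [NeZero N] : LinearMap.BilinForm ℝ (Grid N) :=
  LinearMap.mk₂ ℝ ip ip_add_left ip_smul_left
    (fun f g v => by rw [ip_comm, ip_add_left, ip_comm f, ip_comm f])
    (fun c f g => by rw [ip_comm, ip_smul_left, ip_comm f]; rfl)

@[simp] theorem ipForm_apply (f g : Grid N) : ipForm N f g = ip f g := rfl

/-- The boundary inner product as a bilinear form. -/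
def ipΓForm (N : ℕ) [NeZero N] : LinearMap.BilinForm ℝ (BdryGrid N) :=
  LinearMap.mk₂ ℝ ipΓ
    (fun f g v => by simp only [ipΓ, Pi.add_apply, mul_add, add_mul, sum_add_distrib])
    (fun c f v => by simp only [ipΓ, Pi.smul_apply, smul_eq_mul, mul_sum]; congr! 1; ring)
    (fun f g v => by simp only [ipΓ, Pi.add_apply, mul_add, sum_add_distrib])
    (fun c f v => by simp only [ipΓ, Pi.smul_apply, smul_eq_mul, mul_sum]; congr! 1; ring)

@[simp] theorem ipΓForm_apply (f g : BdryGrid N) : ipΓForm N f g = ipΓ f g := rfl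

/-- `L_h` as a linear map. -/
def LhLin (N : ℕ) [NeZero N] : Grid N →ₗ[ℝ] Grid N where
  toFun := Lh
  map_add' := Lh_add
  map_smul' := Lh_smul

/-- `D_x` as a linear map. -/
def DxLin (N : ℕ) [NeZero N] : BdryGrid N →ₗ[ℝ] BdryGrid N where
  toFun := Dx
  map_add' f g := by funext i; simp only [Dx, Pi.add_apply]; ring
  map_smul' c f := by
    funext i; simp only [Dx, Pi.smul_apply, smul_eq_mul, RingHom.id_apply]; ring

/-- Restriction to the row `j` as a linear map. -/
def rowLin (N : ℕ) (j : ℤ) : Grid N →ₗ[ℝ] BdryGrid N where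
  toFun f := fun i => f i j
  map_add' _ _ := rfl
  map_smul' _ _ := rfl

@[simp] theorem rowLin_zero (f : Grid N) : rowLin N 0 f = bot f := rfl
@[simp] theorem rowLin_N (f : Grid N) : rowLin N N f = top f := rfl

/-- The discrete Dirichlet form `(f, L_h g)`. -/
def gradForm (N : ℕ) [NeZero N] : LinearMap.BilinForm ℝ (Grid N) :=
  (ipForm N).compl₁₂ LinearMap.id (LhLin N)

theorem gradForm_apply (f g : Grid N) : gradForm N f g = ip f (Lh g) := rfl

/-- The Dirichlet form `(D_x f, D_x g)_Γ` of one side. -/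
def dxForm (N : ℕ) [NeZero N] : LinearMap.BilinForm ℝ (BdryGrid N) :=
  (ipΓForm N).compl₁₂ (DxLin N) (DxLin N)

theorem dxForm_apply (f g : BdryGrid N) : dxForm N f g = ipΓ (Dx f) (Dx g) := rfl

theorem dxForm_eq (f g : BdryGrid N) : dxForm N f g = ipΓ f (fun i => - Dxx g i) := by
  rw [dxForm_apply, ipΓ, ipΓ, sum_mul_Dxx]

theorem dxForm_comm (f g : BdryGrid N) : dxForm N f g = dxForm N g f := by
  simp only [dxForm_apply, ipΓ_comm]

theorem dxForm_nonneg (f : BdryGrid N) : 0 ≤ dxForm N f f :=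
  mul_nonneg mesh_pos.le (sum_nonneg fun _ _ => mul_self_nonneg _)

theorem gradForm_expand (f g : Grid N) : gradForm N f g =
    mesh N ^ 2 * (∑ j ∈ range (N + 1), weight N j *
        ∑ i : ZMod N, Dx (fun k => f k j) i * Dx (fun k => g k j) i
      + ∑ i : ZMod N, ∑ j ∈ range N,
        (f i (j + 1) - f i j) / mesh N * ((g i (j + 1) - g i j) / mesh N)) := ip_Lh f g

theorem gradForm_comm (f g : Grid N) : gradForm N f g = gradForm N g f := by
  rw [gradForm_expand, gradForm_expand]
  congr 2
  · exact sum_congr rfl fun j _ => congrArg _ (sum_congr rfl fun i _ => mul_comm _ _)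
  · exact sum_congr rfl fun i _ => sum_congr rfl fun j _ => mul_comm _ _

theorem gradForm_self (f : Grid N) : gradForm N f f = gradSq f := by
  rw [gradForm_expand, gradSq, ip, mul_add]
  congr 2
  · rw [sum_comm (s := univ)]
    refine sum_congr rfl fun j _ => ?_
    simp only [mul_one, ← mul_sum]
    congr 1
    rw [← sum_div, sum_add_distrib]
    -- Periodicity makes the left and right half-points contribute equally, so the average in the
    -- gradient norm can be undone.
    have := Equiv.sum_comp (Equiv.subRight (1 : ZMod N)) (fun i => Dx (fun k => f k j) i ^ 2)
    simp only [Equiv.subRight_apply] at this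
    rw [this, ← two_mul, mul_div_cancel_left₀ _ two_ne_zero]
    simp only [sq]
  · simp only [sq]

theorem gradForm_nonneg (f : Grid N) : 0 ≤ gradForm N f f := by
  rw [gradForm_expand]
  refine mul_nonneg (sq_nonneg _) (add_nonneg ?_ ?_)
  · exact sum_nonneg fun j _ => mul_nonneg (weight_pos j).le (sum_nonneg fun _ _ => mul_self_nonneg _)
  · exact sum_nonneg fun _ _ => sum_nonneg fun _ _ => mul_self_nonneg _

theorem dxSqΓ_eq (f : Grid N) : dxSqΓ f = dxForm N (top f) (top f) + dxForm N (bot f) (bot f) := rfl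

theorem gradSq_nonneg (f : Grid N) : 0 ≤ gradSq f := gradForm_self f ▸ gradForm_nonneg f

theorem dxSqΓ_nonneg (f : Grid N) : 0 ≤ dxSqΓ f :=
  add_nonneg (dxForm_nonneg _) (dxForm_nonneg _)

/-- A grid function on the sides, extended to the bulk by zero, pairs with weight `h / 2`. -/
theorem ip_indicator_row (b : BdryGrid N) (v : Grid N) {l : ℕ} (hl : l = 0 ∨ l = N) :
    ip (fun i j => if j = (l : ℤ) then b i else 0) v
      = mesh N / 2 * ipΓ b (fun i => v i l) := by
  have hmem : l ∈ range (N + 1) := by rcases hl with h | h <;> simp [h]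
  have hw : weight N l = 1 / 2 := by simp [weight, hl]
  unfold ip ipΓ
  rw [← mul_assoc, show mesh N / 2 * mesh N = mesh N ^ 2 * (1 / 2) by ring, mul_assoc]
  congr 1
  rw [mul_sum]
  refine sum_congr rfl fun i _ => ?_
  rw [sum_eq_single_of_mem l hmem]
  · rw [hw]; simp; ring
  · intro j _ hj
    simp [hj]

/-- The five-point Laplacian and `L_h` differ by the normal derivatives on the two sides. -/
theorem ip_lapH (f v : Grid N) : ip (lapH f) v = - gradForm N v f
    - ipΓ (Dy f 0) (bot v) + ipΓ (Dy f N) (top v) := by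
  have hm : mesh N ≠ 0 := mesh_pos.ne'
  have hN : N ≠ 0 := NeZero.ne N
  have h : ip (lapH f) v = ip ((-1 : ℝ) • Lh f
      + ((-(2 / mesh N)) • (fun i j => if j = ((0 : ℕ) : ℤ) then Dy f 0 i else 0)
        + (2 / mesh N) • (fun i j => if j = (N : ℤ) then Dy f N i else 0))) v := by
    refine ip_congr fun i j _ => ?_
    congr 1
    simp only [Pi.add_apply, Pi.smul_apply, smul_eq_mul, Lh, lapH, Dy]
    by_cases h0 : (j : ℤ) = 0
    · have h1 : ((0 : ℤ) = N) = False := by simp; omega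
      simp only [h0, Nat.cast_zero, if_true, h1, if_false]
      simp only [zero_add, zero_sub]
      field_simp
      ring
    · by_cases h1 : (j : ℤ) = N
      · have h2 : ((N : ℤ) = 0) = False := by simp [hN]
        simp only [h1, Nat.cast_zero, h2, if_true, if_false]
        field_simp
        ring
      · simp only [h0, h1, if_false, Nat.cast_zero]
        ring
  rw [h, ip_add_left, ip_add_left, ip_smul_left, ip_smul_left, ip_smul_left,
    ip_indicator_row _ _ (Or.inl rfl), ip_indicator_row _ _ (Or.inr rfl), gradForm_apply, ip_comm v]
  simp only [Nat.cast_zero]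
  unfold top bot
  field_simp
  ring

/-- The discrete Neumann condition makes each ghost row the reflection of the first interior row,
which is what is built into `Lh`. -/
theorem lapH_eq_neg_Lh {μ : Grid N} (h : ∀ i : ZMod N, Dy μ 0 i = 0 ∧ Dy μ N i = 0) (i : ZMod N)
    {j : ℕ} : lapH μ i j = - Lh μ i j := by
  have hm : (2 * mesh N) ≠ 0 := (mul_pos two_pos mesh_pos).ne'
  have h1 := (h i).1
  have h2 := (h i).2
  simp only [Dy, div_eq_zero_iff, hm, or_false, zero_add, zero_sub] at h1 h2
  simp only [Lh]
  split_ifs with h3 h4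
  · simp only [lapH, h3, zero_add, zero_sub]
    rw [show μ i (-1) = μ i 1 by linarith]
    ring
  · simp only [lapH, h4]
    rw [show μ i (N + 1) = μ i (N - 1) by linarith]
    ring
  · ring

/-! ### Discrete Poincaré inequalities -/

theorem sq_sub_le_sum_sq_diff (F : ℕ → ℝ) {M a b : ℕ} (ha : a ≤ M) (hb : b ≤ M) :
    (F b - F a) ^ 2 ≤ M * ∑ n ∈ range M, (F (n + 1) - F n) ^ 2 := by
  wlog hab : a ≤ b generalizing a b
  · rw [← neg_sub, neg_sq]
    exact this hb ha (by omega)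
  rw [← sum_Ico_sub F hab]
  refine (sq_sum_le_card_mul_sum_sq).trans ?_
  rw [Nat.card_Ico]
  refine mul_le_mul (by exact_mod_cast (by omega)) ?_ (sum_nonneg fun _ _ => sq_nonneg _)
    (Nat.cast_nonneg _)
  refine sum_le_sum_of_subset_of_nonneg (fun n hn => ?_) fun _ _ _ => sq_nonneg _
  rw [mem_Ico] at hn
  rw [mem_range]
  omega

theorem sum_range_natCast {M : Type*} [AddCommMonoid M] (f : ZMod N → M) : ∑ n ∈ range N, f (n : ZMod N) = ∑ i, f i := by
  refine sum_nbij' (fun n => (n : ZMod N)) (fun i => i.val) (by simp) ?_ ?_ (by simp) (by simp)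
  · intro i _
    exact mem_range.mpr (ZMod.val_lt i)
  · intro n hn
    exact ZMod.val_cast_of_lt (mem_range.mp hn)

theorem mesh_mul (N : ℕ) [NeZero N] : mesh N * N = 1 := by
  have hN' : (N : ℝ) ≠ 0 := by exact_mod_cast NeZero.ne N
  unfold mesh; field_simp

theorem mesh_mul_sum_const (c : ℝ) : mesh N * ∑ _i : ZMod N, c = c := by
  rw [sum_const, card_univ, ZMod.card, nsmul_eq_mul, ← mul_assoc, mesh_mul, one_mul]

theorem sq_mesh_sum_le (g : ZMod N → ℝ) : (mesh N * ∑ i, g i) ^ 2 ≤ mesh N * ∑ i, g i ^ 2 := by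
  have h := sq_sum_le_card_mul_sum_sq (s := (univ : Finset (ZMod N))) (f := g)
  rw [card_univ, ZMod.card] at h
  calc (mesh N * ∑ i, g i) ^ 2 = mesh N ^ 2 * (∑ i, g i) ^ 2 := by ring
    _ ≤ mesh N ^ 2 * (N * ∑ i, g i ^ 2) := by gcongr
    _ = mesh N * N * (mesh N * ∑ i, g i ^ 2) := by ring
    _ = _ := by rw [mesh_mul, one_mul]

theorem mesh_sum_le_sqrt (g : ZMod N → ℝ) {c : ℝ} (h : mesh N * ∑ i, g i ^ 2 ≤ c) :
    mesh N * ∑ i, g i ≤ √c :=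
  Real.le_sqrt_of_sq_le ((sq_mesh_sum_le g).trans h)

/-- Cauchy–Schwarz along a path inside one period, whose total length is one; the sum is then
enlarged to all `N` links. -/
theorem sq_sub_le_dxForm (f : BdryGrid N) (i k : ZMod N) : (f i - f k) ^ 2 ≤ dxForm N f f := by
  have h := sq_sub_le_sum_sq_diff (fun n : ℕ => f (n : ZMod N)) (ZMod.val_lt k).le
    (ZMod.val_lt i).le
  simp only [ZMod.natCast_val, ZMod.cast_id', id_eq, Nat.cast_add, Nat.cast_one] at h
  refine h.trans (le_of_eq ?_)
  rw [sum_range_natCast (fun i => (f (i + 1) - f i) ^ 2), dxForm_apply, ipΓ, mul_sum, mul_sum]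
  refine sum_congr rfl fun i _ => ?_
  have hm : mesh N ≠ 0 := mesh_pos.ne'
  have h1 := mesh_mul N
  simp only [Dx]
  field_simp
  linear_combination (f (i + 1) - f i) ^ 2 * h1

/-- Poincaré inequality on a side. -/
theorem abs_le_sqrt_dxForm {f : BdryGrid N} (hf : meanΓ f = 0) (i : ZMod N) :
    |f i| ≤ √(dxForm N f f) := by
  have h : f i = mesh N * ∑ k, (f i - f k) := by
    rw [sum_sub_distrib, mul_sub, mesh_mul_sum_const]
    have : mesh N * ∑ k, f k = 0 := by simpa [meanΓ, ipΓ] using hf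
    rw [this, sub_zero]
  rw [h, abs_mul, abs_of_pos mesh_pos]
  calc mesh N * |∑ k, (f i - f k)| ≤ mesh N * ∑ _k : ZMod N, √(dxForm N f f) := by
        refine mul_le_mul_of_nonneg_left ?_ mesh_pos.le
        refine (abs_sum_le_sum_abs _ _).trans (sum_le_sum fun k _ => ?_)
        exact Real.abs_le_sqrt (sq_sub_le_dxForm f i k)
    _ = _ := mesh_mul_sum_const _

/-- The vertical Dirichlet energy of a column. -/
def colEnergy (f : Grid N) (i : ZMod N) : ℝ :=
  mesh N * ∑ j ∈ range N, ((f i (j + 1) - f i j) / mesh N) ^ 2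

theorem colEnergy_nonneg (f : Grid N) (i : ZMod N) : 0 ≤ colEnergy f i :=
  mul_nonneg mesh_pos.le (sum_nonneg fun _ _ => sq_nonneg _)

theorem abs_sub_le_colEnergy (f : Grid N) (i : ZMod N) {j l : ℕ} (hj : j ≤ N) (hl : l ≤ N) :
    |f i j - f i l| ≤ √(colEnergy f i) := by
  refine Real.abs_le_sqrt ?_
  have h := sq_sub_le_sum_sq_diff (fun n : ℕ => f i n) hl hj
  refine h.trans (le_of_eq ?_)
  have hm : mesh N ≠ 0 := mesh_pos.ne'
  have h1 := mesh_mul N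
  rw [colEnergy, mul_sum, mul_sum]
  refine sum_congr rfl fun n _ => ?_
  field_simp
  push_cast
  linear_combination (f i (n + 1) - f i n) ^ 2 * h1

theorem sum_weight : mesh N * ∑ j ∈ range (N + 1), weight N j = 1 := by
  have h := mean_const (N := N) 1
  simp only [mean, ip, mul_one] at h
  rw [sum_const, card_univ, ZMod.card, nsmul_eq_mul] at h
  calc _ = mesh N * N * (mesh N * ∑ j ∈ range (N + 1), weight N j) := by rw [mesh_mul, one_mul]
    _ = _ := by rw [← h]; ring

theorem weighted_const (c : ℝ) : mesh N * ∑ j ∈ range (N + 1), weight N j * c = c := by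
  rw [← sum_mul, ← mul_assoc, sum_weight, one_mul]

theorem gradSq_eq (f : Grid N) : gradSq f
    = mesh N * ∑ j ∈ range (N + 1), weight N j * dxForm N (fun i => f i j) (fun i => f i j)
      + mesh N * ∑ i, colEnergy f i := by
  rw [← gradForm_self, gradForm_expand, mul_add]
  congr 1
  · rw [mul_sum, mul_sum]
    refine sum_congr rfl fun j _ => ?_
    rw [dxForm_apply, ipΓ]
    ring
  · rw [mul_sum, mul_sum]
    refine sum_congr rfl fun i _ => ?_
    rw [colEnergy]
    simp only [sq]
    ring

theorem colEnergy_sum_le (f : Grid N) : mesh N * ∑ i, colEnergy f i ≤ gradSq f := by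
  rw [gradSq_eq]
  refine le_add_of_nonneg_left (mul_nonneg mesh_pos.le (sum_nonneg fun j _ => ?_))
  exact mul_nonneg (weight_pos j).le (dxForm_nonneg _)

theorem rowEnergy_sum_le (f : Grid N) :
    mesh N * ∑ j ∈ range (N + 1), weight N j * dxForm N (fun i => f i j) (fun i => f i j)
      ≤ gradSq f := by
  rw [gradSq_eq]
  exact le_add_of_nonneg_right (mul_nonneg mesh_pos.le (sum_nonneg fun i _ => colEnergy_nonneg f i))

/-- A single column energy is not controlled by `gradSq` uniformly in `h`, only the average over
columns is. The pointwise bounds below therefore keep `colEnergy f i` and are used after summation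
over `i`. -/
theorem sum_sqrt_colEnergy_le (f : Grid N) : mesh N * ∑ i, √(colEnergy f i) ≤ √(gradSq f) := by
  refine mesh_sum_le_sqrt _ ?_
  simp only [Real.sq_sqrt (colEnergy_nonneg f _)]
  exact colEnergy_sum_le f

theorem sum_weight_sqrt_le {a : ℕ → ℝ} (ha : ∀ j, 0 ≤ a j) :
    mesh N * ∑ j ∈ range (N + 1), weight N j * √(a j)
      ≤ √(mesh N * ∑ j ∈ range (N + 1), weight N j * a j) := by
  refine Real.le_sqrt_of_sq_le ?_
  have h := sum_mul_sq_le_sq_mul_sq (range (N + 1)) (fun j => √(weight N j))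
    (fun j => √(weight N j) * √(a j))
  have e1 : ∀ j, √(weight N j) * (√(weight N j) * √(a j)) = weight N j * √(a j) := fun j => by
    rw [← mul_assoc, Real.mul_self_sqrt (weight_pos j).le]
  have e2 : ∀ j, (√(weight N j) * √(a j)) ^ 2 = weight N j * a j := fun j => by
    rw [mul_pow, Real.sq_sqrt (weight_pos j).le, Real.sq_sqrt (ha j)]
  simp only [e1, e2, Real.sq_sqrt (weight_pos _).le] at h
  calc _ = mesh N ^ 2 * (∑ j ∈ range (N + 1), weight N j * √(a j)) ^ 2 := by ring
    _ ≤ mesh N ^ 2 * ((∑ j ∈ range (N + 1), weight N j)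
        * ∑ j ∈ range (N + 1), weight N j * a j) := by gcongr
    _ = (mesh N * ∑ j ∈ range (N + 1), weight N j)
        * (mesh N * ∑ j ∈ range (N + 1), weight N j * a j) := by ring
    _ = _ := by rw [sum_weight, one_mul]

/-- Two points are joined by moving vertically to row `r`, along that row, and vertically again.
Averaging over `r` with the trapezoidal weights turns the row energies into the bulk energy. -/
theorem abs_sub_le_of_gradSq (f : Grid N) (i k : ZMod N) {j l : ℕ} (hj : j ≤ N) (hl : l ≤ N) :
    |f i j - f k l| ≤ √(colEnergy f i) + √(colEnergy f k) + √(gradSq f) := by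
  have h : ∀ r ∈ range (N + 1), weight N r * |f i j - f k l| ≤ weight N r *
      (√(colEnergy f i) + √(colEnergy f k))
        + weight N r * √(dxForm N (fun i => f i r) (fun i => f i r)) := by
    intro r hr
    have hr := Nat.lt_succ_iff.mp (mem_range.mp hr)
    rw [← mul_add]
    refine mul_le_mul_of_nonneg_left ?_ (weight_pos r).le
    have h1 := abs_sub_le_colEnergy f i hj hr
    have h2 := abs_sub_le_colEnergy f k hr hl
    have h3 := Real.abs_le_sqrt (sq_sub_le_dxForm (fun i => f i r) i k)
    have h4 := abs_sub_le (f i j) (f i r) (f k l)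
    have h5 := abs_sub_le (f i r) (f k r) (f k l)
    linarith
  have h2 := mul_le_mul_of_nonneg_left (sum_le_sum h) (mesh_pos (N := N)).le
  rw [sum_add_distrib, mul_add, weighted_const, weighted_const] at h2
  have h3 := (sum_weight_sqrt_le (N := N)
    (fun j => dxForm_nonneg (fun i => f i j))).trans (Real.sqrt_le_sqrt (rowEnergy_sum_le f))
  linarith

/-- Poincaré inequality in the bulk. -/
theorem abs_le_of_mean_eq_zero {f : Grid N} (hf : mean f = 0) (i : ZMod N) {j : ℕ} (hj : j ≤ N) :
    |f i j| ≤ √(colEnergy f i) + 2 * √(gradSq f) := by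
  have h0 : f i j = mesh N * ∑ k, mesh N * ∑ l ∈ range (N + 1), weight N l * (f i j - f k l) := by
    have hm : mesh N * ∑ k, mesh N * ∑ l ∈ range (N + 1), weight N l * f k l = 0 := by
      rw [← hf, mean, ip, ← mul_sum, ← mul_assoc, sq]
      simp
    simp only [mul_sub, sum_sub_distrib, weighted_const]
    rw [mesh_mul_sum_const, hm, sub_zero]
  rw [h0]
  have hs := sum_sqrt_colEnergy_le f
  calc |mesh N * ∑ k, mesh N * ∑ l ∈ range (N + 1), weight N l * (f i j - f k l)|
      ≤ mesh N * ∑ k, mesh N * ∑ l ∈ range (N + 1), weight N l * |f i j - f k l| := by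
        rw [abs_mul, abs_of_pos mesh_pos]
        refine mul_le_mul_of_nonneg_left ((abs_sum_le_sum_abs _ _).trans (sum_le_sum fun k _ => ?_))
          mesh_pos.le
        rw [abs_mul, abs_of_pos mesh_pos]
        refine mul_le_mul_of_nonneg_left ((abs_sum_le_sum_abs _ _).trans (sum_le_sum fun l _ => ?_))
          mesh_pos.le
        rw [abs_mul, abs_of_pos (weight_pos l)]
    _ ≤ mesh N * ∑ k, (√(colEnergy f i) + √(gradSq f) + √(colEnergy f k)) := by
        refine mul_le_mul_of_nonneg_left (sum_le_sum fun k _ => ?_) mesh_pos.le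
        rw [← weighted_const (N := N) (√(colEnergy f i) + √(gradSq f) + √(colEnergy f k))]
        refine mul_le_mul_of_nonneg_left (sum_le_sum fun l hl => ?_) mesh_pos.le
        refine mul_le_mul_of_nonneg_left ?_ (weight_pos l).le
        have := abs_sub_le_of_gradSq f i k hj (Nat.lt_succ_iff.mp (mem_range.mp hl))
        linarith
    _ = √(colEnergy f i) + √(gradSq f) + mesh N * ∑ k, √(colEnergy f k) := by
        rw [sum_add_distrib, mul_add, mesh_mul_sum_const]
    _ ≤ _ := by linarith

theorem abs_le_of_meanΓ_bot {f : Grid N} (hf : meanΓ (bot f) = 0) (i : ZMod N) {j : ℕ}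
    (hj : j ≤ N) : |f i j| ≤ √(colEnergy f i) + √(dxForm N (bot f) (bot f)) := by
  have h1 := abs_sub_le_colEnergy f i hj (Nat.zero_le N)
  have h2 := abs_le_sqrt_dxForm hf i
  simp only [Nat.cast_zero] at h1
  have h3 := abs_sub_abs_le_abs_sub (f i j) (f i 0)
  change |f i 0| ≤ _ at h2
  linarith

end DiscreteForms

/-! ### Energy stability of the BDF2 time stepping -/

section Abstract

variable {V W : Type*} [AddCommGroup V] [Module ℝ V] [AddCommGroup W] [Module ℝ W]

theorem two_mul_form_le {Q : LinearMap.BilinForm ℝ V} (hs : ∀ x y, Q x y = Q y x)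
    (hp : ∀ x, 0 ≤ Q x x) {η : ℝ} (hη : 0 < η) (x y : V) :
    2 * Q x y ≤ η * Q x x + η⁻¹ * Q y y := by
  have h := hp (η • x - y)
  simp only [map_sub, map_smul, LinearMap.sub_apply, LinearMap.smul_apply, smul_eq_mul, hs y x] at h
  have h2 : 0 ≤ η⁻¹ * (η * (η * Q x x) - η * Q x y - (η * Q x y - Q y y)) :=
    mul_nonneg (inv_nonneg.mpr hη.le) (by linarith)
  have h3 : η⁻¹ * (η * (η * Q x x) - η * Q x y - (η * Q x y - Q y y))
      = η * Q x x + η⁻¹ * Q y y - 2 * Q x y := by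
    field_simp
    ring
  linarith

theorem abs_form_le {Q : LinearMap.BilinForm ℝ V} (hs : ∀ x y, Q x y = Q y x)
    (hp : ∀ x, 0 ≤ Q x x) (x y : V) : |Q x y| ≤ √(Q x x) * √(Q y y) := by
  rw [← Real.sqrt_mul (hp x)]
  refine Real.abs_le_sqrt ?_
  have := LinearMap.BilinForm.apply_mul_apply_le_of_forall_zero_le Q hp x y
  rwa [hs y x, ← sq] at this

/-- This is the G-stability of BDF2: apart from a square, the right-hand side is the difference of
one quadratic energy at two consecutive levels. -/
theorem form_bdf2_identity {Q : LinearMap.BilinForm ℝ V} (hs : ∀ x y, Q x y = Q y x) (a b c : V) :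
    2 * Q ((3 : ℝ) • a - (4 : ℝ) • b + c) a = Q a a + Q ((2 : ℝ) • a - b) ((2 : ℝ) • a - b)
      - Q b b - Q ((2 : ℝ) • b - c) ((2 : ℝ) • b - c)
      + Q (a - (2 : ℝ) • b + c) (a - (2 : ℝ) • b + c) := by
  simp only [map_add, map_sub, map_smul, LinearMap.sub_apply, LinearMap.add_apply,
    LinearMap.smul_apply, smul_eq_mul, hs b a, hs c a, hs c b]
  ring

/-- The modified energy of the BDF2 scheme. -/
def bdfEnergy (Q : LinearMap.BilinForm ℝ V) (S : LinearMap.BilinForm ℝ W) (dt : ℝ)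
    (ψ₀ ψ₁ : V) (e₁ : W) : ℝ :=
  (Q ψ₁ ψ₁ + Q ((2 : ℝ) • ψ₁ - ψ₀) ((2 : ℝ) • ψ₁ - ψ₀)) / 4 + dt ^ 2 / 2 * S e₁ e₁

/-- Here `D` is the dissipation, `S` the stabilizing form and `ι` the map that embeds an error into
the space of potentials. Half of `D` pays for the extrapolated term and for the residual, a quarter
each; the other half stays on the left. The extrapolation `2 ψ₁ - ψ₀` already occurs in the old
energy, so the growth factor acts on that energy alone. -/
theorem bdfEnergy_step {Q : LinearMap.BilinForm ℝ V} (hQs : ∀ x y, Q x y = Q y x)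
    (hQp : ∀ x, 0 ≤ Q x x) {S D : LinearMap.BilinForm ℝ W} (hSs : ∀ x y, S x y = S y x)
    (hSp : ∀ x, 0 ≤ S x x) (hDp : ∀ x, 0 ≤ D x x) {ι : W →ₗ[ℝ] V} {dt θ R c : ℝ} (hdt : 0 < dt)
    (hc : 0 < c) {ψ₀ ψ₁ ψ₂ : V} {e₁ e₂ : W} (hD : Q (ι e₂) (ι e₂) ≤ c * D e₂ e₂)
    (h : Q ((3 : ℝ) • ψ₂ - (4 : ℝ) • ψ₁ + ψ₀) ψ₂ / (2 * dt) + D e₂ e₂ + dt * S (e₂ - e₁) e₂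
      ≤ θ * Q ((2 : ℝ) • ψ₁ - ψ₀) (ι e₂) + R * √(D e₂ e₂)) :
    bdfEnergy Q S dt ψ₁ ψ₂ e₂ + dt / 2 * D e₂ e₂
      ≤ (1 + dt * (4 * θ ^ 2 * c)) * bdfEnergy Q S dt ψ₀ ψ₁ e₁ + dt * R ^ 2 := by
  have h1 := form_bdf2_identity hQs ψ₂ ψ₁ ψ₀
  have h2 := hQp (ψ₂ - (2 : ℝ) • ψ₁ + ψ₀)
  have h3 := hSp (e₂ - e₁)
  have h4 : 2 * S (e₂ - e₁) e₂ = S e₂ e₂ - S e₁ e₁ + S (e₂ - e₁) (e₂ - e₁) := by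
    simp only [map_sub, LinearMap.sub_apply, hSs e₁ e₂]
    ring
  -- The parameter `2 c` is chosen so that, after halving, the new error contributes exactly `D e₂
  -- e₂ / 4`.
  have h5 := two_mul_form_le hQs hQp (η := 2 * c) (by positivity)
    (θ • ((2 : ℝ) • ψ₁ - ψ₀)) (ι e₂)
  simp only [map_smul, LinearMap.smul_apply, smul_eq_mul] at h5
  have h6 : (2 * c)⁻¹ * Q (ι e₂) (ι e₂) ≤ D e₂ e₂ / 2 := by
    rw [inv_mul_le_iff₀ (by positivity)]
    linarith
  have h7 : R * √(D e₂ e₂) ≤ R ^ 2 + D e₂ e₂ / 4 := by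
    have := Real.sq_sqrt (hDp e₂)
    nlinarith [sq_nonneg (R - √(D e₂ e₂) / 2)]
  have h8 : Q ((3 : ℝ) • ψ₂ - (4 : ℝ) • ψ₁ + ψ₀) ψ₂ / 2 + dt * D e₂ e₂
      + dt ^ 2 * S (e₂ - e₁) e₂ ≤ dt * (θ * Q ((2 : ℝ) • ψ₁ - ψ₀) (ι e₂)
        + R * √(D e₂ e₂)) := by
    refine le_trans (le_of_eq ?_) (mul_le_mul_of_nonneg_left h hdt.le)
    field_simp
  have h9 : dt * (θ * Q ((2 : ℝ) • ψ₁ - ψ₀) (ι e₂) + R * √(D e₂ e₂))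
      ≤ dt * (c * θ ^ 2 * Q ((2 : ℝ) • ψ₁ - ψ₀) ((2 : ℝ) • ψ₁ - ψ₀) + D e₂ e₂ / 4
        + (R ^ 2 + D e₂ e₂ / 4)) := by
    refine mul_le_mul_of_nonneg_left ?_ hdt.le
    linarith
  have h10 : 0 ≤ dt * (c * θ ^ 2) * Q ψ₁ ψ₁ := mul_nonneg (by positivity) (hQp _)
  have h11 : 0 ≤ dt * (4 * θ ^ 2 * c) * (dt ^ 2 / 2 * S e₁ e₁) :=
    mul_nonneg (by positivity) (mul_nonneg (by positivity) (hSp _))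
  have h12 : dt ^ 2 * (2 * S (e₂ - e₁) e₂) = dt ^ 2 * (S e₂ e₂ - S e₁ e₁)
      + dt ^ 2 * S (e₂ - e₁) (e₂ - e₁) := by rw [h4]; ring
  have h13 : 0 ≤ dt ^ 2 * S (e₂ - e₁) (e₂ - e₁) := mul_nonneg (by positivity) h3
  unfold bdfEnergy
  linarith

end Abstract

/-- Discrete Gronwall inequality. -/
theorem discrete_gronwall {Y : ℕ → ℝ} {a b : ℝ} (ha : 0 ≤ a) (hb : 0 ≤ b) {n : ℕ} (h0 : 0 ≤ Y 0)
    (h : ∀ k < n, Y (k + 1) ≤ (1 + a) * Y k + b) :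
    ∀ k ≤ n, Y k ≤ Real.exp (k * a) * (Y 0 + k * b) := by
  intro k hk
  induction k with
  | zero => simp
  | succ k ih =>
    have h1 := ih (by omega)
    have h2 := h k (by omega)
    have h3 : (1 + a) * Real.exp (k * a) ≤ Real.exp ((k + 1 : ℕ) * a) := by
      have e : ((k + 1 : ℕ) : ℝ) * a = a + k * a := by push_cast; ring
      rw [e, Real.exp_add]
      gcongr
      linarith [Real.add_one_le_exp a]
    have h4 : 1 ≤ Real.exp ((k + 1 : ℕ) * a) := Real.one_le_exp (by positivity)
    calc Y (k + 1) ≤ (1 + a) * (Real.exp (k * a) * (Y 0 + k * b)) + b := by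
          refine h2.trans ?_
          gcongr
      _ = ((1 + a) * Real.exp (k * a)) * (Y 0 + k * b) + 1 * b := by ring
      _ ≤ Real.exp ((k + 1 : ℕ) * a) * (Y 0 + k * b) + Real.exp ((k + 1 : ℕ) * a) * b := by
          gcongr
      _ = _ := by push_cast; ring

section Negative

set_option linter.unusedSectionVars false

variable {N : ℕ} [NeZero N]

/-! ### Combined bulk and boundary forms -/

/-- The weighted sum of the Dirichlet forms of the bulk and of the two sides. -/
def energyForm (N : ℕ) [NeZero N] (a b : ℝ) : LinearMap.BilinForm ℝ (Grid N) :=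
  a • gradForm N + b • ((dxForm N).compl₁₂ (rowLin N N) (rowLin N N)
    + (dxForm N).compl₁₂ (rowLin N 0) (rowLin N 0))

theorem energyForm_apply (a b : ℝ) (f g : Grid N) : energyForm N a b f g
    = a * gradForm N f g + b * (dxForm N (top f) (top g) + dxForm N (bot f) (bot g)) := rfl

theorem energyForm_self (a b : ℝ) (f : Grid N) :
    energyForm N a b f f = a * gradSq f + b * dxSqΓ f := by
  rw [energyForm_apply, gradForm_self, dxSqΓ_eq]

theorem energyForm_comm (a b : ℝ) (f g : Grid N) : energyForm N a b f g = energyForm N a b g f := by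
  rw [energyForm_apply, energyForm_apply, gradForm_comm, dxForm_comm, dxForm_comm (bot f)]

theorem energyForm_nonneg {a b : ℝ} (ha : 0 ≤ a) (hb : 0 ≤ b) (f : Grid N) :
    0 ≤ energyForm N a b f f := by
  rw [energyForm_self]
  exact add_nonneg (mul_nonneg ha (gradSq_nonneg f)) (mul_nonneg hb (dxSqΓ_nonneg f))

/-- The sum of the inner products of the bulk and of the two sides. -/
def massForm (N : ℕ) [NeZero N] : LinearMap.BilinForm ℝ (Grid N) :=
  ipForm N + ((ipΓForm N).compl₁₂ (rowLin N N) (rowLin N N)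
    + (ipΓForm N).compl₁₂ (rowLin N 0) (rowLin N 0))

theorem massForm_apply (f g : Grid N) :
    massForm N f g = ip f g + (ipΓ (top f) (top g) + ipΓ (bot f) (bot g)) := rfl

/-- The Dirichlet form of a triple (bulk, top, bottom) of unrelated potentials. -/
def potForm (N : ℕ) [NeZero N] :
    LinearMap.BilinForm ℝ (Grid N × BdryGrid N × BdryGrid N) :=
  (gradForm N).compl₁₂ (LinearMap.fst ..) (LinearMap.fst ..)
    + ((dxForm N).compl₁₂ (LinearMap.fst .. ∘ₗ LinearMap.snd ..)
        (LinearMap.fst .. ∘ₗ LinearMap.snd ..)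
      + (dxForm N).compl₁₂ (LinearMap.snd .. ∘ₗ LinearMap.snd ..)
        (LinearMap.snd .. ∘ₗ LinearMap.snd ..))

theorem potForm_apply (p q : Grid N × BdryGrid N × BdryGrid N) : potForm N p q
    = gradForm N p.1 q.1 + (dxForm N p.2.1 q.2.1 + dxForm N p.2.2 q.2.2) := rfl

theorem potForm_comm (p q : Grid N × BdryGrid N × BdryGrid N) :
    potForm N p q = potForm N q p := by
  rw [potForm_apply, potForm_apply, gradForm_comm, dxForm_comm, dxForm_comm p.2.2]

theorem potForm_nonneg (p : Grid N × BdryGrid N × BdryGrid N) : 0 ≤ potForm N p p := by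
  rw [potForm_apply]
  exact add_nonneg (gradForm_nonneg _) (add_nonneg (dxForm_nonneg _) (dxForm_nonneg _))

/-- A grid function together with its traces. -/
def withTraces (N : ℕ) : Grid N →ₗ[ℝ] Grid N × BdryGrid N × BdryGrid N :=
  LinearMap.id.prod ((rowLin N N).prod (rowLin N 0))

theorem potForm_withTraces (f : Grid N) :
    potForm N (withTraces N f) (withTraces N f) = energyForm N 1 1 f f := by
  rw [energyForm_apply, one_mul, one_mul]; rfl

/-- The potentials of a mass-free grid function. -/
def potentials (e : Grid N) : Grid N × BdryGrid N × BdryGrid N :=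
  (invLh e, invDxx (top e), invDxx (bot e))

theorem ip_eq_gradForm {e ψ : Grid N} (h : SolvesLh e ψ) (v : Grid N) :
    ip e v = gradForm N ψ v := by
  rw [gradForm_comm, gradForm_apply, ip_comm]
  refine ip_congr fun i j hj => ?_
  rw [h.2 i j hj]

theorem ipΓ_eq_dxForm {e ψ : BdryGrid N} (h : SolvesDxx e ψ) (v : BdryGrid N) :
    ipΓ e v = dxForm N ψ v := by
  rw [dxForm_comm, dxForm_eq, ipΓ_comm]
  congr 1
  funext i
  exact (h.2 i).symm

/-- The duality behind the estimate: an `L²`-type pairing of errors becomes a Dirichlet pairing of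
potentials with a grid function and its traces, and Cauchy–Schwarz for it gives a negative norm
times the energy norm. -/
theorem massForm_eq_potForm {e : Grid N} (he : MassFree e) (v : Grid N) :
    massForm N e v = potForm N (potentials e) (withTraces N v) := by
  rw [massForm_apply, ip_eq_gradForm (invLh_spec he.1), ipΓ_eq_dxForm (invDxx_spec he.2.1),
    ipΓ_eq_dxForm (invDxx_spec he.2.2)]
  rfl

theorem normNeg_sq_add {e : Grid N} (he : MassFree e) :
    normNeg e ^ 2 + normNegΓ e ^ 2 = potForm N (potentials e) (potentials e) := by
  have h1 := ip_eq_gradForm (invLh_spec he.1) (invLh e)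
  have h2 := ipΓ_eq_dxForm (invDxx_spec he.2.1) (invDxx (top e))
  have h3 := ipΓ_eq_dxForm (invDxx_spec he.2.2) (invDxx (bot e))
  rw [normNeg, normNegΓ, normNegSide, normNegSide, h1, h2, h3, Real.sq_sqrt (gradForm_nonneg _),
    Real.sq_sqrt (add_nonneg (sq_nonneg _) (sq_nonneg _)), Real.sq_sqrt (dxForm_nonneg _),
    Real.sq_sqrt (dxForm_nonneg _)]
  rfl

theorem normNeg_add_le {e : Grid N} (he : MassFree e) :
    normNeg e + normNegΓ e ≤ 2 * √(potForm N (potentials e) (potentials e)) := by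
  have h := normNeg_sq_add he
  have h1 : normNeg e ≤ √(potForm N (potentials e) (potentials e)) :=
    Real.le_sqrt_of_sq_le (by nlinarith [sq_nonneg (normNegΓ e)])
  have h2 : normNegΓ e ≤ √(potForm N (potentials e) (potentials e)) :=
    Real.le_sqrt_of_sq_le (by nlinarith [sq_nonneg (normNeg e)])
  linarith

theorem normNeg_nonneg (e : Grid N) : 0 ≤ normNeg e := Real.sqrt_nonneg _

theorem normNegΓ_nonneg (e : Grid N) : 0 ≤ normNegΓ e := Real.sqrt_nonneg _

theorem potForm_potentials_le {e : Grid N} (he : MassFree e) :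
    potForm N (potentials e) (potentials e) ≤ (normNeg e + normNegΓ e) ^ 2 := by
  rw [← normNeg_sq_add he]
  nlinarith [mul_nonneg (normNeg_nonneg e) (normNegΓ_nonneg e)]

/-! ### Pairing with small residuals -/

/-- The `ℓ¹` norm in the bulk and on both sides. -/
def l1Trace (f : Grid N) : ℝ :=
  mesh N * ∑ i, mesh N * ∑ j ∈ range (N + 1), weight N j * |f i j|
    + (mesh N * ∑ i, |top f i| + mesh N * ∑ i, |bot f i|)

/-- Residuals may be larger by a factor `1 / h` on the boundary rows. -/
structure SmallResidual (c : ℝ) (r : Grid N) : Prop where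
  interior : ∀ i, ∀ j : ℕ, 0 < j → j < N → |r i j| ≤ c
  on_top : ∀ i, mesh N * |r i N| ≤ c
  on_bot : ∀ i, mesh N * |r i 0| ≤ c

theorem SmallResidual.nonneg {c : ℝ} {r : Grid N} (h : SmallResidual c r) : 0 ≤ c :=
  (mul_nonneg mesh_pos.le (abs_nonneg _)).trans (h.on_top 0)

/-- A boundary row has weight `h² / 2` in the bulk product but `h` in the side sums of `l1Trace`.
The spare factor `h` compensates a residual of size `c / h`. -/
theorem SmallResidual.abs_ip_le {c : ℝ} {r : Grid N} (h : SmallResidual c r) (g : Grid N) :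
    |ip r g| ≤ c * l1Trace g := by
  have hc := h.nonneg
  have hm := (mesh_pos (N := N)).le
  have key : ∀ i, ∀ j ∈ range (N + 1), mesh N ^ 2 * (weight N j * |r i j| * |g i j|)
      ≤ c * mesh N ^ 2 * (weight N j * |g i j|)
        + ((if j = N then c * mesh N * |top g i| else 0)
          + (if j = 0 then c * mesh N * |bot g i| else 0)) := by
    intro i j hj
    have hj := Nat.lt_succ_iff.mp (mem_range.mp hj)
    have p1 : 0 ≤ c * mesh N ^ 2 * (weight N j * |g i j|) :=
      mul_nonneg (by positivity) (mul_nonneg (weight_pos j).le (abs_nonneg _))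
    by_cases h0 : j = 0
    · subst h0
      have h1 := mul_le_mul_of_nonneg_right (h.on_bot i) (mul_nonneg hm (abs_nonneg (g i 0)))
      have p2 : 0 ≤ mesh N * |r i 0| * (mesh N * |g i 0|) := by positivity
      have p3 : 0 ≤ (if (0 : ℕ) = N then c * mesh N * |top g i| else 0) := by
        split_ifs <;> positivity
      simp only [weight, true_or, if_true, Nat.cast_zero] at p1 ⊢
      unfold bot
      nlinarith
    · by_cases h1 : j = N
      · have h2 := mul_le_mul_of_nonneg_right (h.on_top i) (mul_nonneg hm (abs_nonneg (g i N)))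
        have p2 : 0 ≤ mesh N * |r i N| * (mesh N * |g i N|) := by positivity
        simp only [weight, h1, or_true, if_true, if_false, NeZero.ne N] at p1 ⊢
        unfold top
        nlinarith
      · have h2 := h.interior i j (by omega) (by omega)
        simp only [weight, h0, h1, or_false, if_false] at p1 ⊢
        have : mesh N ^ 2 * (1 * |r i j| * |g i j|) ≤ mesh N ^ 2 * (1 * c * |g i j|) := by gcongr
        linarith
  calc |ip r g| ≤ ∑ i, ∑ j ∈ range (N + 1), mesh N ^ 2 * (weight N j * |r i j| * |g i j|) := by
        rw [ip, mul_sum]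
        refine (abs_sum_le_sum_abs _ _).trans (sum_le_sum fun i _ => ?_)
        rw [mul_sum]
        refine (abs_sum_le_sum_abs _ _).trans (sum_le_sum fun j _ => le_of_eq ?_)
        rw [abs_mul, abs_mul, abs_mul, abs_of_pos (weight_pos (N := N) j),
          abs_of_nonneg (sq_nonneg _)]
    _ ≤ ∑ i, ∑ j ∈ range (N + 1), (c * mesh N ^ 2 * (weight N j * |g i j|)
        + ((if j = N then c * mesh N * |top g i| else 0)
          + (if j = 0 then c * mesh N * |bot g i| else 0))) :=
        sum_le_sum fun i _ => sum_le_sum (key i)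
    _ = c * l1Trace g := by
        simp only [sum_add_distrib, sum_ite_eq', mem_range, Nat.lt_succ_self, if_true,
          Nat.succ_pos, l1Trace, ← mul_sum]
        ring

theorem abs_ipΓ_le {c : ℝ} {r : BdryGrid N} (h : ∀ i, |r i| ≤ c) (g : BdryGrid N) :
    |ipΓ r g| ≤ c * (mesh N * ∑ i, |g i|) := by
  rw [ipΓ, abs_mul, abs_of_pos mesh_pos, mul_left_comm]
  refine mul_le_mul_of_nonneg_left ((abs_sum_le_sum_abs _ _).trans ?_) mesh_pos.le
  rw [mul_sum]
  refine sum_le_sum fun i _ => ?_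
  rw [abs_mul]
  exact mul_le_mul_of_nonneg_right (h i) (abs_nonneg _)

theorem sum_abs_le_sqrt_dxForm {f : BdryGrid N} (hf : meanΓ f = 0) :
    mesh N * ∑ i, |f i| ≤ √(dxForm N f f) := by
  rw [← mesh_mul_sum_const (N := N) (√(dxForm N f f))]
  exact mul_le_mul_of_nonneg_left (sum_le_sum fun i _ => abs_le_sqrt_dxForm hf i) mesh_pos.le

/-- A bound uniform along each column also covers the two trace values; the factor 3 counts the bulk
and the two sides. -/
theorem l1Trace_le_of_rows {f : Grid N} {b : ZMod N → ℝ} (hb : ∀ i, ∀ j : ℕ, j ≤ N → |f i j| ≤ b i) :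
    l1Trace f ≤ 3 * (mesh N * ∑ i, b i) := by
  have h1 : mesh N * ∑ i, mesh N * ∑ j ∈ range (N + 1), weight N j * |f i j|
      ≤ mesh N * ∑ i, b i := by
    refine mul_le_mul_of_nonneg_left (sum_le_sum fun i _ => ?_) mesh_pos.le
    rw [← weighted_const (N := N) (b i)]
    refine mul_le_mul_of_nonneg_left (sum_le_sum fun j hj => ?_) mesh_pos.le
    exact mul_le_mul_of_nonneg_left (hb i j (Nat.lt_succ_iff.mp (mem_range.mp hj)))
      (weight_pos j).le
  have h2 : mesh N * ∑ i, |top f i| ≤ mesh N * ∑ i, b i :=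
    mul_le_mul_of_nonneg_left (sum_le_sum fun i _ => hb i N le_rfl) mesh_pos.le
  have h3 : mesh N * ∑ i, |bot f i| ≤ mesh N * ∑ i, b i :=
    mul_le_mul_of_nonneg_left (sum_le_sum fun i _ => by
      have := hb i 0 (Nat.zero_le N); rwa [Nat.cast_zero] at this)
      mesh_pos.le
  unfold l1Trace
  linarith

theorem l1Trace_le_of_mean {f : Grid N} (hf : mean f = 0) : l1Trace f ≤ 9 * √(gradSq f) := by
  refine (l1Trace_le_of_rows fun i j hj => abs_le_of_mean_eq_zero hf i hj).trans ?_
  rw [sum_add_distrib, mul_add, mesh_mul_sum_const]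
  linarith [sum_sqrt_colEnergy_le f]

theorem gradSq_le_energy (f : Grid N) : gradSq f ≤ energyForm N 1 1 f f := by
  rw [energyForm_self]
  linarith [dxSqΓ_nonneg f]

theorem dxForm_bot_le_energy (f : Grid N) :
    dxForm N (bot f) (bot f) ≤ energyForm N 1 1 f f := by
  rw [energyForm_self, dxSqΓ_eq]
  linarith [gradSq_nonneg f, dxForm_nonneg (top f)]

theorem l1Trace_le_of_meanΓ {f : Grid N} (hf : meanΓ (bot f) = 0) :
    l1Trace f ≤ 6 * √(energyForm N 1 1 f f) := by
  refine (l1Trace_le_of_rows fun i j hj => abs_le_of_meanΓ_bot hf i hj).trans ?_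
  rw [sum_add_distrib, mul_add, mesh_mul_sum_const]
  linarith [sum_sqrt_colEnergy_le f, Real.sqrt_le_sqrt (gradSq_le_energy f),
    Real.sqrt_le_sqrt (dxForm_bot_le_energy f)]

/-! ### Control of the potentials by the energy norm -/

theorem ip_self_le_of_rows {f : Grid N} {b : ZMod N → ℝ}
    (hb : ∀ i, ∀ j : ℕ, j ≤ N → f i j ^ 2 ≤ b i) : ip f f ≤ mesh N * ∑ i, b i := by
  rw [ip, sq, mul_assoc, mul_sum]
  refine mul_le_mul_of_nonneg_left (sum_le_sum fun i _ => ?_) mesh_pos.le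
  rw [← weighted_const (N := N) (b i)]
  refine mul_le_mul_of_nonneg_left (sum_le_sum fun j hj => ?_) mesh_pos.le
  rw [mul_assoc, ← sq]
  exact mul_le_mul_of_nonneg_left (hb i j (Nat.lt_succ_iff.mp (mem_range.mp hj)))
    (weight_pos j).le

theorem sq_le_of_abs_le_sqrt {x a b : ℝ} (ha : 0 ≤ a) (hb : 0 ≤ b) (h : |x| ≤ √a + √b) :
    x ^ 2 ≤ 2 * a + 2 * b := by
  have h1 := sq_le_sq' (by linarith [abs_nonneg x, Real.sqrt_nonneg a, Real.sqrt_nonneg b]) h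
  rw [sq_abs] at h1
  nlinarith [Real.sq_sqrt ha, Real.sq_sqrt hb, sq_nonneg (√a - √b)]

theorem ip_self_le_of_mean {f : Grid N} (hf : mean f = 0) : ip f f ≤ 10 * gradSq f := by
  have h4 : √(4 * gradSq f) = 2 * √(gradSq f) := by
    rw [Real.sqrt_mul (by norm_num), show (4 : ℝ) = 2 ^ 2 by norm_num,
      Real.sqrt_sq (by norm_num)]
  refine (ip_self_le_of_rows fun i j hj => sq_le_of_abs_le_sqrt (colEnergy_nonneg f i)
    (mul_nonneg (by norm_num : (0 : ℝ) ≤ 4) (gradSq_nonneg f))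
    (h4 ▸ abs_le_of_mean_eq_zero hf i hj)).trans ?_
  rw [sum_add_distrib, mul_add, mesh_mul_sum_const, ← mul_sum]
  linarith [colEnergy_sum_le f]

theorem ip_self_le_of_meanΓ {f : Grid N} (hf : meanΓ (bot f) = 0) :
    ip f f ≤ 2 * energyForm N 1 1 f f := by
  refine (ip_self_le_of_rows fun i j hj => sq_le_of_abs_le_sqrt (colEnergy_nonneg f i)
    (dxForm_nonneg _) (abs_le_of_meanΓ_bot hf i hj)).trans ?_
  rw [sum_add_distrib, mul_add, mesh_mul_sum_const, ← mul_sum, energyForm_self, dxSqΓ_eq]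
  linarith [colEnergy_sum_le f, dxForm_nonneg (top f)]

theorem ip_self_nonneg (f : Grid N) : 0 ≤ ip f f :=
  mul_nonneg (sq_nonneg _) (sum_nonneg fun _ _ => sum_nonneg fun j _ => by
    rw [mul_assoc]; exact mul_nonneg (weight_pos j).le (mul_self_nonneg _))

/-- Testing `L_h ψ = e` with `ψ` gives the Dirichlet energy of `ψ`. Young's inequality with
parameter 10 matches the Poincaré constant for `ψ`, so half of the resulting bound is absorbed; the
Poincaré constant 2 for `e` then yields 20. -/
theorem gradForm_invLh_le {e : Grid N} (he : MassFree e) :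
    gradForm N (invLh e) (invLh e) ≤ 20 * energyForm N 1 1 e e := by
  have hs := invLh_spec he.1
  have h1 := ip_eq_gradForm hs (invLh e)
  have h2 := two_mul_form_le (Q := ipForm N) ip_comm ip_self_nonneg (η := 10) (by norm_num)
    e (invLh e)
  simp only [ipForm_apply] at h2
  have h3 := ip_self_le_of_mean hs.1
  have h4 := ip_self_le_of_meanΓ he.2.2
  rw [← gradForm_self] at h3
  rw [h1] at h2
  linarith

theorem dxForm_invDxx_le {e : BdryGrid N} (he : meanΓ e = 0) :
    dxForm N (invDxx e) (invDxx e) ≤ dxForm N e e := by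
  have hs := invDxx_spec he
  have h1 := ipΓ_eq_dxForm hs (invDxx e)
  have h2 := abs_ipΓ_le (fun i => abs_le_sqrt_dxForm he i) (invDxx e)
  have h3 := sum_abs_le_sqrt_dxForm hs.1
  have h4 := mul_le_mul_of_nonneg_left h3 (Real.sqrt_nonneg (dxForm N e e))
  have h5 := (le_abs_self _).trans (h2.trans h4)
  rw [h1] at h5
  have h6 := Real.sq_sqrt (dxForm_nonneg e)
  have h7 := Real.sq_sqrt (dxForm_nonneg (invDxx e))
  nlinarith [sq_nonneg (√(dxForm N e e) - √(dxForm N (invDxx e) (invDxx e)))]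

/-- The negative norm is weaker than the energy norm. The bulk gives 20 and the sides at most 1; the
sum is rounded up to the square 25. -/
theorem potForm_potentials_le_energy {e : Grid N} (he : MassFree e) :
    potForm N (potentials e) (potentials e) ≤ 25 * energyForm N 1 1 e e := by
  have h1 := gradForm_invLh_le he
  have h2 := dxForm_invDxx_le he.2.1
  have h3 := dxForm_invDxx_le he.2.2
  have h4 := energyForm_self 1 1 e
  rw [dxSqΓ_eq] at h4
  have h5 := gradSq_nonneg e
  have h6 := energyForm_nonneg zero_le_one zero_le_one e
  rw [potForm_apply]
  simp only [potentials]
  linarith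

end Negative

/-! ### Weak form of the scheme, error equation and stability -/

section Stability

set_option linter.unusedSectionVars false

variable {N : ℕ} [NeZero N]

/-- The logarithmic part of the chemical potential. -/
def logPot (s : ℝ) : ℝ := Real.log (1 + s) - Real.log (1 - s)

theorem logPot_monotone {a b : ℝ} (ha : -1 < a) (hab : a ≤ b) (hb : b < 1) :
    logPot a ≤ logPot b := by
  unfold logPot
  have h1 := Real.log_le_log (by linarith : 0 < 1 + a) (by linarith : 1 + a ≤ 1 + b)
  have h2 := Real.log_le_log (by linarith : 0 < 1 - b) (by linarith : 1 - b ≤ 1 - a)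
  linarith

theorem logPot_sub_mul_nonneg {a b : ℝ} (ha : -1 < a ∧ a < 1) (hb : -1 < b ∧ b < 1) :
    0 ≤ (logPot a - logPot b) * (a - b) := by
  rcases le_total a b with h | h
  · exact mul_nonneg_of_nonpos_of_nonpos (by linarith [logPot_monotone ha.1 h hb.2])
      (by linarith)
  · exact mul_nonneg (by linarith [logPot_monotone hb.1 h ha.2]) (by linarith)

/-- The logarithmic part of the chemical potential of a grid function. -/
def logGrid (f : Grid N) : Grid N := fun i j => logPot (f i j)

/-- The weak form of the right-hand sides defining the chemical potentials of the scheme. -/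
def schemeForm (ε κ θ₀ A B dt : ℝ) (φ₀ φ₁ φ₂ v : Grid N) : ℝ :=
  massForm N (logGrid φ₂) v - θ₀ * massForm N ((2 : ℝ) • φ₁ - φ₀) v
    + energyForm N (ε ^ 2) (ε * κ) φ₂ v + dt * energyForm N A B (φ₂ - φ₁) v

/-- The second order backward difference. -/
def bdfDiff (dt : ℝ) (φ₀ φ₁ φ₂ : Grid N) : Grid N :=
  (1 / (2 * dt)) • ((3 : ℝ) • φ₂ - (4 : ℝ) • φ₁ + φ₀)

/-- The weak form of one step of the scheme, in which the ghost rows no longer occur. -/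
theorem BDF2Step.weak {ε κ θ₀ A B dt : ℝ} {φ₀ φ₁ φ₂ : Grid N}
    (h : BDF2Step ε κ θ₀ A B dt φ₀ φ₁ φ₂) : ∃ (μ : Grid N) (μT μB : BdryGrid N),
      (∀ i, ∀ j : ℕ, j ≤ N → bdfDiff dt φ₀ φ₁ φ₂ i j = - Lh μ i j) ∧
      (∀ i, top (bdfDiff dt φ₀ φ₁ φ₂) i = Dxx μT i) ∧
      (∀ i, bot (bdfDiff dt φ₀ φ₁ φ₂) i = Dxx μB i) ∧
      ∀ v, ip μ v + (ipΓ μT (top v) + ipΓ μB (bot v)) = schemeForm ε κ θ₀ A B dt φ₀ φ₁ φ₂ v := by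
  obtain ⟨-, μ, μB, μT, h1, h2, h3, h4, h5, h6, h7⟩ := h
  refine ⟨μ, μT, μB, fun i j hj => ?_, fun i => ?_, fun i => ?_, fun v => ?_⟩
  · rw [← lapH_eq_neg_Lh h3, ← h1 i j hj]
    simp only [bdfDiff, Pi.smul_apply, Pi.add_apply, Pi.sub_apply, smul_eq_mul]
    ring
  · rw [← h5]
    simp only [bdfDiff, top, Pi.smul_apply, Pi.add_apply, Pi.sub_apply, smul_eq_mul]
    ring
  · rw [← h4]
    simp only [bdfDiff, bot, Pi.smul_apply, Pi.add_apply, Pi.sub_apply, smul_eq_mul]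
    ring
  · have e1 : ip μ v = ip (logGrid φ₂ + ((-θ₀) • ((2 : ℝ) • φ₁ - φ₀)
        + ((-ε ^ 2) • lapH φ₂ + (-(A * dt)) • lapH (φ₂ - φ₁)))) v := by
      refine ip_congr fun i j hj => ?_
      rw [h2 i j hj]
      simp only [logGrid, logPot, Pi.smul_apply, Pi.add_apply, Pi.sub_apply, smul_eq_mul]
      ring
    have e2 : μT = top (logGrid φ₂) + ((-θ₀) • ((2 : ℝ) • top φ₁ - top φ₀)
        + ((ε * κ) • (fun i => - Dxx (top φ₂) i) + ((B * dt) • (fun i => - Dxx (top φ₂ - top φ₁) i)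
        + (ε ^ 2 • Dy φ₂ N + (A * dt) • Dy (φ₂ - φ₁) N)))) := by
      funext i
      rw [h7 i]
      simp only [logGrid, logPot, top, Pi.smul_apply, Pi.add_apply, Pi.sub_apply, smul_eq_mul]
      ring
    have e3 : μB = bot (logGrid φ₂) + ((-θ₀) • ((2 : ℝ) • bot φ₁ - bot φ₀)
        + ((ε * κ) • (fun i => - Dxx (bot φ₂) i) + ((B * dt) • (fun i => - Dxx (bot φ₂ - bot φ₁) i)
        + ((-ε ^ 2) • Dy φ₂ 0 + (-(A * dt)) • Dy (φ₂ - φ₁) 0)))) := by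
      funext i
      rw [h6 i]
      simp only [logGrid, logPot, bot, Pi.smul_apply, Pi.add_apply, Pi.sub_apply, smul_eq_mul]
      ring
    rw [e1, e2, e3]
    simp only [ip_add_left, ip_smul_left]
    simp only [← ipΓForm_apply, map_add, map_smul, LinearMap.add_apply, LinearMap.smul_apply,
      smul_eq_mul]
    -- Summation by parts of `-ε² Δ_h` and of the `A` term leaves normal derivatives on the sides;
    -- they cancel those in `μT` and `μB`, so no ghost value survives.
    simp only [ipΓForm_apply, ip_lapH]
    rw [ipΓ_comm (fun i => - Dxx (top φ₂) i), ipΓ_comm (fun i => - Dxx (bot φ₂) i),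
      ipΓ_comm (fun i => - Dxx (top φ₂ - top φ₁) i), ipΓ_comm (fun i => - Dxx (bot φ₂ - bot φ₁) i),
      ← dxForm_eq, ← dxForm_eq, ← dxForm_eq, ← dxForm_eq]
    simp only [schemeForm, massForm_apply, energyForm_apply, gradForm_comm φ₂,
      gradForm_comm (φ₂ - φ₁), dxForm_comm (top φ₂), dxForm_comm (bot φ₂)]
    rw [dxForm_comm (top v) (top φ₂ - top φ₁), dxForm_comm (bot v) (bot φ₂ - bot φ₁),
      dxForm_comm (top v) (top φ₂), dxForm_comm (bot v) (bot φ₂)]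
    simp only [show top (φ₂ - φ₁) = top φ₂ - top φ₁ from rfl,
      show bot (φ₂ - φ₁) = bot φ₂ - bot φ₁ from rfl,
      show top ((2 : ℝ) • φ₁ - φ₀) = (2 : ℝ) • top φ₁ - top φ₀ from rfl,
      show bot ((2 : ℝ) • φ₁ - φ₀) = (2 : ℝ) • bot φ₁ - bot φ₀ from rfl,
      dxForm_comm (top φ₂) (top v), dxForm_comm (bot φ₂) (bot v)]
    ring

/-- The grid functions `P₀, P₁, P₂` solve one step of the scheme up to residuals of size `c`. -/
structure Consistent (ε κ θ₀ A B dt c : ℝ) (P₀ P₁ P₂ : Grid N) (μ : Grid N) (μT μB : BdryGrid N) :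
    Prop where
  range : ∀ i, ∀ j : ℕ, j ≤ N → -1 < P₂ i j ∧ P₂ i j < 1
  bulk : SmallResidual c (bdfDiff dt P₀ P₁ P₂ + Lh μ)
  on_top : ∀ i, |top (bdfDiff dt P₀ P₁ P₂) i - Dxx μT i| ≤ c
  on_bot : ∀ i, |bot (bdfDiff dt P₀ P₁ P₂) i - Dxx μB i| ≤ c
  weak : ∀ v, MassFree v → |ip μ v + (ipΓ μT (top v) + ipΓ μB (bot v))
    - schemeForm ε κ θ₀ A B dt P₀ P₁ P₂ v| ≤ c * √(energyForm N 1 1 v v)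

theorem MassFree.combine {a b c : ℝ} {f g k : Grid N} (hf : MassFree f) (hg : MassFree g)
    (hk : MassFree k) : MassFree (a • f + b • g + c • k) := by
  have e : ∀ u : Grid N, meanΓ (top u) = ipΓForm N (rowLin N N u) (fun _ => 1) := fun _ => rfl
  have e' : ∀ u : Grid N, meanΓ (bot u) = ipΓForm N (rowLin N 0 u) (fun _ => 1) := fun _ => rfl
  have h2 := hf.2.1
  have h3 := hf.2.2
  have h4 := hg.2.1
  have h5 := hg.2.2
  have h6 := hk.2.1
  have h7 := hk.2.2
  refine ⟨by simp [mean_add, mean_smul, hf.1, hg.1, hk.1], ?_, ?_⟩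
  · rw [e] at *
    simp only [map_add, map_smul, LinearMap.add_apply, LinearMap.smul_apply, h2, h4, h6, smul_zero,
      add_zero]
  · rw [e'] at *
    simp only [map_add, map_smul, LinearMap.add_apply, LinearMap.smul_apply, h3, h5, h7, smul_zero,
      add_zero]

theorem meanΓ_Dxx (f : BdryGrid N) : meanΓ (Dxx f) = 0 := by
  have := sum_mul_Dxx (fun _ => (1 : ℝ)) f
  simp only [one_mul, sum_neg_distrib] at this
  simp only [meanΓ, ipΓ, mul_one]
  rw [show ∑ i, Dxx f i = 0 by rw [← neg_eq_zero, this]; simp [Dx], mul_zero]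

/-- The scheme conserves the three discrete masses. -/
theorem BDF2Step.massFree {ε κ θ₀ A B dt : ℝ} {φ₀ φ₁ φ₂ : Grid N}
    (h : BDF2Step ε κ θ₀ A B dt φ₀ φ₁ φ₂) : MassFree (bdfDiff dt φ₀ φ₁ φ₂) := by
  obtain ⟨μ, μT, μB, h1, h2, h3, -⟩ := h.weak
  refine ⟨?_, ?_, ?_⟩
  · rw [mean_congr (g := (-1 : ℝ) • Lh μ), mean_smul, mean_Lh, mul_zero]
    intro i j hj
    rw [h1 i j hj]
    simp
  · rw [show top (bdfDiff dt φ₀ φ₁ φ₂) = Dxx μT from funext h2, meanΓ_Dxx]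
  · rw [show bot (bdfDiff dt φ₀ φ₁ φ₂) = Dxx μB from funext h3, meanΓ_Dxx]

/-- The logarithmic terms enter the error inequality only through monotonicity. No Lipschitz bound
at `φ` is needed, hence no strict separation of the computed solution. -/
theorem logGrid_massForm_nonneg {f g : Grid N}
    (hf : ∀ i, ∀ j : ℕ, j ≤ N → -1 < f i j ∧ f i j < 1)
    (hg : ∀ i, ∀ j : ℕ, j ≤ N → -1 < g i j ∧ g i j < 1) :
    0 ≤ massForm N (logGrid f - logGrid g) (f - g) := by
  have key : ∀ i, ∀ j : ℕ, j ≤ N → 0 ≤ (logGrid f - logGrid g) i j * (f - g) i j := fun i j hj =>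
    logPot_sub_mul_nonneg (hf i j hj) (hg i j hj)
  rw [massForm_apply]
  refine add_nonneg ?_ (add_nonneg ?_ ?_)
  · refine mul_nonneg (sq_nonneg _) (sum_nonneg fun i _ => sum_nonneg fun j hj => ?_)
    rw [mul_assoc]
    exact mul_nonneg (weight_pos j).le (key i j (Nat.lt_succ_iff.mp (mem_range.mp hj)))
  · exact mul_nonneg mesh_pos.le (sum_nonneg fun i _ => key i N le_rfl)
  · exact mul_nonneg mesh_pos.le (sum_nonneg fun i _ => by
      have := key i 0 (Nat.zero_le N); rwa [Nat.cast_zero] at this)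

/-- The tested error equation. -/
theorem error_inequality {ε κ θ₀ A B dt c : ℝ} {P₀ P₁ P₂ φ₀ φ₁ φ₂ : Grid N} {μ : Grid N}
    {μT μB : BdryGrid N}
    (hP : Consistent ε κ θ₀ A B dt c P₀ P₁ P₂ μ μT μB) (hφ : BDF2Step ε κ θ₀ A B dt φ₀ φ₁ φ₂)
    (h₀ : MassFree (P₀ - φ₀)) (h₁ : MassFree (P₁ - φ₁)) (h₂ : MassFree (P₂ - φ₂)) :
    potForm N ((3 : ℝ) • potentials (P₂ - φ₂) - (4 : ℝ) • potentials (P₁ - φ₁)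
        + potentials (P₀ - φ₀)) (potentials (P₂ - φ₂)) / (2 * dt)
      + energyForm N (ε ^ 2) (ε * κ) (P₂ - φ₂) (P₂ - φ₂)
      + dt * energyForm N A B (P₂ - φ₂ - (P₁ - φ₁)) (P₂ - φ₂)
      ≤ θ₀ * potForm N ((2 : ℝ) • potentials (P₁ - φ₁) - potentials (P₀ - φ₀))
          (withTraces N (P₂ - φ₂))
        + 60 * c * √(energyForm N 1 1 (P₂ - φ₂) (P₂ - φ₂)) := by
  obtain ⟨m, mT, mB, g1, g2, g3, g4⟩ := hφ.weak
  set e₀ := P₀ - φ₀ with he₀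
  set e₁ := P₁ - φ₁ with he₁
  set e₂ := P₂ - φ₂ with he₂
  have hc := hP.bulk.nonneg
  have s1 := invLh_spec h₂.1
  have s2 := invDxx_spec h₂.2.1
  have s3 := invDxx_spec h₂.2.2
  have d0 : bdfDiff dt e₀ e₁ e₂ = bdfDiff dt P₀ P₁ P₂ - bdfDiff dt φ₀ φ₁ φ₂ := by
    rw [bdfDiff, bdfDiff, bdfDiff, ← smul_sub]
    congr 1
    rw [he₀, he₁, he₂]
    module
  have mb : ∀ v, ip (bdfDiff dt e₀ e₁ e₂) v = gradForm N ((1 / (2 * dt)) •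
      ((3 : ℝ) • invLh e₂ - (4 : ℝ) • invLh e₁ + invLh e₀)) v := by
    intro v
    rw [bdfDiff, ← ipForm_apply]
    simp only [map_add, map_sub, map_smul, LinearMap.add_apply, LinearMap.sub_apply,
      LinearMap.smul_apply, ipForm_apply, ip_eq_gradForm s1, ip_eq_gradForm (invLh_spec h₀.1),
      ip_eq_gradForm (invLh_spec h₁.1)]
  have mt : ∀ v, ipΓ (top (bdfDiff dt e₀ e₁ e₂)) v = dxForm N ((1 / (2 * dt)) •
      ((3 : ℝ) • invDxx (top e₂) - (4 : ℝ) • invDxx (top e₁) + invDxx (top e₀))) v := by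
    intro v
    rw [bdfDiff, ← ipΓForm_apply, ← rowLin_N]
    simp only [map_add, map_sub, map_smul, LinearMap.add_apply, LinearMap.sub_apply,
      LinearMap.smul_apply, ipΓForm_apply, rowLin_N, ipΓ_eq_dxForm s2,
      ipΓ_eq_dxForm (invDxx_spec h₀.2.1), ipΓ_eq_dxForm (invDxx_spec h₁.2.1)]
  have mbb : ∀ v, ipΓ (bot (bdfDiff dt e₀ e₁ e₂)) v = dxForm N ((1 / (2 * dt)) •
      ((3 : ℝ) • invDxx (bot e₂) - (4 : ℝ) • invDxx (bot e₁) + invDxx (bot e₀))) v := by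
    intro v
    rw [bdfDiff, ← ipΓForm_apply, ← rowLin_zero]
    simp only [map_add, map_sub, map_smul, LinearMap.add_apply, LinearMap.sub_apply,
      LinearMap.smul_apply, ipΓForm_apply, rowLin_zero, ipΓ_eq_dxForm s3,
      ipΓ_eq_dxForm (invDxx_spec h₀.2.2), ipΓ_eq_dxForm (invDxx_spec h₁.2.2)]
  have q1 : potForm N ((3 : ℝ) • potentials e₂ - (4 : ℝ) • potentials e₁ + potentials e₀)
      (potentials e₂) / (2 * dt) = ip (bdfDiff dt e₀ e₁ e₂) (invLh e₂)
        + (ipΓ (top (bdfDiff dt e₀ e₁ e₂)) (invDxx (top e₂))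
          + ipΓ (bot (bdfDiff dt e₀ e₁ e₂)) (invDxx (bot e₂))) := by
    rw [mb, mt, mbb, map_smul, map_smul, map_smul, LinearMap.smul_apply, LinearMap.smul_apply,
      LinearMap.smul_apply, smul_eq_mul, smul_eq_mul, smul_eq_mul, ← mul_add, ← mul_add, div_eq_mul_one_div, mul_comm]
    rfl
  -- the three residual terms
  have r1 : ip (bdfDiff dt e₀ e₁ e₂) (invLh e₂) = ip (bdfDiff dt P₀ P₁ P₂ + Lh μ) (invLh e₂)
      - ip (μ - m) e₂ := by
    have a1 : ip (bdfDiff dt φ₀ φ₁ φ₂) (invLh e₂) = - ip m e₂ := by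
      rw [ip_comm m, ip_eq_gradForm s1, gradForm_apply, ip_comm _ (Lh m), ← neg_one_mul,
        ← ip_smul_left]
      exact ip_congr fun i j hj => by rw [g1 i j hj]; simp
    have a2 : ip (Lh μ) (invLh e₂) = ip μ e₂ := by
      rw [ip_comm μ, ip_eq_gradForm s1, gradForm_apply, ip_comm]
    rw [d0, ip_add_left, a2]
    simp only [← ipForm_apply, map_sub, LinearMap.sub_apply]
    simp only [ipForm_apply, a1]
    ring
  -- Self-adjointness of `D_x²` moves the operator from the potential onto the inverse of the error,
  -- which leaves the residual and the difference of the potentials. The bulk version is `r1`.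
  have aux : ∀ (x y : BdryGrid N) (ν n e ψ : BdryGrid N), SolvesDxx e ψ → (∀ i, y i = Dxx n i) →
      ipΓ (x - y) ψ = ipΓ (fun i => x i - Dxx ν i) ψ - ipΓ (ν - n) e := by
    intro x y ν n e ψ hs hy
    have a1 : ∀ n, ipΓ (Dxx n) ψ = - ipΓ n e := by
      intro n
      rw [ipΓ_comm n, ipΓ_eq_dxForm hs, dxForm_eq, ipΓ_comm, ipΓ, ipΓ]
      simp
    have hy' : y = Dxx n := funext hy
    rw [show (fun i => x i - Dxx ν i) = x - Dxx ν from rfl, hy']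
    simp only [← ipΓForm_apply, map_sub, LinearMap.sub_apply]
    simp only [ipΓForm_apply, a1]
    ring
  have r2 := aux (top (bdfDiff dt P₀ P₁ P₂)) _ μT mT _ _ s2 g2
  have r3 := aux (bot (bdfDiff dt P₀ P₁ P₂)) _ μB mB _ _ s3 g3
  have f2 : top (bdfDiff dt P₀ P₁ P₂) - top (bdfDiff dt φ₀ φ₁ φ₂) = top (bdfDiff dt e₀ e₁ e₂) := by
    rw [d0]; rfl
  have f3 : bot (bdfDiff dt P₀ P₁ P₂) - bot (bdfDiff dt φ₀ φ₁ φ₂) = bot (bdfDiff dt e₀ e₁ e₂) := by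
    rw [d0]; rfl
  rw [f2] at r2
  rw [f3] at r3
  -- size of the residuals
  have hpot := Real.sqrt_le_sqrt (potForm_potentials_le_energy h₂)
  rw [Real.sqrt_mul (by norm_num), show (25 : ℝ) = 5 ^ 2 by norm_num, Real.sqrt_sq (by norm_num)]
    at hpot
  have hpa := potForm_apply (potentials e₂) (potentials e₂)
  simp only [potentials] at hpa
  have n1 := gradForm_nonneg (invLh e₂)
  have n2 := dxForm_nonneg (invDxx (top e₂))
  have n3 := dxForm_nonneg (invDxx (bot e₂))
  have b1 : |ip (bdfDiff dt P₀ P₁ P₂ + Lh μ) (invLh e₂)|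
      ≤ c * (9 * √(potForm N (potentials e₂) (potentials e₂))) := by
    refine (hP.bulk.abs_ip_le _).trans (mul_le_mul_of_nonneg_left ?_ hc)
    refine (l1Trace_le_of_mean s1.1).trans ?_
    rw [← gradForm_self]
    gcongr
    simp only [potentials]
    linarith
  have b2 := (abs_ipΓ_le hP.on_top (invDxx (top e₂))).trans
    (mul_le_mul_of_nonneg_left ((sum_abs_le_sqrt_dxForm s2.1).trans (Real.sqrt_le_sqrt
      (by simp only [potentials]; linarith :
        _ ≤ potForm N (potentials e₂) (potentials e₂)))) hc)
  have b3 := (abs_ipΓ_le hP.on_bot (invDxx (bot e₂))).trans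
    (mul_le_mul_of_nonneg_left ((sum_abs_le_sqrt_dxForm s3.1).trans (Real.sqrt_le_sqrt
      (by simp only [potentials]; linarith :
        _ ≤ potForm N (potentials e₂) (potentials e₂)))) hc)
  have b4 := hP.weak e₂ h₂
  have b5 := mul_le_mul_of_nonneg_left hpot hc
  -- the difference of the weak forms
  have w : schemeForm ε κ θ₀ A B dt P₀ P₁ P₂ e₂ - schemeForm ε κ θ₀ A B dt φ₀ φ₁ φ₂ e₂
      = massForm N (logGrid P₂ - logGrid φ₂) e₂
        - θ₀ * potForm N ((2 : ℝ) • potentials e₁ - potentials e₀) (withTraces N e₂)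
        + energyForm N (ε ^ 2) (ε * κ) e₂ e₂ + dt * energyForm N A B (e₂ - e₁) e₂ := by
    have t1 : potForm N ((2 : ℝ) • potentials e₁ - potentials e₀) (withTraces N e₂)
        = massForm N ((2 : ℝ) • e₁ - e₀) e₂ := by
      simp only [map_sub, map_smul, LinearMap.sub_apply, LinearMap.smul_apply,
        massForm_eq_potForm h₀, massForm_eq_potForm h₁]
    rw [t1, schemeForm, schemeForm]
    have t2 : energyForm N (ε ^ 2) (ε * κ) e₂ e₂ = energyForm N (ε ^ 2) (ε * κ) P₂ e₂
        - energyForm N (ε ^ 2) (ε * κ) φ₂ e₂ := by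
      rw [← LinearMap.sub_apply, ← map_sub]
    have t3 : energyForm N A B (e₂ - e₁) e₂ = energyForm N A B (P₂ - P₁) e₂
        - energyForm N A B (φ₂ - φ₁) e₂ := by
      rw [← LinearMap.sub_apply, ← map_sub]
      congr 2
      rw [he₁, he₂]
      abel
    have t4 : massForm N ((2 : ℝ) • e₁ - e₀) e₂ = massForm N ((2 : ℝ) • P₁ - P₀) e₂
        - massForm N ((2 : ℝ) • φ₁ - φ₀) e₂ := by
      rw [← LinearMap.sub_apply, ← map_sub]
      congr 2
      rw [he₁, he₀]
      module
    rw [t2, t3, t4, map_sub (massForm N) (logGrid P₂), LinearMap.sub_apply]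
    ring
  have w2 : ip (μ - m) e₂ + (ipΓ (μT - mT) (top e₂) + ipΓ (μB - mB) (bot e₂))
      = (ip μ e₂ + (ipΓ μT (top e₂) + ipΓ μB (bot e₂))) - schemeForm ε κ θ₀ A B dt φ₀ φ₁ φ₂ e₂ := by
    rw [← g4 e₂]
    simp only [← ipΓForm_apply, ← ipForm_apply, map_sub, LinearMap.sub_apply]
    ring
  have mono := logGrid_massForm_nonneg hP.range hφ.1
  rw [← he₂] at mono
  rw [q1, r1, r2, r3]
  have c1 := (abs_le.mp b1).2
  have c2 := (abs_le.mp b2).2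
  have c3 := (abs_le.mp b3).2
  have c4 := (abs_le.mp b4).1
  -- The residuals add up to `(9 + 1 + 1) * 5 + 1 = 56` times `c √E`, with 5 from comparing
  -- potentials with energy; this is rounded up to 60.
  have c5 : 0 ≤ c * √(energyForm N 1 1 e₂ e₂) := mul_nonneg hc (Real.sqrt_nonneg _)
  linarith

/-- The new error is `4/3` of the last one minus `1/3` of the one before, minus a multiple of
`bdfDiff` of the scheme, plus the same backward difference of `P`. The coefficients `1, -4/3, 1/3`
sum to zero, so the common reference `P` drops out of the latter. -/
theorem MassFree.step {ε κ θ₀ A B dt : ℝ} {P P₀ P₁ P₂ φ₀ φ₁ φ₂ : Grid N} (hdt : 0 < dt)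
    (hφ : BDF2Step ε κ θ₀ A B dt φ₀ φ₁ φ₂) (h₀ : MassFree (P₀ - φ₀)) (h₁ : MassFree (P₁ - φ₁))
    (hP₀ : MassFree (P₀ - P)) (hP₁ : MassFree (P₁ - P)) (hP₂ : MassFree (P₂ - P)) :
    MassFree (P₂ - φ₂) := by
  have h3 := MassFree.combine (a := 1) (b := -(4 / 3)) (c := 1 / 3) hP₂ hP₁ hP₀
  have h4 := MassFree.combine (a := 4 / 3) (b := -(1 / 3)) (c := -(2 * dt / 3)) h₁ h₀ hφ.massFree
  have h5 := MassFree.combine (a := 1) (b := 1) (c := 0) h3 h4 h₀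
  convert h5 using 1
  have : dt ≠ 0 := hdt.ne'
  funext i j
  simp only [bdfDiff, Pi.sub_apply, Pi.add_apply, Pi.smul_apply, smul_eq_mul]
  field_simp
  ring

/-- Stability of the scheme: consistency of order `c` implies an error of order `c`. -/
theorem stability {ε κ θ₀ A B dt c Λ : ℝ} (hε : 0 < ε) (hκ : 0 < κ) (hA : 0 ≤ A) (hB : 0 ≤ B)
    (hdt : 0 < dt) (hΛ : 0 < Λ)
    (hD : ∀ f : Grid N, energyForm N 1 1 f f ≤ Λ * energyForm N (ε ^ 2) (ε * κ) f f)
    {P φ : ℕ → Grid N} {n : ℕ}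
    (hP : ∀ k, 1 ≤ k → k ≤ n → ∃ μ μT μB,
      Consistent ε κ θ₀ A B dt c (P (k - 1)) (P k) (P (k + 1)) μ μT μB)
    (hφ : ∀ k, 1 ≤ k → k ≤ n → BDF2Step ε κ θ₀ A B dt (φ (k - 1)) (φ k) (φ (k + 1)))
    (hPm : ∀ k, k ≤ n + 1 → MassFree (P k - P 0))
    (h0 : MassFree (P 0 - φ 0)) (h1 : MassFree (P 1 - φ 1)) :
    MassFree (P (n + 1) - φ (n + 1)) ∧
      potForm N (potentials (P (n + 1) - φ (n + 1))) (potentials (P (n + 1) - φ (n + 1))) / 4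
        + dt / 2 * ∑ k ∈ Icc 1 (n + 1), energyForm N (ε ^ 2) (ε * κ) (P k - φ k) (P k - φ k)
      ≤ Real.exp (n * (dt * (4 * θ₀ ^ 2 * Λ)))
        * (bdfEnergy (potForm N) (energyForm N A B) dt (potentials (P 0 - φ 0))
            (potentials (P 1 - φ 1)) (P 1 - φ 1)
          + dt / 2 * energyForm N (ε ^ 2) (ε * κ) (P 1 - φ 1) (P 1 - φ 1)
          + n * (dt * (60 * c * √Λ) ^ 2)) := by
  have hm : ∀ k ≤ n, MassFree (P k - φ k) ∧ MassFree (P (k + 1) - φ (k + 1)) := by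
    intro k hk
    induction k with
    | zero => exact ⟨h0, h1⟩
    | succ k ih =>
      obtain ⟨i1, i2⟩ := ih (by omega)
      exact ⟨i2, MassFree.step hdt (hφ (k + 1) (by omega) hk) i1 i2 (hPm k (by omega))
        (hPm _ (by omega)) (hPm _ (by omega))⟩
  have hDp : ∀ f, 0 ≤ energyForm N (ε ^ 2) (ε * κ) f f :=
    energyForm_nonneg (by positivity) (by positivity)
  have hSp : ∀ f, 0 ≤ energyForm N A B f f := energyForm_nonneg hA hB
  have hE : ∀ p q f, potForm N q q / 4 ≤ bdfEnergy (potForm N) (energyForm N A B) dt p q f := by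
    intro p q f
    have a1 := potForm_nonneg ((2 : ℝ) • q - p)
    have a2 := mul_nonneg (by positivity : 0 ≤ dt ^ 2 / 2) (hSp f)
    unfold bdfEnergy
    linarith
  set D : ℕ → ℝ := fun k => energyForm N (ε ^ 2) (ε * κ) (P k - φ k) (P k - φ k) with hDdef
  -- The accumulated dissipation is included in the Gronwall quantity, so a single application
  -- bounds both the final error and the sum over time.
  set Y : ℕ → ℝ := fun k => bdfEnergy (potForm N) (energyForm N A B) dt (potentials (P k - φ k))
    (potentials (P (k + 1) - φ (k + 1))) (P (k + 1) - φ (k + 1))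
      + dt / 2 * ∑ l ∈ Icc 1 (k + 1), D l with hY
  have hs0 : ∀ k, 0 ≤ dt / 2 * ∑ l ∈ Icc 1 k, D l := fun k =>
    mul_nonneg (by positivity) (sum_nonneg fun _ _ => hDp _)
  have hYstep : ∀ k < n, Y (k + 1) ≤ (1 + dt * (4 * θ₀ ^ 2 * Λ)) * Y k
      + dt * (60 * c * √Λ) ^ 2 := by
    intro k hk
    obtain ⟨m0, m1⟩ := hm k hk.le
    obtain ⟨-, m2⟩ := hm (k + 1) (by omega)
    obtain ⟨μ, μT, μB, hc⟩ := hP (k + 1) (by omega) (by omega)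
    have e1 := error_inequality hc (hφ (k + 1) (by omega) (by omega)) m0 m1 m2
    have hcc := hc.bulk.nonneg
    have e2 : 60 * c * √(energyForm N 1 1 (P (k + 1 + 1) - φ (k + 1 + 1))
        (P (k + 1 + 1) - φ (k + 1 + 1))) ≤ 60 * c * √Λ * √(D (k + 1 + 1)) := by
      rw [mul_assoc (60 * c), ← Real.sqrt_mul hΛ.le]
      gcongr
      exact hD _
    have e3 := bdfEnergy_step potForm_comm potForm_nonneg (energyForm_comm A B) hSp hDp
      (ι := withTraces N) hdt hΛ (by rw [potForm_withTraces]; exact hD _)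
      (e1.trans (add_le_add_right e2 _))
    have e4 := hs0 (k + 1)
    have e5 : 0 ≤ dt * (4 * θ₀ ^ 2 * Λ) * (dt / 2 * ∑ l ∈ Icc 1 (k + 1), D l) :=
      mul_nonneg (by positivity) e4
    simp only [hY]
    rw [sum_Icc_succ_top (by omega : 1 ≤ k + 1 + 1)]
    simp only [Nat.add_sub_cancel] at e3
    simp only [hDdef] at e5 ⊢
    linarith
  have hg := discrete_gronwall (by positivity) (by positivity)
    (add_nonneg ((div_nonneg (potForm_nonneg _) (by norm_num)).trans (hE _ _ _)) (hs0 _)) hYstep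
    n le_rfl
  refine ⟨(hm n le_rfl).2, ?_⟩
  have hl := hE (potentials (P n - φ n)) (potentials (P (n + 1) - φ (n + 1)))
    (P (n + 1) - φ (n + 1))
  have e0 : Y 0 = bdfEnergy (potForm N) (energyForm N A B) dt (potentials (P 0 - φ 0))
      (potentials (P 1 - φ 1)) (P 1 - φ 1) + dt / 2 * D 1 := by
    simp [hY]
  rw [e0] at hg
  refine le_trans ?_ hg
  simp only [hY]
  linarith

end Stability

open MeasureTheory

/-! ### The Fourier projection -/

/-- The Fourier coefficients over one period. -/
abbrev fcoef (f : ℝ → ℝ) (k : ℤ) : ℂ :=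
  fourierCoeffOn (zero_lt_one' ℝ) (fun s => (f s : ℂ)) k

theorem fcoef_eq (f : ℝ → ℝ) (k : ℤ) :
    fcoef f k = ∫ x in (0 : ℝ)..1, Complex.exp (-(2 * Real.pi * Complex.I * k * x)) * f x := by
  rw [fcoef, fourierCoeffOn_eq_integral]
  simp only [sub_zero, div_one, one_smul, fourier_coe_apply, smul_eq_mul]
  refine intervalIntegral.integral_congr fun x _ => ?_
  congr 2
  push_cast
  ring

theorem norm_exp_two_pi (k : ℤ) (x : ℝ) :
    ‖Complex.exp (2 * Real.pi * Complex.I * k * x)‖ = 1 := by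
  rw [show (2 * Real.pi * Complex.I * k * x : ℂ) = ((2 * Real.pi * k * x : ℝ) : ℂ) * Complex.I by
    push_cast; ring]
  exact Complex.norm_exp_ofReal_mul_I _

theorem norm_fcoef_le {f : ℝ → ℝ} {M : ℝ} (h : ∀ x, |f x| ≤ M) (k : ℤ) : ‖fcoef f k‖ ≤ M := by
  rw [fcoef_eq]
  have := intervalIntegral.norm_integral_le_of_norm_le_const (a := 0) (b := 1) (C := M)
    (f := fun x : ℝ => Complex.exp (-(2 * Real.pi * Complex.I * k * x)) * f x) (fun x _ => by
      have := norm_exp_two_pi (-k) x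
      rw [norm_mul, show -(2 * Real.pi * Complex.I * k * x : ℂ)
        = 2 * Real.pi * Complex.I * (-k : ℤ) * x by push_cast; ring, this, one_mul,
        Complex.norm_real]
      exact h x)
  simpa using this

theorem fcoef_zero (f : ℝ → ℝ) : (fcoef f 0).re = ∫ x in (0 : ℝ)..1, f x := by
  rw [fcoef_eq]
  simp [intervalIntegral.integral_ofReal]

theorem fcoef_sub {f g : ℝ → ℝ} (hf : Continuous f) (hg : Continuous g) (k : ℤ) :
    fcoef (fun x => f x - g x) k = fcoef f k - fcoef g k := by
  simp only [fcoef_eq]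
  rw [← intervalIntegral.integral_sub]
  · simp only [Complex.ofReal_sub, mul_sub]
  · exact Continuous.intervalIntegrable (by fun_prop) _ _
  · exact Continuous.intervalIntegrable (by fun_prop) _ _

/-- Integration by parts, where periodicity removes the boundary term. The factor `1 / (2π)` is
discarded. -/
theorem norm_fcoef_le_deriv {f f' : ℝ → ℝ} (hf : ∀ x, HasDerivAt f (f' x) x)
    (hf' : Continuous f') (hp : Function.Periodic f 1) {k : ℤ} (hk : k ≠ 0) :
    ‖fcoef f k‖ ≤ ‖fcoef f' k‖ / |(k : ℝ)| := by
  have h01 : f 1 = f 0 := by simpa using hp 0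
  have hI : IntervalIntegrable (fun x => (f' x : ℂ)) volume 0 1 :=
    Continuous.intervalIntegrable (by fun_prop) _ _
  have h := fourierCoeffOn_of_hasDerivAt (zero_lt_one' ℝ) (f := fun s => (f s : ℂ))
    (f' := fun s => (f' s : ℂ)) hk (fun x _ => (hf x).ofReal_comp) hI
  rw [fcoef, h, h01, sub_self, mul_zero, zero_sub, norm_mul, norm_neg]
  have hk' : 0 < |(k : ℝ)| := abs_pos.mpr (by exact_mod_cast hk)
  rw [norm_div, norm_one, norm_mul, norm_mul, norm_mul, norm_mul]
  simp only [Complex.ofReal_one, Complex.ofReal_zero, sub_zero, norm_one, one_mul, norm_neg,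
    Complex.norm_ofNat, Complex.norm_real, Complex.norm_I, mul_one, Complex.norm_intCast,
    Real.norm_eq_abs, abs_of_pos Real.pi_pos]
  rw [div_mul_eq_mul_div, one_mul]
  refine div_le_div_of_nonneg_left (norm_nonneg _) hk' ?_
  nlinarith [Real.pi_gt_three]

/-- A chain of derivatives of length five of a `1`-periodic function, with a bound on the last. -/
structure DerivChain (F : ℕ → ℝ → ℝ) (M : ℝ) : Prop where
  hasDerivAt : ∀ k < 5, ∀ x, HasDerivAt (F k) (F (k + 1) x) x
  continuous : ∀ k ≤ 5, Continuous (F k)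
  periodic : ∀ k ≤ 5, Function.Periodic (F k) 1
  bound : ∀ x, |F 5 x| ≤ M

theorem DerivChain.norm_fcoef_le {F : ℕ → ℝ → ℝ} {M : ℝ} (h : DerivChain F M) {k : ℤ}
    (hk : k ≠ 0) : ‖fcoef (F 0) k‖ ≤ M / |(k : ℝ)| ^ 5 := by
  have hk' : 0 < |(k : ℝ)| := abs_pos.mpr (by exact_mod_cast hk)
  have key : ∀ l ≤ 5, ‖fcoef (F 0) k‖ ≤ ‖fcoef (F l) k‖ / |(k : ℝ)| ^ l := by
    intro l hl
    induction l with
    | zero => simp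
    | succ l ih =>
      refine (ih (by omega)).trans ?_
      rw [pow_succ', ← div_div]
      gcongr
      exact norm_fcoef_le_deriv (h.hasDerivAt l (by omega)) (h.continuous _ hl)
        (h.periodic l (by omega)) hk
  refine (key 5 le_rfl).trans ?_
  gcongr
  exact CHDBC.norm_fcoef_le h.bound k

theorem DerivChain.summable {F : ℕ → ℝ → ℝ} {M : ℝ} (h : DerivChain F M) :
    Summable (fcoef (F 0)) := by
  have h1 : Summable fun k : ℤ => M / |(k : ℝ)| ^ 5 := by
    have := (Real.summable_one_div_int_pow (p := 5)).mpr (by norm_num)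
    refine ((this.abs).mul_left M).congr fun k => ?_
    rw [abs_div, abs_one, abs_pow]
    ring
  refine Summable.of_norm_bounded_eventually h1 ?_
  refine (Set.finite_singleton (0 : ℤ)).subset fun k hk => ?_
  by_contra hk0
  exact hk (h.norm_fcoef_le hk0)

/-- Absolutely summable coefficients give convergence of the Fourier series at every point, after
the function is lifted to the circle. -/
theorem hasSum_fcoef {f : ℝ → ℝ} (hf : Continuous f) (hp : Function.Periodic f 1)
    (hs : Summable (fcoef f)) (x : ℝ) :
    HasSum (fun k : ℤ => fcoef f k * Complex.exp (2 * Real.pi * Complex.I * k * x)) (f x) := by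
  have hp' : Function.Periodic (fun s => (f s : ℂ)) 1 := fun s => by simp only [hp s]
  let g : C(AddCircle (1 : ℝ), ℂ) :=
    ⟨hp'.lift, (QuotientAddGroup.isQuotientMap_mk _).continuous_iff.mpr
      (show Continuous fun s : ℝ => (f s : ℂ) by fun_prop)⟩
  have hg : ∀ k, fourierCoeff g k = fcoef f k := by
    intro k
    rw [fcoef_eq, fourierCoeff_eq_intervalIntegral _ _ 0]
    simp only [zero_add, div_one, one_smul, fourier_coe_apply, smul_eq_mul]
    refine intervalIntegral.integral_congr fun x _ => ?_
    have : g (x : AddCircle (1 : ℝ)) = f x := hp'.lift_coe x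
    simp only [this]
    congr 2
    push_cast
    ring
  have h := has_pointwise_sum_fourier_series_of_summable (f := g)
    (by rwa [funext hg]) (x : AddCircle (1 : ℝ))
  have hgx : g (x : AddCircle (1 : ℝ)) = f x := hp'.lift_coe x
  rw [hgx] at h
  convert! h using 2 with k
  rw [hg, smul_eq_mul, fourier_coe_apply]
  congr 2
  push_cast
  ring

/-- Accuracy of the Fourier projection. -/
theorem exists_fourierProj_bound : ∃ S > 0, ∀ (K : ℕ) (F : ℕ → ℝ → ℝ) (M : ℝ), DerivChain F M →
    ∀ x, |fourierProj K (F 0) x - F 0 x| ≤ S * M * mesh (2 * K + 1) ^ 3 := by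
  have hsum : Summable fun k : ℤ => 1 / (k : ℝ) ^ 2 :=
    Real.summable_one_div_int_pow.mpr (by norm_num)
  refine ⟨8 * (∑' k : ℤ, 1 / (k : ℝ) ^ 2 + 1),
    by have : 0 ≤ ∑' k : ℤ, 1 / (k : ℝ) ^ 2 := tsum_nonneg fun k => by positivity
       linarith, fun K F M h x => ?_⟩
  have hM : 0 ≤ M := (abs_nonneg _).trans (h.bound 0)
  have hs := hasSum_fcoef (h.continuous 0 (by norm_num)) (h.periodic 0 (by norm_num)) h.summable x
  set u : ℤ → ℂ := fun k => fcoef (F 0) k * Complex.exp (2 * Real.pi * Complex.I * k * x) with hu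
  have e := hs.summable.sum_add_tsum_subtype_compl (Icc (-(K : ℤ)) K)
  rw [hs.tsum_eq] at e
  have e2 : fourierProj K (F 0) x - F 0 x
      = - (∑' k : {k // k ∉ Icc (-(K : ℤ)) K}, u k).re := by
    have := congrArg Complex.re e
    rw [Complex.add_re, Complex.ofReal_re] at this
    rw [← this, fourierProj]
    ring
  rw [e2, abs_neg]
  refine (Complex.abs_re_le_norm _).trans ?_
  -- Of the five powers of decay, three are spent on `|k| ≥ K + 1` to gain `h³`, and two keep the
  -- tail summable with a constant independent of `K`.
  have hb : ∀ k : {k // k ∉ Icc (-(K : ℤ)) K},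
      ‖u k‖ ≤ M / ((K : ℝ) + 1) ^ 3 * (1 / ((k : ℤ) : ℝ) ^ 2) := by
    rintro ⟨k, hk⟩
    have hk1 : (K : ℤ) + 1 ≤ |k| := by
      rw [mem_Icc, not_and_or, not_le, not_le] at hk
      rcases hk with hk | hk
      · rw [abs_of_neg (by omega)]; omega
      · rw [abs_of_pos (by omega)]; omega
    have hk0 : k ≠ 0 := by rintro rfl; simp at hk1; omega
    have hk2 : (K : ℝ) + 1 ≤ |(k : ℝ)| := by exact_mod_cast hk1
    have hk3 : 0 < |(k : ℝ)| := lt_of_lt_of_le (by positivity) hk2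
    simp only [hu, norm_mul, norm_exp_two_pi, mul_one]
    refine (h.norm_fcoef_le hk0).trans ?_
    rw [← sq_abs (k : ℝ), div_mul_div_comm, mul_one]
    refine div_le_div_of_nonneg_left hM (by positivity) ?_
    calc ((K : ℝ) + 1) ^ 3 * |(k : ℝ)| ^ 2 ≤ |(k : ℝ)| ^ 3 * |(k : ℝ)| ^ 2 := by gcongr
      _ = |(k : ℝ)| ^ 5 := by ring
  have hs2 : Summable fun k : {k // k ∉ Icc (-(K : ℤ)) K} =>
      M / ((K : ℝ) + 1) ^ 3 * (1 / ((k : ℤ) : ℝ) ^ 2) :=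
    (hsum.mul_left _).comp_injective Subtype.val_injective
  have h1 := tsum_of_norm_bounded hs2.hasSum hb
  refine h1.trans ?_
  rw [tsum_mul_left]
  have h2 : ∑' k : {k // k ∉ Icc (-(K : ℤ)) K}, 1 / ((k : ℤ) : ℝ) ^ 2
      ≤ ∑' k : ℤ, 1 / (k : ℝ) ^ 2 :=
    hsum.tsum_subtype_le (fun k : ℤ => 1 / (k : ℝ) ^ 2) {k | k ∉ Icc (-(K : ℤ)) K}
      (fun k => by positivity)
  -- The factor 8 comes from `2K + 1 ≤ 2 (K + 1)`.
  have h3 : 1 / ((K : ℝ) + 1) ^ 3 ≤ 8 * mesh (2 * K + 1) ^ 3 := by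
    rw [mesh, div_pow, one_pow, mul_one_div, div_le_div_iff₀ (by positivity) (by positivity)]
    push_cast
    have : (2 * (K : ℝ) + 1) ^ 3 ≤ (2 * (K + 1)) ^ 3 := by gcongr; linarith
    linarith
  calc M / ((K : ℝ) + 1) ^ 3 * ∑' k : {k // k ∉ Icc (-(K : ℤ)) K}, 1 / ((k : ℤ) : ℝ) ^ 2
      = M * (1 / ((K : ℝ) + 1) ^ 3) * ∑' k : {k // k ∉ Icc (-(K : ℤ)) K}, 1 / ((k : ℤ) : ℝ) ^ 2 := by
        ring
    _ ≤ M * (8 * mesh (2 * K + 1) ^ 3) * (∑' k : ℤ, 1 / (k : ℝ) ^ 2 + 1) := by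
        have h4 : 0 ≤ M * (8 * mesh (2 * K + 1) ^ 3) :=
          mul_nonneg hM (mul_nonneg (by norm_num) (pow_nonneg mesh_pos.le 3))
        exact mul_le_mul (mul_le_mul_of_nonneg_left h3 hM) (by linarith)
          (tsum_nonneg fun k => by positivity) h4
    _ = _ := by ring

theorem fourierProj_sub {f g : ℝ → ℝ} (hf : Continuous f) (hg : Continuous g) (K : ℕ) (x : ℝ) :
    fourierProj K (fun s => f s - g s) x = fourierProj K f x - fourierProj K g x := by
  have h := fcoef_sub hf hg
  simp only [fcoef] at h
  simp only [fourierProj, h, sub_mul, sum_sub_distrib, Complex.sub_re]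

/-- The horizontal grid points. -/
def gridX {N : ℕ} (i : ZMod N) : ℝ := ((i.val : ℝ) + 1 / 2) * mesh N

/-- A geometric sum over the powers of an `N`-th root of unity, which differs from 1 because `0 <
|k| < N`. The half-cell shift of the grid only contributes a common phase. -/
theorem sum_exp_gridX {N : ℕ} [NeZero N] {k : ℤ} (hk : |k| < N) :
    ∑ i : ZMod N, Complex.exp (2 * Real.pi * Complex.I * k * (gridX i : ℝ))
      = if k = 0 then (N : ℂ) else 0 := by
  split_ifs with h0
  · subst h0
    simp [ZMod.card]
  have hN0 : (N : ℂ) ≠ 0 := by exact_mod_cast NeZero.ne N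
  set ζ := Complex.exp (2 * Real.pi * Complex.I * k / N) with hζ
  have hζ1 : ζ ≠ 1 := by
    intro h
    obtain ⟨m, hm⟩ := Complex.exp_eq_one_iff.mp h
    have h1 : (k : ℂ) = m * N := by
      field_simp at hm
      linear_combination hm
    have h2 : k = m * N := by exact_mod_cast h1
    have h3 : m = 0 := by
      by_contra hm0
      have : (N : ℤ) ≤ |k| := by
        rw [h2, abs_mul, Nat.abs_cast]
        exact le_mul_of_one_le_left (by positivity) (Int.one_le_abs hm0)
      omega
    exact h0 (by rw [h2, h3, zero_mul])
  have hζN : ζ ^ N = 1 := by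
    rw [hζ, ← Complex.exp_nat_mul, mul_div_cancel₀ _ hN0]
    exact Complex.exp_eq_one_iff.mpr ⟨k, by ring⟩
  have hterm : ∀ n ∈ range N, Complex.exp (2 * Real.pi * Complex.I * k
      * (gridX (n : ZMod N) : ℝ)) = Complex.exp (Real.pi * Complex.I * k / N) * ζ ^ n := by
    intro n hn
    rw [hζ, ← Complex.exp_nat_mul, ← Complex.exp_add, gridX, ZMod.val_cast_of_lt (mem_range.mp hn),
      mesh]
    congr 1
    push_cast
    field_simp
    ring
  rw [← sum_range_natCast, sum_congr rfl hterm, ← mul_sum, geom_sum_eq hζ1, hζN]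
  simp

/-- On the grid, the mean of the Fourier projection is the integral. -/
theorem sum_fourierProj_gridX (K : ℕ) (f : ℝ → ℝ) :
    mesh (2 * K + 1) * ∑ i : ZMod (2 * K + 1), fourierProj K f (gridX i)
      = ∫ x in (0 : ℝ)..1, f x := by
  rw [← fcoef_zero]
  simp only [fourierProj]
  rw [← Complex.re_sum, sum_comm]
  have : ∀ k ∈ Icc (-(K : ℤ)) K, ∑ i : ZMod (2 * K + 1),
      fcoef f k * Complex.exp (2 * Real.pi * Complex.I * k * (gridX i : ℝ))
        = if k = 0 then fcoef f k * ((2 * K + 1 : ℕ) : ℂ) else 0 := by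
    intro k hk
    rw [mem_Icc, ← abs_le] at hk
    -- Frequencies up to `K` are below `N = 2K + 1`, so there is no aliasing and only the zero mode
    -- survives.
    rw [← mul_sum, sum_exp_gridX (by omega), mul_ite, mul_zero]
  rw [sum_congr rfl this, sum_ite_eq', if_pos (by simp)]
  rw [show ((2 * K + 1 : ℕ) : ℂ) = (((2 * K + 1 : ℕ) : ℝ) : ℂ) by push_cast; rfl,
    Complex.re_mul_ofReal, mul_comm, mul_assoc, mul_comm _ (mesh _), mesh_mul, mul_one]

/-! ### Smooth functions on space-time that are periodic in `x` -/

/-- The direction of time. -/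
def et : ℝ × ℝ × ℝ := (1, 0, 0)
/-- The tangential direction. -/
def ex : ℝ × ℝ × ℝ := (0, 1, 0)
/-- The normal direction. -/
def ey : ℝ × ℝ × ℝ := (0, 0, 1)

/-- Directional derivatives. -/
def pd (v : ℝ × ℝ × ℝ) (G : ℝ × ℝ × ℝ → ℝ) : ℝ × ℝ × ℝ → ℝ := fun p => fderiv ℝ G p v

/-- The spatial Laplacian. -/
def lap (G : ℝ × ℝ × ℝ → ℝ) : ℝ × ℝ × ℝ → ℝ := fun p => pd ex (pd ex G) p + pd ey (pd ey G) p

/-- Functions of class `C^n` of `(t, x, y)` with period one in `x`. -/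
structure PerSmooth (n : ℕ) (G : ℝ × ℝ × ℝ → ℝ) : Prop where
  smooth : ContDiff ℝ n G
  periodic : ∀ t x y, G (t, x + 1, y) = G (t, x, y)

namespace PerSmooth

variable {n : ℕ} {G H : ℝ × ℝ × ℝ → ℝ}

theorem of_le (h : PerSmooth n G) {m : ℕ} (hm : m ≤ n) : PerSmooth m G :=
  ⟨h.smooth.of_le (by exact_mod_cast hm), h.periodic⟩

theorem pd (h : PerSmooth (n + 1) G) (v : ℝ × ℝ × ℝ) : PerSmooth n (CHDBC.pd v G) := by
  refine ⟨(h.smooth.fderiv_right (m := n) (by exact_mod_cast le_rfl)).clm_apply contDiff_const,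
    fun t x y => ?_⟩
  have hG : (fun p => G (p + ex)) = G := by
    funext p
    have := h.periodic p.1 p.2.1 p.2.2
    simpa [ex, Prod.add_def] using this
  have := fderiv_comp_add_right (𝕜 := ℝ) (f := G) (x := (t, x, y)) ex
  rw [hG] at this
  simp only [CHDBC.pd]
  rw [this]
  simp [ex]

theorem add (h : PerSmooth n G) (h' : PerSmooth n H) : PerSmooth n (fun p => G p + H p) :=
  ⟨h.smooth.add h'.smooth, fun t x y => by rw [h.periodic, h'.periodic]⟩

theorem sub (h : PerSmooth n G) (h' : PerSmooth n H) : PerSmooth n (fun p => G p - H p) :=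
  ⟨h.smooth.sub h'.smooth, fun t x y => by rw [h.periodic, h'.periodic]⟩

theorem const_mul (h : PerSmooth n G) (c : ℝ) : PerSmooth n (fun p => c * G p) :=
  ⟨contDiff_const.mul h.smooth, fun t x y => by rw [h.periodic]⟩

theorem comp (h : PerSmooth n G) {F : ℝ → ℝ} (hF : ContDiff ℝ n F) :
    PerSmooth n (fun p => F (G p)) :=
  ⟨hF.comp h.smooth, fun t x y => by rw [h.periodic]⟩

theorem lap (h : PerSmooth (n + 2) G) : PerSmooth n (CHDBC.lap G) :=
  ((h.pd ex).pd ex).add ((h.pd ey).pd ey)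

theorem continuous (h : PerSmooth n G) : Continuous G := h.smooth.continuous

theorem hasFDerivAt (h : PerSmooth (n + 1) G) (p : ℝ × ℝ × ℝ) :
    HasFDerivAt G (fderiv ℝ G p) p :=
  (h.smooth.differentiable (by simp) p).hasFDerivAt

theorem hasDerivAt_t (h : PerSmooth (n + 1) G) (t x y : ℝ) :
    HasDerivAt (fun s => G (s, x, y)) (CHDBC.pd et G (t, x, y)) t :=
  (h.hasFDerivAt (t, x, y)).comp_hasDerivAt t
    ((hasDerivAt_id t).prodMk ((hasDerivAt_const t x).prodMk (hasDerivAt_const t y)))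

theorem hasDerivAt_x (h : PerSmooth (n + 1) G) (t x y : ℝ) :
    HasDerivAt (fun s => G (t, s, y)) (CHDBC.pd ex G (t, x, y)) x :=
  (h.hasFDerivAt (t, x, y)).comp_hasDerivAt x
    ((hasDerivAt_const x t).prodMk ((hasDerivAt_id x).prodMk (hasDerivAt_const x y)))

theorem hasDerivAt_y (h : PerSmooth (n + 1) G) (t x y : ℝ) :
    HasDerivAt (fun s => G (t, x, s)) (CHDBC.pd ey G (t, x, y)) y :=
  (h.hasFDerivAt (t, x, y)).comp_hasDerivAt y
    ((hasDerivAt_const y t).prodMk ((hasDerivAt_const y x).prodMk (hasDerivAt_id y)))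

/-- Periodicity reduces `x` to one period, and the remaining domain is compact. -/
theorem exists_bound (h : PerSmooth n G) (T : ℝ) : ∃ C > 0, ∀ t ∈ Set.Icc 0 T, ∀ x,
    ∀ y ∈ Set.Icc (0 : ℝ) 1, |G (t, x, y)| ≤ C := by
  have hc : IsCompact (Set.Icc 0 T ×ˢ Set.Icc (0 : ℝ) 1 ×ˢ Set.Icc (0 : ℝ) 1) :=
    isCompact_Icc.prod (isCompact_Icc.prod isCompact_Icc)
  obtain ⟨C, hC⟩ := hc.exists_bound_of_continuousOn h.continuous.continuousOn
  refine ⟨|C| + 1, by positivity, fun t ht x y hy => ?_⟩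
  have hper : Function.Periodic (fun s => G (t, s, y)) 1 := fun s => h.periodic t s y
  have hx : G (t, x, y) = G (t, Int.fract x, y) := by
    have := hper.sub_int_mul_eq (x := x) ⌊x⌋
    simp only [mul_one] at this
    rw [← this]
    rfl
  rw [hx]
  have := hC (t, Int.fract x, y) ⟨ht, ⟨Int.fract_nonneg x, (Int.fract_lt_one x).le⟩, hy⟩
  rw [Real.norm_eq_abs] at this
  linarith [le_abs_self C]

end PerSmooth

/-! ### Taylor estimates for difference quotients -/

/-- One integration of a power bound, without the gain `1 / (k + 1)`. The Taylor estimates below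
iterate it on remainders that vanish at `0` together with the derivatives used, with the step size
as the variable. -/
theorem abs_le_of_deriv_le {f f' : ℝ → ℝ} {M S : ℝ} {k : ℕ} (h0 : f 0 = 0)
    (hf : ∀ s, HasDerivAt f (f' s) s) (hM : 0 ≤ M)
    (hb : ∀ s ∈ Set.Icc 0 S, |f' s| ≤ M * s ^ k) : ∀ s ∈ Set.Icc 0 S, |f s| ≤ M * s ^ (k + 1) := by
  intro s hs
  have h := (convex_Icc 0 s).norm_image_sub_le_of_norm_hasDerivWithin_le (f := f) (f' := f')
    (C := M * s ^ k) (x := 0) (y := s) (fun r _ => (hf r).hasDerivWithinAt) (fun r hr => by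
      refine (hb r ⟨hr.1, hr.2.trans hs.2⟩).trans ?_
      exact mul_le_mul_of_nonneg_left (pow_le_pow_left₀ hr.1 hr.2 k) hM)
    ⟨le_rfl, hs.1⟩ ⟨hs.1, le_rfl⟩
  rw [h0, sub_zero, sub_zero, Real.norm_eq_abs, Real.norm_eq_abs, abs_of_nonneg hs.1] at h
  rwa [pow_succ, ← mul_assoc]

theorem HasDerivAt.comp_affine {f : ℝ → ℝ} {f' : ℝ} (a b s : ℝ) (h : HasDerivAt f f' (a + b * s)) :
    HasDerivAt (fun s => f (a + b * s)) (b * f') s := by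
  have h1 : HasDerivAt (fun s => a + b * s) b s := by
    simpa using ((hasDerivAt_id s).const_mul b).const_add a
  have := HasDerivAt.comp s h h1
  rwa [mul_comm] at this

section Taylor

variable {f₀ f₁ f₂ f₃ f₄ : ℝ → ℝ} {a b h M : ℝ}

/-- The remainder is differentiated in the step size: each derivative turns the symmetric sum at `a
± s` into the antisymmetric difference or back, so all odd terms cancel. -/
theorem abs_second_difference_le (h1 : ∀ x, HasDerivAt f₀ (f₁ x) x)
    (h2 : ∀ x, HasDerivAt f₁ (f₂ x) x) (h3 : ∀ x, HasDerivAt f₂ (f₃ x) x)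
    (h4 : ∀ x, HasDerivAt f₃ (f₄ x) x) (hh : 0 ≤ h)
    (hM : ∀ x ∈ Set.Icc (a - h) (a + h), |f₄ x| ≤ M) :
    |f₀ (a + h) - 2 * f₀ a + f₀ (a - h) - h ^ 2 * f₂ a| ≤ 2 * M * h ^ 4 := by
  have hM0 : 0 ≤ M := (abs_nonneg _).trans (hM a ⟨by linarith, by linarith⟩)
  have d : ∀ {g g' : ℝ → ℝ}, (∀ x, HasDerivAt g (g' x) x) → ∀ c s,
      HasDerivAt (fun s => g (a + c * s)) (c * g' (a + c * s)) s :=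
    fun hg c s => HasDerivAt.comp_affine a c s (hg _)
  have k4 : ∀ s ∈ Set.Icc 0 h, |f₄ (a + 1 * s) + f₄ (a + -1 * s)| ≤ 2 * M * s ^ 0 := by
    intro s hs
    refine (abs_add_le _ _).trans ?_
    have := hM (a + 1 * s) ⟨by linarith [hs.1], by linarith [hs.2]⟩
    have := hM (a + -1 * s) ⟨by linarith [hs.2], by linarith [hs.1]⟩
    linarith
  have k3 := abs_le_of_deriv_le (f := fun s => f₃ (a + 1 * s) - f₃ (a + -1 * s)) (by simp)
    (fun s => by
      refine ((d h4 1 s).sub (d h4 (-1) s)).congr_deriv ?_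
      ring) (by positivity) k4
  have k2 := abs_le_of_deriv_le
    (f := fun s => f₂ (a + 1 * s) + f₂ (a + -1 * s) - 2 * f₂ a) (by simp; ring)
    (fun s => by
      refine (((d h3 1 s).add (d h3 (-1) s)).sub_const _).congr_deriv ?_
      ring) (by positivity) k3
  have k1 := abs_le_of_deriv_le
    (f := fun s => f₁ (a + 1 * s) - f₁ (a + -1 * s) - (2 * f₂ a) * s) (by simp)
    (fun s => by
      refine (((d h2 1 s).sub (d h2 (-1) s)).sub ((hasDerivAt_id s).const_mul _)).congr_deriv ?_
      ring) (by positivity) k2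
  have k0 := abs_le_of_deriv_le
    (f := fun s => f₀ (a + 1 * s) + f₀ (a + -1 * s) - 2 * f₀ a - f₂ a * s ^ 2) (by simp; ring)
    (fun s => by
      refine ((((d h1 1 s).add (d h1 (-1) s)).sub_const _).sub
        ((hasDerivAt_pow 2 s).const_mul _)).congr_deriv ?_
      simp
      ring) (by positivity) k1 h ⟨hh, le_rfl⟩
  refine (le_of_eq ?_).trans k0
  congr 1
  simp only [one_mul, neg_mul, sub_eq_add_neg]
  ring

/-- The sign `σ` points into the domain, so only values on one side of `a` are bounded. This is what
the boundary rows need. -/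
theorem abs_one_sided_difference_le {σ : ℝ} (hσ : σ ^ 2 = 1) (h1 : ∀ x, HasDerivAt f₀ (f₁ x) x)
    (h2 : ∀ x, HasDerivAt f₁ (f₂ x) x) (h3 : ∀ x, HasDerivAt f₂ (f₃ x) x) (hh : 0 ≤ h)
    (hM : ∀ s ∈ Set.Icc 0 h, |f₃ (a + σ * s)| ≤ M) :
    |f₀ (a + σ * h) - f₀ a - σ * h * f₁ a - h ^ 2 / 2 * f₂ a| ≤ M * h ^ 3 := by
  have hM0 : 0 ≤ M := (abs_nonneg _).trans (hM 0 ⟨le_rfl, hh⟩)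
  have hσ' : |σ| = 1 := by
    rw [← abs_one, ← sq_eq_sq_iff_abs_eq_abs, hσ, one_pow]
  have d : ∀ {g g' : ℝ → ℝ}, (∀ x, HasDerivAt g (g' x) x) → ∀ c s,
      HasDerivAt (fun s => g (a + c * s)) (c * g' (a + c * s)) s :=
    fun hg c s => HasDerivAt.comp_affine a c s (hg _)
  have k3 : ∀ s ∈ Set.Icc 0 h, |σ * f₃ (a + σ * s)| ≤ M * s ^ 0 := by
    intro s hs
    rw [abs_mul, hσ', one_mul, pow_zero, mul_one]
    exact hM s hs
  have k2 := abs_le_of_deriv_le (f := fun s => f₂ (a + σ * s) - f₂ a) (by simp)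
    (fun s => (d h3 σ s).sub_const _) hM0 k3
  have k1 := abs_le_of_deriv_le (f := fun s => σ * f₁ (a + σ * s) - σ * f₁ a - f₂ a * s) (by simp)
    (fun s => by
      refine ((((d h2 σ s).const_mul σ).sub_const _).sub
        ((hasDerivAt_id s).const_mul _)).congr_deriv ?_
      linear_combination f₂ (a + σ * s) * hσ) hM0 k2
  have k0 := abs_le_of_deriv_le
    (f := fun s => f₀ (a + σ * s) - f₀ a - σ * f₁ a * s - f₂ a / 2 * s ^ 2) (by simp)
    (fun s => by
      refine ((((d h1 σ s).sub_const _).sub ((hasDerivAt_id s).const_mul _)).sub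
        ((hasDerivAt_pow 2 s).const_mul _)).congr_deriv ?_
      simp
      ring) hM0 k1 h ⟨hh, le_rfl⟩
  refine (le_of_eq ?_).trans k0
  congr 1
  ring

/-- After removal of its linear part, the numerator has vanishing value and first two derivatives at
zero step; its third derivative is at most `(4 + 8) M`. Division by `2 h` yields the constant 6. -/
theorem abs_bdf_le (h1 : ∀ x, HasDerivAt f₀ (f₁ x) x) (h2 : ∀ x, HasDerivAt f₁ (f₂ x) x)
    (h3 : ∀ x, HasDerivAt f₂ (f₃ x) x) (hh : 0 < h)
    (hM : ∀ x ∈ Set.Icc (b - 2 * h) b, |f₃ x| ≤ M) :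
    |(3 * f₀ b - 4 * f₀ (b - h) + f₀ (b - 2 * h)) / (2 * h) - f₁ b| ≤ 6 * M * h ^ 2 := by
  have hM0 : 0 ≤ M := (abs_nonneg _).trans (hM b ⟨by linarith, by linarith⟩)
  have d : ∀ {g g' : ℝ → ℝ}, (∀ x, HasDerivAt g (g' x) x) → ∀ c s,
      HasDerivAt (fun s => g (b + c * s)) (c * g' (b + c * s)) s :=
    fun hg c s => HasDerivAt.comp_affine b c s (hg _)
  have k3 : ∀ s ∈ Set.Icc 0 h, |4 * f₃ (b + -1 * s) - 8 * f₃ (b + -2 * s)| ≤ 12 * M * s ^ 0 := by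
    intro s hs
    have a1 := abs_le.mp (hM (b + -1 * s) ⟨by linarith [hs.1, hs.2], by linarith [hs.1]⟩)
    have a2 := abs_le.mp (hM (b + -2 * s) ⟨by linarith [hs.1, hs.2], by linarith [hs.1]⟩)
    rw [abs_le]
    constructor <;> linarith [a1.1, a1.2, a2.1, a2.2]
  have k2 := abs_le_of_deriv_le (f := fun s => -4 * f₂ (b + -1 * s) + 4 * f₂ (b + -2 * s))
    (by simp) (fun s => by
      refine (((d h3 (-1) s).const_mul (-4)).add ((d h3 (-2) s).const_mul 4)).congr_deriv ?_
      ring) (by positivity) k3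
  have k1 := abs_le_of_deriv_le
    (f := fun s => 4 * f₁ (b + -1 * s) - 2 * f₁ (b + -2 * s) - 2 * f₁ b) (by simp; ring)
    (fun s => by
      refine ((((d h2 (-1) s).const_mul 4).sub ((d h2 (-2) s).const_mul 2)).sub_const
        _).congr_deriv ?_
      ring) (by positivity) k2
  have k0 := abs_le_of_deriv_le
    (f := fun s => 3 * f₀ b - 4 * f₀ (b + -1 * s) + f₀ (b + -2 * s) - (2 * f₁ b) * s)
    (by simp; ring)
    (fun s => by
      refine (((((d h1 (-1) s).const_mul 4).const_sub (3 * f₀ b)).add (d h1 (-2) s)).sub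
        ((hasDerivAt_id s).const_mul _)).congr_deriv ?_
      ring) (by positivity) k1 h ⟨hh.le, le_rfl⟩
  have e : (3 * f₀ b - 4 * f₀ (b - h) + f₀ (b - 2 * h)) / (2 * h) - f₁ b
      = (3 * f₀ b - 4 * f₀ (b + -1 * h) + f₀ (b + -2 * h) - (2 * f₁ b) * h) / (2 * h) := by
    rw [show b + -1 * h = b - h by ring, show b + -2 * h = b - 2 * h by ring]
    field_simp
  rw [e, abs_div, abs_of_pos (by positivity : 0 < 2 * h), div_le_iff₀ (by positivity)]
  refine k0.trans (le_of_eq (by ring))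

theorem abs_extrapolation_le (h1 : ∀ x, HasDerivAt f₀ (f₁ x) x)
    (h2 : ∀ x, HasDerivAt f₁ (f₂ x) x) (hh : 0 ≤ h)
    (hM : ∀ x ∈ Set.Icc (b - 2 * h) b, |f₂ x| ≤ M) :
    |f₀ b - 2 * f₀ (b - h) + f₀ (b - 2 * h)| ≤ 6 * M * h ^ 2 := by
  have hM0 : 0 ≤ M := (abs_nonneg _).trans (hM b ⟨by linarith, by linarith⟩)
  have d : ∀ {g g' : ℝ → ℝ}, (∀ x, HasDerivAt g (g' x) x) → ∀ c s,
      HasDerivAt (fun s => g (b + c * s)) (c * g' (b + c * s)) s :=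
    fun hg c s => HasDerivAt.comp_affine b c s (hg _)
  have k2 : ∀ s ∈ Set.Icc 0 h, |-2 * f₂ (b + -1 * s) + 4 * f₂ (b + -2 * s)| ≤ 6 * M * s ^ 0 := by
    intro s hs
    have a1 := abs_le.mp (hM (b + -1 * s) ⟨by linarith [hs.1, hs.2], by linarith [hs.1]⟩)
    have a2 := abs_le.mp (hM (b + -2 * s) ⟨by linarith [hs.1, hs.2], by linarith [hs.1]⟩)
    rw [abs_le]
    constructor <;> linarith [a1.1, a1.2, a2.1, a2.2]
  have k1 := abs_le_of_deriv_le (f := fun s => 2 * f₁ (b + -1 * s) - 2 * f₁ (b + -2 * s))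
    (by simp) (fun s => by
      refine (((d h2 (-1) s).const_mul 2).sub ((d h2 (-2) s).const_mul 2)).congr_deriv ?_
      ring) (by positivity) k2
  have k0 := abs_le_of_deriv_le
    (f := fun s => f₀ b - 2 * f₀ (b + -1 * s) + f₀ (b + -2 * s)) (by simp; ring)
    (fun s => by
      refine ((((d h1 (-1) s).const_mul 2).const_sub (f₀ b)).add (d h1 (-2) s)).congr_deriv ?_
      ring) (by positivity) k1 h ⟨hh, le_rfl⟩
  refine (le_of_eq ?_).trans k0
  congr 1
  simp only [neg_mul, one_mul, sub_eq_add_neg]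

theorem abs_sub_le_of_deriv {C : ℝ} {s : Set ℝ} (hs : Convex ℝ s) {f f' : ℝ → ℝ}
    (hf : ∀ x, HasDerivAt f (f' x) x) (hb : ∀ x ∈ s, |f' x| ≤ C) {x y : ℝ} (hx : x ∈ s)
    (hy : y ∈ s) : |f y - f x| ≤ C * |y - x| :=
  hs.norm_image_sub_le_of_norm_hasDerivWithin_le (fun r _ => (hf r).hasDerivWithinAt) hb hx hy

end Taylor

/-! ### Sampling on the grid -/

section Sampling

set_option linter.unusedSectionVars false

variable {N : ℕ} [NeZero N]

/-- The values of `G` at time `t` on the grid. -/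
def samp (N : ℕ) [NeZero N] (G : ℝ × ℝ × ℝ → ℝ) (t : ℝ) : Grid N :=
  fun i j => G (t, gridX i, j * mesh N)

theorem mesh_le_one : mesh N ≤ 1 := by
  unfold mesh
  have : (1 : ℝ) ≤ N := by exact_mod_cast Nat.pos_of_ne_zero (NeZero.ne N)
  exact div_le_one_of_le₀ this (by positivity)

/-- The second case is the wrap-around from the last index to the first, where the grid points
differ from a shift by one full period. -/
theorem gridX_add_one (i : ZMod N) :
    gridX (i + 1) = gridX i + mesh N ∨ gridX (i + 1) + 1 = gridX i + mesh N := by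
  have h : (i + 1).val = (i.val + 1) % N := by
    conv_lhs => rw [← ZMod.natCast_zmod_val i]
    rw [← Nat.cast_succ, ZMod.val_natCast]
  have hi := ZMod.val_lt i
  unfold gridX
  rcases Nat.lt_or_ge (i.val + 1) N with h1 | h1
  · left
    rw [h, Nat.mod_eq_of_lt h1]
    push_cast
    ring
  · right
    have h2 : i.val + 1 = N := by omega
    rw [h, h2, Nat.mod_self]
    have h3 : (i.val : ℝ) = N - 1 := by
      have : ((i.val + 1 : ℕ) : ℝ) = N := congrArg _ h2
      push_cast at this
      linarith
    have := mesh_mul N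
    rw [h3]
    push_cast
    linear_combination -this

theorem apply_gridX_add_one {f : ℝ → ℝ} (hf : ∀ x, f (x + 1) = f x) (i : ZMod N) :
    f (gridX (i + 1)) = f (gridX i + mesh N) := by
  rcases gridX_add_one i with h | h
  · rw [h]
  · rw [← h, hf]

theorem apply_gridX_sub_one {f : ℝ → ℝ} (hf : ∀ x, f (x + 1) = f x) (i : ZMod N) :
    f (gridX (i - 1)) = f (gridX i - mesh N) := by
  have h := gridX_add_one (i - 1)
  rw [sub_add_cancel] at h
  rcases h with h | h
  · rw [h, add_sub_cancel_right]
  · rw [show gridX (i - 1) = gridX i - mesh N + 1 by linarith, hf]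

theorem mul_mesh_mem {j : ℕ} (hj : j ≤ N) : ((j : ℤ) : ℝ) * mesh N ∈ Set.Icc (0 : ℝ) 1 := by
  refine ⟨mul_nonneg (by positivity) mesh_pos.le, ?_⟩
  rw [← mesh_mul N, mul_comm]
  refine mul_le_mul_of_nonneg_left ?_ mesh_pos.le
  exact_mod_cast hj

theorem PerSmooth.exists_Dxx_samp {G : ℝ × ℝ × ℝ → ℝ} (hG : PerSmooth 4 G) (T : ℝ) : ∃ C > 0,
    ∀ t ∈ Set.Icc 0 T, ∀ (N : ℕ) [NeZero N] (i : ZMod N) (j : ℕ), j ≤ N →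
      |Dxx (fun k => samp N G t k j) i - samp N (CHDBC.pd ex (CHDBC.pd ex G)) t i j|
        ≤ C * mesh N ^ 2 := by
  obtain ⟨C, hC, hb⟩ := ((((hG.pd ex).pd ex).pd ex).pd ex).exists_bound T
  refine ⟨2 * C, by positivity, fun t ht N _ i j hj => ?_⟩
  have hm := mesh_pos (N := N)
  have h := abs_second_difference_le (a := gridX i) (h := mesh N) (M := C)
    (fun x => hG.hasDerivAt_x t x (((j : ℤ) : ℝ) * mesh N))
    (fun x => (hG.pd ex).hasDerivAt_x t x _) (fun x => ((hG.pd ex).pd ex).hasDerivAt_x t x _)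
    (fun x => (((hG.pd ex).pd ex).pd ex).hasDerivAt_x t x _) hm.le
    (fun x _ => hb t ht x _ (mul_mesh_mem hj))
  have e : Dxx (fun k => samp N G t k j) i - samp N (CHDBC.pd ex (CHDBC.pd ex G)) t i j
      = (G (t, gridX i + mesh N, ((j : ℤ) : ℝ) * mesh N)
        - 2 * G (t, gridX i, ((j : ℤ) : ℝ) * mesh N)
        + G (t, gridX i - mesh N, ((j : ℤ) : ℝ) * mesh N)
        - mesh N ^ 2 * samp N (CHDBC.pd ex (CHDBC.pd ex G)) t i j) / mesh N ^ 2 := by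
    rw [Dxx]
    simp only [samp]
    rw [apply_gridX_add_one (f := fun x => G (t, x, ((j : ℤ) : ℝ) * mesh N))
        (fun x => hG.periodic _ _ _),
      apply_gridX_sub_one (f := fun x => G (t, x, ((j : ℤ) : ℝ) * mesh N))
        (fun x => hG.periodic _ _ _)]
    field_simp
  rw [e, abs_div, abs_of_pos (pow_pos hm 2), div_le_iff₀ (pow_pos hm 2)]
  exact h.trans (le_of_eq (by ring))

theorem abs_div_sub_le {x a m C : ℝ} (hm : 0 < m) (h : |x - m * a| ≤ C * m) : |x / m - a| ≤ C := by
  rw [show x / m - a = (x - m * a) / m by field_simp, abs_div, abs_of_pos hm, div_le_iff₀ hm]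
  exact h

/-- Consistency of `L_h`; on the boundary rows only up to the normal derivative. -/
theorem PerSmooth.exists_Lh_samp {G : ℝ × ℝ × ℝ → ℝ} (hG : PerSmooth 4 G) (T : ℝ) : ∃ C > 0,
    ∀ t ∈ Set.Icc 0 T, ∀ (N : ℕ) [NeZero N] (i : ZMod N),
      (∀ j : ℕ, 0 < j → j < N →
        |Lh (samp N G t) i j + samp N (CHDBC.lap G) t i j| ≤ C * mesh N ^ 2) ∧
      |Lh (samp N G t) i N + samp N (CHDBC.lap G) t i N
        - 2 / mesh N * samp N (CHDBC.pd ey G) t i N| ≤ C * mesh N ∧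
      |Lh (samp N G t) i 0 + samp N (CHDBC.lap G) t i 0
        + 2 / mesh N * samp N (CHDBC.pd ey G) t i 0| ≤ C * mesh N := by
  obtain ⟨C₁, hC₁, h₁⟩ := hG.exists_Dxx_samp T
  obtain ⟨C₂, hC₂, h₂⟩ := ((((hG.pd ey).pd ey).pd ey).pd ey).exists_bound T
  obtain ⟨C₃, hC₃, h₃⟩ := (((hG.pd ey).pd ey).pd ey).exists_bound T
  refine ⟨C₁ + 2 * C₂ + 2 * C₃, by positivity, fun t ht N _ i => ?_⟩
  have hm := mesh_pos (N := N)
  have hm1 := mesh_le_one (N := N)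
  have hN := NeZero.ne N
  have hmN := mesh_mul N
  have hsq : mesh N ^ 2 ≤ mesh N := by nlinarith
  have d0 := fun y => hG.hasDerivAt_y t (gridX i) y
  have d1 := fun y => (hG.pd ey).hasDerivAt_y t (gridX i) y
  have d2 := fun y => ((hG.pd ey).pd ey).hasDerivAt_y t (gridX i) y
  have d3 := fun y => (((hG.pd ey).pd ey).pd ey).hasDerivAt_y t (gridX i) y
  refine ⟨fun j h0 hj => ?_, ?_, ?_⟩
  · have a1 := h₁ t ht N i j hj.le
    have hj1 : (j : ℝ) + 1 ≤ N := by exact_mod_cast hj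
    have hj0 : (1 : ℝ) ≤ j := by exact_mod_cast h0
    have a2 := abs_second_difference_le (a := ((j : ℤ) : ℝ) * mesh N) (h := mesh N) (M := C₂)
      d0 d1 d2 d3 hm.le (fun y hy => h₂ t ht _ y ⟨by
        have := hy.1
        push_cast at this
        nlinarith, by
        have := hy.2
        push_cast at this
        nlinarith⟩)
    have a3 := abs_div_sub_le (m := mesh N ^ 2) (C := 2 * C₂ * mesh N ^ 2) (pow_pos hm 2)
      (a2.trans (le_of_eq (by ring)))
    have hj0' : ¬ ((j : ℤ) = 0) := by omega
    have hjN' : ¬ ((j : ℤ) = N) := by omega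
    have e : Lh (samp N G t) i j = - Dxx (fun k => samp N G t k j) i
        - (G (t, gridX i, ((j : ℤ) : ℝ) * mesh N + mesh N)
          - 2 * G (t, gridX i, ((j : ℤ) : ℝ) * mesh N)
          + G (t, gridX i, ((j : ℤ) : ℝ) * mesh N - mesh N)) / mesh N ^ 2 := by
      simp only [Lh, hj0', hjN', if_false, lapH]
      simp only [samp]
      push_cast
      rw [add_mul, sub_mul, one_mul]
      ring
    rw [e]
    have b1 := abs_le.mp a1
    have b3 := abs_le.mp a3
    have hp : 0 ≤ C₃ * mesh N ^ 2 := by positivity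
    rw [abs_le]
    simp only [samp, CHDBC.lap] at b1 b3 ⊢
    constructor <;> linarith [b1.1, b1.2, b3.1, b3.2]
  · have a1 := h₁ t ht N i N le_rfl
    -- On a boundary row `L_h` sees only the inner neighbour: `2 (f_{N-1} - f_N) / h² = -(2/h) f_y +
    -- f_yy + O(h)`. The row at `y = 0` is treated alike with the opposite direction.
    have a2 := abs_one_sided_difference_le (σ := -1) (a := 1) (h := mesh N) (M := C₃) (by norm_num)
      d0 d1 d2 hm.le (fun s hs => h₃ t ht _ _ ⟨by linarith [hs.2], by linarith [hs.1]⟩)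
    have hN0 : ¬ ((N : ℤ) = 0) := by exact_mod_cast hN
    have eN : ((N : ℤ) : ℝ) * mesh N = 1 := by push_cast; linarith
    have e : Lh (samp N G t) i N + samp N (CHDBC.lap G) t i N
        - 2 / mesh N * samp N (CHDBC.pd ey G) t i N
        = - (Dxx (fun k => samp N G t k N) i - samp N (CHDBC.pd ex (CHDBC.pd ex G)) t i N)
          - 2 * ((G (t, gridX i, 1 + -1 * mesh N) - G (t, gridX i, 1)
            - -1 * mesh N * CHDBC.pd ey G (t, gridX i, 1)
            - mesh N ^ 2 / 2 * CHDBC.pd ey (CHDBC.pd ey G) (t, gridX i, 1)) / mesh N ^ 2) := by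
      simp only [Lh, hN0, if_false, if_true]
      simp only [samp, CHDBC.lap]
      push_cast at eN ⊢
      rw [sub_mul, eN, one_mul, show 1 + -1 * mesh N = 1 - mesh N by ring]
      field_simp
      ring
    rw [e]
    have a3 : |(G (t, gridX i, 1 + -1 * mesh N) - G (t, gridX i, 1)
            - -1 * mesh N * CHDBC.pd ey G (t, gridX i, 1)
            - mesh N ^ 2 / 2 * CHDBC.pd ey (CHDBC.pd ey G) (t, gridX i, 1)) / mesh N ^ 2|
        ≤ C₃ * mesh N := by
      rw [abs_div, abs_of_pos (pow_pos hm 2), div_le_iff₀ (pow_pos hm 2)]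
      exact a2.trans (le_of_eq (by ring))
    have b1 := abs_le.mp a1
    have b3 := abs_le.mp a3
    have hp : C₁ * mesh N ^ 2 ≤ C₁ * mesh N := by gcongr
    have hp2 : 0 ≤ C₂ * mesh N := by positivity
    rw [abs_le]
    constructor <;> linarith [b1.1, b1.2, b3.1, b3.2]
  · have a1 := h₁ t ht N i 0 (Nat.zero_le N)
    have a2 := abs_one_sided_difference_le (σ := 1) (a := 0) (h := mesh N) (M := C₃) (by norm_num)
      d0 d1 d2 hm.le (fun s hs => h₃ t ht _ _ ⟨by linarith [hs.1], by linarith [hs.2]⟩)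
    have e : Lh (samp N G t) i 0 + samp N (CHDBC.lap G) t i 0
        + 2 / mesh N * samp N (CHDBC.pd ey G) t i 0
        = - (Dxx (fun k => samp N G t k (0 : ℕ)) i
            - samp N (CHDBC.pd ex (CHDBC.pd ex G)) t i (0 : ℕ))
          - 2 * ((G (t, gridX i, 0 + 1 * mesh N) - G (t, gridX i, 0)
            - 1 * mesh N * CHDBC.pd ey G (t, gridX i, 0)
            - mesh N ^ 2 / 2 * CHDBC.pd ey (CHDBC.pd ey G) (t, gridX i, 0)) / mesh N ^ 2) := by
      simp only [Lh, if_true]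
      simp only [samp, CHDBC.lap]
      push_cast
      simp only [zero_mul, zero_add]
      field_simp
      ring
    rw [e]
    have a3 : |(G (t, gridX i, 0 + 1 * mesh N) - G (t, gridX i, 0)
            - 1 * mesh N * CHDBC.pd ey G (t, gridX i, 0)
            - mesh N ^ 2 / 2 * CHDBC.pd ey (CHDBC.pd ey G) (t, gridX i, 0)) / mesh N ^ 2|
        ≤ C₃ * mesh N := by
      rw [abs_div, abs_of_pos (pow_pos hm 2), div_le_iff₀ (pow_pos hm 2)]
      exact a2.trans (le_of_eq (by ring))
    have b1 := abs_le.mp a1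
    have b3 := abs_le.mp a3
    have hp : C₁ * mesh N ^ 2 ≤ C₁ * mesh N := by gcongr
    have hp2 : 0 ≤ C₂ * mesh N := by positivity
    rw [abs_le]
    push_cast at b1 b3 ⊢
    constructor <;> linarith [b1.1, b1.2, b3.1, b3.2]

end Sampling

open Filter Topology

/-! ### A smooth extension of the chemical potentials -/

/-- A smooth positive function that equals the identity on `[2 c, ∞)`. -/
def clampPos (c u : ℝ) : ℝ := c + Real.smoothTransition ((u - c) / c) * (u - c)

theorem clampPos_pos {c : ℝ} (hc : 0 < c) (u : ℝ) : 0 < clampPos c u := by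
  unfold clampPos
  rcases le_total u c with h | h
  · rw [Real.smoothTransition.zero_of_nonpos (div_nonpos_of_nonpos_of_nonneg (by linarith) hc.le)]
    linarith
  · have := mul_nonneg (Real.smoothTransition.nonneg ((u - c) / c)) (sub_nonneg.mpr h)
    linarith

theorem clampPos_eq {c u : ℝ} (hc : 0 < c) (h : 2 * c ≤ u) : clampPos c u = u := by
  unfold clampPos
  rw [Real.smoothTransition.one_of_one_le ((one_le_div hc).mpr (by linarith))]
  ring

theorem contDiff_clampPos (c : ℝ) {n : ℕ∞} : ContDiff ℝ n (clampPos c) :=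
  contDiff_const.add ((Real.smoothTransition.contDiff.comp
    ((contDiff_id.sub contDiff_const).div_const c)).mul (contDiff_id.sub contDiff_const))

/-- A smooth function that equals `logPot` away from `±1`. -/
def logExt (c s : ℝ) : ℝ := Real.log (clampPos c (1 + s)) - Real.log (clampPos c (1 - s))

theorem logExt_eq {c s : ℝ} (hc : 0 < c) (h₁ : 2 * c ≤ 1 + s) (h₂ : 2 * c ≤ 1 - s) :
    logExt c s = logPot s := by
  rw [logExt, clampPos_eq hc h₁, clampPos_eq hc h₂, logPot]

theorem contDiff_logExt {c : ℝ} (hc : 0 < c) {n : ℕ} : ContDiff ℝ n (logExt c) :=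
  (((contDiff_clampPos c (n := n)).comp (contDiff_const.add contDiff_id)).log
      fun _ => (clampPos_pos hc _).ne').sub
    (((contDiff_clampPos c (n := n)).comp (contDiff_const.sub contDiff_id)).log
      fun _ => (clampPos_pos hc _).ne')

/-- The bulk chemical potential, extended smoothly. -/
def muExt (ε θ₀ c : ℝ) (G : ℝ × ℝ × ℝ → ℝ) : ℝ × ℝ × ℝ → ℝ :=
  fun p => logExt c (G p) - θ₀ * G p - ε ^ 2 * lap G p

/-- The surface chemical potential with normal `σ e_y`, extended smoothly. -/
def muSide (ε κ θ₀ c σ : ℝ) (G : ℝ × ℝ × ℝ → ℝ) : ℝ × ℝ × ℝ → ℝ :=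
  fun p => logExt c (G p) - θ₀ * G p - κ * ε * pd ex (pd ex G) p + ε ^ 2 * σ * pd ey G p

theorem PerSmooth.muExt {n : ℕ} {G : ℝ × ℝ × ℝ → ℝ} (h : PerSmooth (n + 2) G) (ε θ₀ : ℝ) {c : ℝ}
    (hc : 0 < c) : PerSmooth n (muExt ε θ₀ c G) :=
  (((h.of_le (by omega)).comp (contDiff_logExt hc)).sub ((h.of_le (by omega)).const_mul _)).sub
    (h.lap.const_mul _)

theorem PerSmooth.muSide {n : ℕ} {G : ℝ × ℝ × ℝ → ℝ} (h : PerSmooth (n + 2) G) (ε κ θ₀ σ : ℝ)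
    {c : ℝ} (hc : 0 < c) : PerSmooth n (muSide ε κ θ₀ c σ G) :=
  ((((h.of_le (by omega)).comp (contDiff_logExt hc)).sub ((h.of_le (by omega)).const_mul _)).sub
    (((h.pd ex).pd ex).const_mul _)).add (((h.pd ey).of_le (by omega)).const_mul _)

/-- The Cahn–Hilliard system in terms of functions that are smooth on the whole space. -/
structure SmoothSolution (ε κ θ₀ T c : ℝ) (G : ℝ × ℝ × ℝ → ℝ) : Prop where
  smooth : PerSmooth 8 G
  pos : 0 < c
  range : ∀ t ∈ Set.Icc 0 T, ∀ x, ∀ y ∈ Set.Icc (0 : ℝ) 1,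
    4 * c ≤ 1 + G (t, x, y) ∧ 4 * c ≤ 1 - G (t, x, y)
  bulk : ∀ t ∈ Set.Icc 0 T, ∀ x, ∀ y ∈ Set.Icc (0 : ℝ) 1,
    pd et G (t, x, y) = lap (muExt ε θ₀ c G) (t, x, y)
  noFlux : ∀ t ∈ Set.Icc 0 T, ∀ x,
    pd ey (muExt ε θ₀ c G) (t, x, 0) = 0 ∧ pd ey (muExt ε θ₀ c G) (t, x, 1) = 0
  on_bot : ∀ t ∈ Set.Icc 0 T, ∀ x,
    pd et G (t, x, 0) = pd ex (pd ex (muSide ε κ θ₀ c (-1) G)) (t, x, 0)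
  on_top : ∀ t ∈ Set.Icc 0 T, ∀ x,
    pd et G (t, x, 1) = pd ex (pd ex (muSide ε κ θ₀ c 1 G)) (t, x, 1)

theorem iteratedDeriv_two_eq {f f₁ f₂ : ℝ → ℝ} (h₁ : ∀ x, HasDerivAt f (f₁ x) x)
    (h₂ : ∀ x, HasDerivAt f₁ (f₂ x) x) (x : ℝ) : iteratedDeriv 2 f x = f₂ x := by
  rw [iteratedDeriv_succ, iteratedDeriv_one, show deriv f = f₁ from funext fun x => (h₁ x).deriv]
  exact (h₂ x).deriv

/-- With `c = ε₀ / 4` the range condition holds with `4 c`, while `logExt` is the true logarithm as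
soon as `1 ± s ≥ 2 c`. The gap makes the two potentials agree near each `y` in the closed interval,
hence also their derivatives at the sides. The same gap later leaves room for perturbing the exact
solution. -/
theorem ExactSolution.smoothSolution {ε κ θ₀ T : ℝ} {Φ : ℝ → ℝ → ℝ → ℝ}
    (h : ExactSolution ε κ θ₀ T 8 Φ) :
    ∃ c, SmoothSolution ε κ θ₀ T c (fun p => Φ p.1 p.2.1 p.2.2) := by
  obtain ⟨ε₀, hε₀, hsep⟩ := h.separated
  set G : ℝ × ℝ × ℝ → ℝ := fun p => Φ p.1 p.2.1 p.2.2 with hG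
  have hS : PerSmooth 8 G := ⟨h.regular, fun t x y => h.periodic t x y⟩
  have hc : 0 < ε₀ / 4 := by positivity
  have hlap : ∀ t x y, laplacian (Φ t) x y = lap G (t, x, y) := by
    intro t x y
    rw [laplacian, lap, iteratedDeriv_two_eq (fun x => hS.hasDerivAt_x t x y)
      (fun x => (hS.pd ex).hasDerivAt_x t x y), iteratedDeriv_two_eq
      (fun y => hS.hasDerivAt_y t x y) (fun y => (hS.pd ey).hasDerivAt_y t x y)]
  have hmu := hS.muExt (n := 6) ε θ₀ hc
  have heq : ∀ t x y, 2 * (ε₀ / 4) ≤ 1 + Φ t x y → 2 * (ε₀ / 4) ≤ 1 - Φ t x y →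
      chemPot ε θ₀ (Φ t) x y = muExt ε θ₀ (ε₀ / 4) G (t, x, y) := by
    intro t x y h1 h2
    rw [chemPot, hlap, muExt, logExt_eq hc h1 h2, logPot]
  have hev : ∀ t ∈ Set.Icc 0 T, ∀ x, ∀ y ∈ Set.Icc (0 : ℝ) 1,
      (fun s => chemPot ε θ₀ (Φ t) x s) =ᶠ[𝓝 y] fun s => muExt ε θ₀ (ε₀ / 4) G (t, x, s) := by
    intro t ht x y hy
    obtain ⟨h1, h2⟩ := hsep t ht x y hy
    have hcont : ContinuousAt (fun s => Φ t x s) y := (hS.hasDerivAt_y t x y).continuousAt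
    filter_upwards [(continuousAt_const.add hcont).eventually_const_lt
        (show 2 * (ε₀ / 4) < 1 + Φ t x y by linarith),
      (continuousAt_const.sub hcont).eventually_const_lt
        (show 2 * (ε₀ / 4) < 1 - Φ t x y by linarith)] with s h1 h2
    exact heq t x s h1.le h2.le
  have hside : ∀ t ∈ Set.Icc 0 T, ∀ b ∈ Set.Icc (0 : ℝ) 1, ∀ σ x,
      iteratedDeriv 2 (chemPotΓ ε κ θ₀ (Φ t) b σ) x
        = pd ex (pd ex (muSide ε κ θ₀ (ε₀ / 4) σ G)) (t, x, b) := by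
    intro t ht b hb σ x
    have hms := hS.muSide (n := 6) ε κ θ₀ σ hc
    have : chemPotΓ ε κ θ₀ (Φ t) b σ = fun x => muSide ε κ θ₀ (ε₀ / 4) σ G (t, x, b) := by
      funext x
      obtain ⟨h1, h2⟩ := hsep t ht x b hb
      rw [chemPotΓ, muSide, iteratedDeriv_two_eq (fun x => hS.hasDerivAt_x t x b)
        (fun x => (hS.pd ex).hasDerivAt_x t x b),
        logExt_eq hc (by simp only [hG]; linarith) (by simp only [hG]; linarith), logPot,
        show deriv (fun s => Φ t x s) b = pd ey G (t, x, b) from (hS.hasDerivAt_y t x b).deriv]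
      ring
    rw [this, iteratedDeriv_two_eq (fun x => hms.hasDerivAt_x t x b)
      (fun x => (hms.pd ex).hasDerivAt_x t x b)]
  refine ⟨ε₀ / 4, hS, hc, fun t ht x y hy => ?_, fun t ht x y hy => ?_, fun t ht x => ?_,
    fun t ht x => ?_, fun t ht x => ?_⟩
  · have := hsep t ht x y hy
    rwa [mul_div_cancel₀ _ (by norm_num : (4 : ℝ) ≠ 0)]
  · have hIoo : Set.EqOn (fun y => pd et G (t, x, y))
        (fun y => lap (muExt ε θ₀ (ε₀ / 4) G) (t, x, y)) (Set.Ioo 0 1) := by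
      intro y hy
      have hy' := Set.Ioo_subset_Icc_self hy
      have e := h.bulk t ht x y hy
      rw [(hS.hasDerivAt_t t x y).deriv, laplacian,
        (hev t ht x y hy').iteratedDeriv_eq,
        show (fun s => chemPot ε θ₀ (Φ t) s y) = fun s => muExt ε θ₀ (ε₀ / 4) G (t, s, y) from
          funext fun s => (hev t ht s y hy').eq_of_nhds,
        iteratedDeriv_two_eq (fun x => hmu.hasDerivAt_x t x y)
          (fun x => (hmu.pd ex).hasDerivAt_x t x y), iteratedDeriv_two_eq
          (fun y => hmu.hasDerivAt_y t x y) (fun y => (hmu.pd ey).hasDerivAt_y t x y)] at e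
      exact e
    -- The equation is assumed in the open strip only; continuity of both sides carries it to the
    -- boundary rows of the grid.
    have hcl := hIoo.closure ((hS.pd et).continuous.comp (by fun_prop))
      (hmu.lap.continuous.comp (by fun_prop))
    rw [closure_Ioo zero_ne_one] at hcl
    exact hcl hy
  · obtain ⟨h0, h1⟩ := h.noFlux t ht x
    rw [(hev t ht x 0 ⟨le_rfl, zero_le_one⟩).deriv_eq, (hmu.hasDerivAt_y t x 0).deriv] at h0
    rw [(hev t ht x 1 ⟨zero_le_one, le_rfl⟩).deriv_eq, (hmu.hasDerivAt_y t x 1).deriv] at h1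
    exact ⟨h0, h1⟩
  · have e := h.bottom t ht x
    rw [hside t ht 0 ⟨le_rfl, zero_le_one⟩] at e
    exact ((hS.hasDerivAt_t t x 0).deriv).symm.trans e
  · have e := h.top t ht x
    rw [hside t ht 1 ⟨zero_le_one, le_rfl⟩] at e
    exact ((hS.hasDerivAt_t t x 1).deriv).symm.trans e

/-! ### The projected and corrected exact solution -/

/-- An exact solution as a function on space-time. -/
abbrev uncurry3 (Φ : ℝ → ℝ → ℝ → ℝ) : ℝ × ℝ × ℝ → ℝ := fun p => Φ p.1 p.2.1 p.2.2

theorem PerSmooth.iterate_pd {n k : ℕ} {G : ℝ × ℝ × ℝ → ℝ} (h : PerSmooth (n + k) G)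
    (v : ℝ × ℝ × ℝ) : PerSmooth n ((CHDBC.pd v)^[k] G) := by
  induction k generalizing n with
  | zero => exact h
  | succ k ih =>
    rw [Function.iterate_succ_apply']
    exact (ih (n := n + 1) (h.of_le (by omega))).pd v

theorem PerSmooth.derivChain {G : ℝ × ℝ × ℝ → ℝ} (h : PerSmooth 6 G) (t y : ℝ) {M : ℝ}
    (hM : ∀ x, |(CHDBC.pd ex)^[5] G (t, x, y)| ≤ M) :
    DerivChain (fun k x => (CHDBC.pd ex)^[k] G (t, x, y)) M where
  hasDerivAt k hk x := by
    simp only [Function.iterate_succ_apply']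
    exact ((h.of_le (by omega) : PerSmooth (0 + 1 + k) G).iterate_pd ex).hasDerivAt_x t x y
  continuous k hk := ((h.of_le (by omega) : PerSmooth (0 + k) G).iterate_pd ex).continuous.comp
    (by fun_prop)
  periodic k hk x := ((h.of_le (by omega) : PerSmooth (0 + k) G).iterate_pd ex).periodic t x y
  bound := hM

theorem DerivChain.sub {F F' : ℕ → ℝ → ℝ} {M M' M'' : ℝ} (h : DerivChain F M)
    (h' : DerivChain F' M') (hb : ∀ x, |F 5 x - F' 5 x| ≤ M'') :
    DerivChain (fun k x => F k x - F' k x) M'' where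
  hasDerivAt k hk x := (h.hasDerivAt k hk x).sub (h'.hasDerivAt k hk x)
  continuous k hk := (h.continuous k hk).sub (h'.continuous k hk)
  periodic k hk x := by simp only [h.periodic k hk x, h'.periodic k hk x]
  bound := hb

/-- The projection error on the grid. -/
def projErr (K : ℕ) (Φ : ℝ → ℝ → ℝ → ℝ) (t : ℝ) : Grid (2 * K + 1) :=
  projGrid K Φ t - samp (2 * K + 1) (uncurry3 Φ) t

/-- The Lipschitz bound in time applies the projection estimate to the increment between two times:
projection is linear, and the fifth `x`-derivative of the increment is `O(|t' - t|)`. -/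
theorem exists_projErr_bound {Φ : ℝ → ℝ → ℝ → ℝ} (h : PerSmooth 8 (uncurry3 Φ)) (T : ℝ) :
    ∃ C > 0, ∀ K : ℕ, ∀ t ∈ Set.Icc 0 T, ∀ i, ∀ j : ℕ, j ≤ 2 * K + 1 →
      |projErr K Φ t i j| ≤ C * mesh (2 * K + 1) ^ 3 ∧
      ∀ t' ∈ Set.Icc 0 T, |projErr K Φ t' i j - projErr K Φ t i j|
        ≤ C * mesh (2 * K + 1) ^ 3 * |t' - t| := by
  obtain ⟨S, hS, hproj⟩ := exists_fourierProj_bound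
  have h6 : PerSmooth 6 (uncurry3 Φ) := h.of_le (by norm_num)
  have h5 : PerSmooth 3 ((pd ex)^[5] (uncurry3 Φ)) := PerSmooth.iterate_pd (n := 3) h ex
  obtain ⟨C₁, hC₁, hb₁⟩ := h5.exists_bound T
  obtain ⟨C₂, hC₂, hb₂⟩ := (h5.pd et).exists_bound T
  refine ⟨S * C₁ + S * C₂, by positivity, fun K t ht i j hj => ?_⟩
  have hy := mul_mesh_mem (N := 2 * K + 1) hj
  set y := ((j : ℤ) : ℝ) * mesh (2 * K + 1) with hy_def
  have hm := mesh_pos (N := 2 * K + 1)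
  have hc : ∀ t ∈ Set.Icc 0 T, DerivChain (fun k x => (pd ex)^[k] (uncurry3 Φ) (t, x, y)) C₁ :=
    fun t ht => h6.derivChain t y fun x => hb₁ t ht x y hy
  refine ⟨(hproj K _ _ (hc t ht) (gridX i)).trans ?_, fun t' ht' => ?_⟩
  · gcongr
    linarith [mul_pos hS hC₂]
  · have hd := (hc t' ht').sub (hc t ht) (M'' := C₂ * |t' - t|) fun x =>
      abs_sub_le_of_deriv (convex_Icc 0 T) (fun s => h5.hasDerivAt_t s x y)
        (fun s hs => hb₂ s hs x y hy) ht ht'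
    have h1 := hproj K _ _ hd (gridX i)
    have h2 := fourierProj_sub (f := fun x => uncurry3 Φ (t', x, y))
      (g := fun x => uncurry3 Φ (t, x, y)) ((hc t' ht').continuous 0 (by norm_num))
      ((hc t ht).continuous 0 (by norm_num)) K (gridX i)
    simp only [Function.iterate_zero, id_eq] at h1
    rw [h2] at h1
    have e : projErr K Φ t' i j - projErr K Φ t i j
        = fourierProj K (fun x => uncurry3 Φ (t', x, y)) (gridX i)
          - fourierProj K (fun x => uncurry3 Φ (t, x, y)) (gridX i)
          - (uncurry3 Φ (t', gridX i, y) - uncurry3 Φ (t, gridX i, y)) := by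
      change (fourierProj K (fun x => uncurry3 Φ (t', x, y)) (gridX i)
        - uncurry3 Φ (t', gridX i, y)) - (fourierProj K (fun x => uncurry3 Φ (t, x, y)) (gridX i)
        - uncurry3 Φ (t, gridX i, y)) = _
      ring
    rw [e]
    refine h1.trans ?_
    have : 0 ≤ S * C₁ * mesh (2 * K + 1) ^ 3 * |t' - t| := by positivity
    linarith

/-! ### Means and the calculus of small residuals -/

section MeanLemmas

set_option linter.unusedSectionVars false

variable {N : ℕ} [NeZero N]

theorem mean_sub (f g : Grid N) : mean (f - g) = mean f - mean g := by
  rw [sub_eq_add_neg, mean_add, ← neg_one_smul ℝ g, mean_smul]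
  ring

theorem l1Trace_one : l1Trace (N := N) (fun _ _ => 1) = 3 := by
  simp only [l1Trace, top, bot, abs_one]
  rw [weighted_const]
  simp only [mesh_mul_sum_const]
  norm_num

theorem SmallResidual.abs_mean_le {c : ℝ} {r : Grid N} (h : SmallResidual c r) :
    |mean r| ≤ 3 * c := by
  have := h.abs_ip_le (fun _ _ => 1)
  rw [l1Trace_one] at this
  rw [mean]
  linarith

theorem SmallResidual.of_le {c : ℝ} {r : Grid N}
    (h : ∀ i, ∀ j : ℕ, j ≤ N → |r i j| ≤ c) : SmallResidual c r where
  interior i j _ hj := h i j hj.le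
  on_top i := (mul_le_of_le_one_left (abs_nonneg _) mesh_le_one).trans (h i N le_rfl)
  on_bot i := by
    have := h i 0 (Nat.zero_le N)
    rw [Nat.cast_zero] at this
    exact (mul_le_of_le_one_left (abs_nonneg _) mesh_le_one).trans this

theorem SmallResidual.add {c c' : ℝ} {r r' : Grid N} (h : SmallResidual c r)
    (h' : SmallResidual c' r') : SmallResidual (c + c') (r + r') where
  interior i j h0 hj := (abs_add_le _ _).trans (add_le_add (h.interior i j h0 hj)
    (h'.interior i j h0 hj))
  on_top i := by
    have h1 := h.on_top i
    have h2 := h'.on_top i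
    have := mul_le_mul_of_nonneg_left (abs_add_le (r i N) (r' i N)) (mesh_pos (N := N)).le
    simp only [Pi.add_apply]
    linarith
  on_bot i := by
    have h1 := h.on_bot i
    have h2 := h'.on_bot i
    have := mul_le_mul_of_nonneg_left (abs_add_le (r i 0) (r' i 0)) (mesh_pos (N := N)).le
    simp only [Pi.add_apply]
    linarith

theorem SmallResidual.smul {c : ℝ} {r : Grid N} (h : SmallResidual c r) (a : ℝ) :
    SmallResidual (|a| * c) (a • r) where
  interior i j h0 hj := by
    simp only [Pi.smul_apply, smul_eq_mul, abs_mul]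
    exact mul_le_mul_of_nonneg_left (h.interior i j h0 hj) (abs_nonneg a)
  on_top i := by
    simp only [Pi.smul_apply, smul_eq_mul, abs_mul]
    rw [mul_left_comm]
    exact mul_le_mul_of_nonneg_left (h.on_top i) (abs_nonneg a)
  on_bot i := by
    simp only [Pi.smul_apply, smul_eq_mul, abs_mul]
    rw [mul_left_comm]
    exact mul_le_mul_of_nonneg_left (h.on_bot i) (abs_nonneg a)

theorem SmallResidual.mono {c c' : ℝ} {r : Grid N} (h : SmallResidual c r) (hc : c ≤ c') :
    SmallResidual c' r :=
  ⟨fun i j h0 hj => (h.interior i j h0 hj).trans hc, fun i => (h.on_top i).trans hc,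
    fun i => (h.on_bot i).trans hc⟩

theorem hasDerivAt_mean_samp {n : ℕ} {G : ℝ × ℝ × ℝ → ℝ} (h : PerSmooth (n + 1) G) (t : ℝ) :
    HasDerivAt (fun t => mean (samp N G t)) (mean (samp N (pd et G) t)) t := by
  simp only [mean, ip, mul_one]
  refine HasDerivAt.const_mul _ ?_
  refine HasDerivAt.fun_sum fun i _ => HasDerivAt.fun_sum fun j _ => ?_
  exact (h.hasDerivAt_t t _ _).const_mul _

end MeanLemmas

/-- Consistency of the bulk equation. On the boundary rows the no-flux condition removes the `2/h`
term in the expansion of `L_h μ`, and the remaining `O(h)` is admissible for a small residual of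
size `h²`. -/
theorem SmoothSolution.exists_mean_samp_bound {ε κ θ₀ T c : ℝ} {G : ℝ × ℝ × ℝ → ℝ}
    (h : SmoothSolution ε κ θ₀ T c G) : ∃ C > 0, ∀ (N : ℕ) [NeZero N], ∀ t ∈ Set.Icc 0 T,
      SmallResidual (C * mesh N ^ 2)
        (samp N (pd et G) t + Lh (samp N (muExt ε θ₀ c G) t)) := by
  have hmu := h.smooth.muExt (n := 6) ε θ₀ h.pos
  obtain ⟨C, hC, hb⟩ := (hmu.of_le (by norm_num) : PerSmooth 4 _).exists_Lh_samp T
  refine ⟨C, hC, fun N _ t ht => ?_⟩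
  have hm := mesh_pos (N := N)
  have hb' := hb t ht N
  have hrow : ∀ i, ∀ j : ℕ, j ≤ N →
      samp N (pd et G) t i j = samp N (lap (muExt ε θ₀ c G)) t i j := fun i j hj =>
    h.bulk t ht _ _ (mul_mesh_mem hj)
  refine ⟨fun i j h0 hj => ?_, fun i => ?_, fun i => ?_⟩
  · rw [Pi.add_apply, Pi.add_apply, hrow i j hj.le, add_comm]
    exact (hb' i).1 j h0 hj
  · have h1 := (hb' i).2.1
    have h2 : samp N (pd ey (muExt ε θ₀ c G)) t i N = 0 := by
      have e : ((N : ℤ) : ℝ) * mesh N = 1 := by push_cast; rw [mul_comm]; exact mesh_mul N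
      rw [samp, e]
      exact (h.noFlux t ht _).2
    rw [h2, mul_zero, sub_zero] at h1
    rw [Pi.add_apply, Pi.add_apply, hrow i N le_rfl, add_comm, sq]
    calc _ ≤ mesh N * (C * mesh N) := by gcongr
      _ = _ := by ring
  · have h1 := (hb' i).2.2
    have h2 : samp N (pd ey (muExt ε θ₀ c G)) t i 0 = 0 := by
      rw [samp, Int.cast_zero, zero_mul]
      exact (h.noFlux t ht _).1
    rw [h2, mul_zero, add_zero] at h1
    have h3 := hrow i 0 (Nat.zero_le N)
    rw [Nat.cast_zero] at h3
    rw [Pi.add_apply, Pi.add_apply, h3, add_comm, sq]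
    calc _ ≤ mesh N * (C * mesh N) := by gcongr
      _ = _ := by ring

/-! ### The mass defect of the trapezoidal rule -/

theorem abs_mean_le_of_rows {N : ℕ} [NeZero N] {c : ℝ} {r : Grid N}
    (h : ∀ i, ∀ j : ℕ, j ≤ N → |r i j| ≤ c) : |mean r| ≤ 3 * c :=
  (SmallResidual.of_le h).abs_mean_le

/-- The excess of mass caused by the trapezoidal rule. -/
def massExcess (K : ℕ) (Φ : ℝ → ℝ → ℝ → ℝ) (t : ℝ) : ℝ :=
  mean (projGrid K Φ t) - mean (projGrid K Φ 0)

/-- The sampled mass changes at the rate given by the mean of the sampled time derivative. Since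
`L_h` has mean zero, this equals the mean of the residual of the bulk equation, which is `O(h²)`.
The projection error contributes `O(h³)`. -/
theorem exists_massExcess_bound {ε κ θ₀ T c : ℝ} {Φ : ℝ → ℝ → ℝ → ℝ}
    (h : SmoothSolution ε κ θ₀ T c (uncurry3 Φ)) :
    ∃ C > 0, ∀ K : ℕ, ∀ t ∈ Set.Icc 0 T, ∀ t' ∈ Set.Icc 0 T,
      |massExcess K Φ t' - massExcess K Φ t| ≤ C * mesh (2 * K + 1) ^ 2 * |t' - t| := by
  obtain ⟨C₁, hC₁, h₁⟩ := h.exists_mean_samp_bound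
  obtain ⟨C₂, hC₂, h₂⟩ := exists_projErr_bound h.smooth T
  refine ⟨3 * C₁ + 3 * C₂, by positivity, fun K t ht t' ht' => ?_⟩
  have hm := mesh_pos (N := 2 * K + 1)
  have hm1 := mesh_le_one (N := 2 * K + 1)
  have e : massExcess K Φ t' - massExcess K Φ t
      = (mean (samp (2 * K + 1) (uncurry3 Φ) t') - mean (samp (2 * K + 1) (uncurry3 Φ) t))
        + mean (projErr K Φ t' - projErr K Φ t) := by
    rw [massExcess, massExcess, mean_sub, projErr, projErr, mean_sub, mean_sub]
    ring
  have b1 : |mean (samp (2 * K + 1) (uncurry3 Φ) t') - mean (samp (2 * K + 1) (uncurry3 Φ) t)|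
      ≤ 3 * (C₁ * mesh (2 * K + 1) ^ 2) * |t' - t| := by
    refine abs_sub_le_of_deriv (convex_Icc 0 T)
      (fun s => hasDerivAt_mean_samp (n := 7) h.smooth s) (fun s hs => ?_) ht ht'
    have := (h₁ (2 * K + 1) s hs).abs_mean_le
    rwa [mean_add, mean_Lh, add_zero] at this
  have b2 : |mean (projErr K Φ t' - projErr K Φ t)|
      ≤ 3 * (C₂ * mesh (2 * K + 1) ^ 3 * |t' - t|) :=
    abs_mean_le_of_rows fun i j hj => (h₂ K t ht i j hj).2 t' ht'
  have b3 : mesh (2 * K + 1) ^ 3 ≤ mesh (2 * K + 1) ^ 2 :=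
    pow_le_pow_of_le_one hm.le hm1 (by norm_num)
  have b4 : C₂ * mesh (2 * K + 1) ^ 3 * |t' - t| ≤ C₂ * mesh (2 * K + 1) ^ 2 * |t' - t| := by
    gcongr
  rw [e]
  refine (abs_add_le _ _).trans ?_
  linarith

/-! ### Conservation of mass -/

/-- The mass increment is a double integral of `∂_t`; after exchanging the order, each inner
integral is that of a second `x`-derivative over a full period, which vanishes. -/
theorem SmoothSolution.integral_side_eq {ε κ θ₀ T c : ℝ} {G : ℝ × ℝ × ℝ → ℝ}
    (h : SmoothSolution ε κ θ₀ T c G) {t : ℝ} (ht : t ∈ Set.Icc 0 T) {b σ : ℝ}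
    (hb : ∀ t ∈ Set.Icc 0 T, ∀ x,
      pd et G (t, x, b) = pd ex (pd ex (muSide ε κ θ₀ c σ G)) (t, x, b)) :
    ∫ x in (0 : ℝ)..1, G (t, x, b) = ∫ x in (0 : ℝ)..1, G (0, x, b) := by
  have hmu := h.smooth.muSide (n := 6) ε κ θ₀ σ h.pos
  have hct : Continuous (pd et G) := (PerSmooth.pd (n := 7) h.smooth et).continuous
  have hc0 := h.smooth.continuous
  have hFTC : ∀ x, G (t, x, b) - G (0, x, b) = ∫ s in (0 : ℝ)..t, pd et G (s, x, b) := by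
    intro x
    exact (intervalIntegral.integral_eq_sub_of_hasDerivAt
      (fun s _ => PerSmooth.hasDerivAt_t (n := 7) h.smooth s x b)
      ((hct.comp (by fun_prop)).intervalIntegrable _ _)).symm
  have hinner : ∀ s ∈ Set.Icc 0 t, ∫ x in (0 : ℝ)..1, pd et G (s, x, b) = 0 := by
    intro s hs
    have hs' : s ∈ Set.Icc 0 T := ⟨hs.1, hs.2.trans ht.2⟩
    simp only [hb s hs']
    rw [intervalIntegral.integral_eq_sub_of_hasDerivAt
      (fun x _ => (hmu.pd ex).hasDerivAt_x s x b)
      ((((hmu.pd ex).pd ex).continuous.comp (by fun_prop)).intervalIntegrable _ _)]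
    have := (hmu.pd ex).periodic s 0 b
    rw [zero_add] at this
    rw [this, sub_self]
  have h0 : ∫ x in (0 : ℝ)..1, (G (t, x, b) - G (0, x, b)) = 0 := by
    simp only [hFTC]
    rw [MeasureTheory.intervalIntegral_intervalIntegral_swap]
    · rw [intervalIntegral.integral_congr (g := fun _ => (0 : ℝ)), intervalIntegral.integral_zero]
      intro s hs
      rw [Set.uIcc_of_le ht.1] at hs
      exact hinner s hs
    · have hcont : Continuous (Function.uncurry fun x s => pd et G (s, x, b)) :=
        hct.comp (f := fun p : ℝ × ℝ => (p.2, p.1, b)) (by fun_prop)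
      exact (hcont.continuousOn.integrableOn_compact
        (isCompact_uIcc.prod isCompact_uIcc)).mono_set
        (Set.prod_mono Set.uIoc_subset_uIcc Set.uIoc_subset_uIcc)
  rw [intervalIntegral.integral_sub] at h0
  · linarith
  · exact Continuous.intervalIntegrable (hc0.comp (by fun_prop)) _ _
  · exact Continuous.intervalIntegrable (hc0.comp (by fun_prop)) _ _

/-- The cosine takes the same value at both ends, so the trapezoidal rule becomes a plain sum over
`0 ≤ j < N`: the real part of the sum of all `N`-th roots of unity, which is zero for `N > 1`. -/
theorem mean_one_sub_cos {N : ℕ} [NeZero N] (hN : 1 < N) :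
    mean (N := N) (fun _ j => 1 - Real.cos (2 * Real.pi * (j * mesh N))) = 1 := by
  have hcos : ∑ j ∈ range N, Real.cos (2 * Real.pi * (j * mesh N)) = 0 := by
    have h := (Complex.isPrimitiveRoot_exp N (NeZero.ne N)).geom_sum_eq_zero hN
    have h2 := congrArg Complex.re h
    rw [Complex.re_sum, Complex.zero_re] at h2
    rw [← h2]
    refine sum_congr rfl fun j _ => ?_
    rw [← Complex.exp_nat_mul, ← Complex.exp_ofReal_mul_I_re]
    congr 2
    rw [mesh]
    push_cast
    ring
  have hw : ∑ j ∈ range (N + 1), weight N j * Real.cos (2 * Real.pi * (j * mesh N)) = 0 := by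
    rw [← hcos]
    obtain ⟨M, rfl⟩ := Nat.exists_eq_succ_of_ne_zero (NeZero.ne N)
    rw [sum_range_succ, sum_range_succ', sum_range_succ']
    have e : ∀ j ∈ range M, weight (M + 1) (j + 1)
        * Real.cos (2 * Real.pi * ((j + 1 : ℕ) * mesh (M + 1)))
        = Real.cos (2 * Real.pi * ((j + 1 : ℕ) * mesh (M + 1))) := by
      intro j hj
      have hj' : j ≠ M := (mem_range.mp hj).ne
      simp [weight, hj']
    have eN : Real.cos (2 * Real.pi * ((M + 1 : ℕ) * mesh (M + 1))) = 1 := by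
      rw [mul_comm _ (mesh (M + 1)), mesh_mul, mul_one, Real.cos_two_pi]
    simp only [Nat.succ_eq_add_one]
    rw [sum_congr rfl e, eN]
    simp [weight]
    ring
  have h1 := mean_const (N := N) 1
  have e : mean (N := N) (fun _ j => 1 - Real.cos (2 * Real.pi * (j * mesh N)))
      = mean (N := N) (fun _ _ => 1)
        - mean (N := N) (fun _ j => Real.cos (2 * Real.pi * (j * mesh N))) := by
    rw [← mean_sub]; rfl
  rw [e, h1, mean, ip]
  simp only [mul_one, Int.cast_natCast, hw, sum_const_zero, mul_zero, sub_zero]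

/-- The corrected exact solution on the grid. -/
def refGrid (K : ℕ) (Φ : ℝ → ℝ → ℝ → ℝ) (t : ℝ) : Grid (2 * K + 1) :=
  projGrid K Φ t - corrGrid K Φ t

theorem corrGrid_apply (K : ℕ) (Φ : ℝ → ℝ → ℝ → ℝ) (t : ℝ) (i : ZMod (2 * K + 1)) (j : ℤ) :
    corrGrid K Φ t i j
      = massExcess K Φ t * (1 - Real.cos (2 * Real.pi * (j * mesh (2 * K + 1)))) := rfl

theorem cast_mul_mesh (N : ℕ) [NeZero N] : ((N : ℤ) : ℝ) * mesh N = 1 := by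
  rw [Int.cast_natCast, mul_comm, mesh_mul]

/-- The correction profile vanishes at `y = 1`, so the side keeps the mass of the projection, and
that is the exact integral. -/
theorem meanΓ_top_refGrid (K : ℕ) (Φ : ℝ → ℝ → ℝ → ℝ) (t : ℝ) :
    meanΓ (top (refGrid K Φ t)) = ∫ x in (0 : ℝ)..1, uncurry3 Φ (t, x, 1) := by
  rw [← sum_fourierProj_gridX K, meanΓ, ipΓ]
  congr 1
  refine sum_congr rfl fun i _ => ?_
  rw [mul_one, top, refGrid, Pi.sub_apply, Pi.sub_apply, corrGrid_apply, projGrid, cast_mul_mesh,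
    mul_one, Real.cos_two_pi, sub_self, mul_zero, sub_zero]
  rfl

theorem meanΓ_bot_refGrid (K : ℕ) (Φ : ℝ → ℝ → ℝ → ℝ) (t : ℝ) :
    meanΓ (bot (refGrid K Φ t)) = ∫ x in (0 : ℝ)..1, uncurry3 Φ (t, x, 0) := by
  rw [← sum_fourierProj_gridX K, meanΓ, ipΓ]
  congr 1
  refine sum_congr rfl fun i _ => ?_
  rw [mul_one, bot, refGrid, Pi.sub_apply, Pi.sub_apply, corrGrid_apply, projGrid, Int.cast_zero,
    zero_mul, mul_zero, Real.cos_zero, sub_self, mul_zero, sub_zero]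
  rfl

theorem mean_refGrid {K : ℕ} (hK : 1 ≤ K) (Φ : ℝ → ℝ → ℝ → ℝ) (t : ℝ) :
    mean (refGrid K Φ t) = mean (projGrid K Φ 0) := by
  have e : corrGrid K Φ t = massExcess K Φ t
      • (fun _ j => 1 - Real.cos (2 * Real.pi * ((j : ℝ) * mesh (2 * K + 1))) :
        Grid (2 * K + 1)) := rfl
  rw [refGrid, mean_sub, e, mean_smul, mean_one_sub_cos (by omega), massExcess]
  ring

theorem meanΓ_sub {N : ℕ} [NeZero N] (f g : BdryGrid N) : meanΓ (f - g) = meanΓ f - meanΓ g := by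
  simp only [meanΓ, ipΓ, Pi.sub_apply, mul_one, sum_sub_distrib, mul_sub]

theorem SmoothSolution.massFree_refGrid {ε κ θ₀ T c : ℝ} {Φ : ℝ → ℝ → ℝ → ℝ}
    (h : SmoothSolution ε κ θ₀ T c (uncurry3 Φ)) {K : ℕ} (hK : 1 ≤ K) {t : ℝ}
    (ht : t ∈ Set.Icc 0 T) : MassFree (refGrid K Φ t - refGrid K Φ 0) := by
  refine ⟨?_, ?_, ?_⟩
  · rw [mean_sub, mean_refGrid hK, mean_refGrid hK, sub_self]
  · rw [show top (refGrid K Φ t - refGrid K Φ 0) = top (refGrid K Φ t) - top (refGrid K Φ 0)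
      from rfl, meanΓ_sub, meanΓ_top_refGrid, meanΓ_top_refGrid, h.integral_side_eq ht h.on_top,
      sub_self]
  · rw [show bot (refGrid K Φ t - refGrid K Φ 0) = bot (refGrid K Φ t) - bot (refGrid K Φ 0)
      from rfl, meanΓ_sub, meanΓ_bot_refGrid, meanΓ_bot_refGrid, h.integral_side_eq ht h.on_bot,
      sub_self]

/-! ### Consistency of the corrected exact solution -/

/-- The difference of the corrected projection and the exact solution on the grid. -/
def refErr (K : ℕ) (Φ : ℝ → ℝ → ℝ → ℝ) (t : ℝ) : Grid (2 * K + 1) :=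
  refGrid K Φ t - samp (2 * K + 1) (uncurry3 Φ) t

theorem refGrid_eq (K : ℕ) (Φ : ℝ → ℝ → ℝ → ℝ) (t : ℝ) :
    refGrid K Φ t = samp (2 * K + 1) (uncurry3 Φ) t + refErr K Φ t := by
  rw [refErr]; abel

theorem refErr_apply (K : ℕ) (Φ : ℝ → ℝ → ℝ → ℝ) (t : ℝ) (i : ZMod (2 * K + 1)) (j : ℤ) :
    refErr K Φ t i j = projErr K Φ t i j
      - massExcess K Φ t * (1 - Real.cos (2 * Real.pi * (j * mesh (2 * K + 1)))) := by
  rw [← corrGrid_apply]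
  simp only [refErr, refGrid, projErr, Pi.sub_apply]
  ring

theorem abs_one_sub_cos_le (x : ℝ) : |1 - Real.cos x| ≤ 2 := by
  rw [abs_le]
  constructor <;> linarith [Real.cos_le_one x, Real.neg_one_le_cos x]

theorem abs_cos_sub_cos_le' (x y : ℝ) : |Real.cos x - Real.cos y| ≤ |x - y| := by
  have := abs_sub_le_of_deriv (C := 1) convex_univ Real.hasDerivAt_cos
    (fun x _ => by rw [abs_neg]; exact Real.abs_sin_le_one x) (Set.mem_univ y) (Set.mem_univ x)
  rwa [one_mul] at this

/-- Size of the deviation from the exact solution and of its differences. -/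
structure RefErrBound (T C : ℝ) (Φ : ℝ → ℝ → ℝ → ℝ) : Prop where
  pos : 0 < C
  size : ∀ K : ℕ, ∀ t ∈ Set.Icc 0 T, ∀ i, ∀ j : ℕ, j ≤ 2 * K + 1 →
    |refErr K Φ t i j| ≤ C * mesh (2 * K + 1) ^ 2
  time : ∀ K : ℕ, ∀ t ∈ Set.Icc 0 T, ∀ t' ∈ Set.Icc 0 T, ∀ i, ∀ j : ℕ, j ≤ 2 * K + 1 →
    |refErr K Φ t' i j - refErr K Φ t i j| ≤ C * mesh (2 * K + 1) ^ 2 * |t' - t|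
  diff_x : ∀ K : ℕ, ∀ t ∈ Set.Icc 0 T, ∀ i, ∀ j : ℕ, j ≤ 2 * K + 1 →
    |refErr K Φ t (i + 1) j - refErr K Φ t i j| ≤ C * mesh (2 * K + 1) ^ 2 * mesh (2 * K + 1)
  diff_y : ∀ K : ℕ, ∀ t ∈ Set.Icc 0 T, ∀ i, ∀ j : ℕ, j < 2 * K + 1 →
    |refErr K Φ t i (j + 1) - refErr K Φ t i j| ≤ C * mesh (2 * K + 1) ^ 2 * mesh (2 * K + 1)

/-- The projection error is `O(h³)`, so its spatial differences need no smoothness: two values are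
simply added. The correction does not depend on `x`, and in `y` it is `O(h²)` times a cosine, whose
difference over one cell is at most `2π h ≤ 7 h`. -/
theorem SmoothSolution.exists_refErrBound {ε κ θ₀ T c : ℝ} {Φ : ℝ → ℝ → ℝ → ℝ}
    (h : SmoothSolution ε κ θ₀ T c (uncurry3 Φ)) (hT : 0 < T) : ∃ C, RefErrBound T C Φ := by
  obtain ⟨C₁, hC₁, h₁⟩ := exists_projErr_bound h.smooth T
  obtain ⟨C₂, hC₂, h₂⟩ := exists_massExcess_bound h
  have hpos : 0 < 2 * C₁ + 7 * C₂ * (T + 1) := by positivity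
  have hcube : ∀ K : ℕ, mesh (2 * K + 1) ^ 3 ≤ mesh (2 * K + 1) ^ 2 := fun K =>
    pow_le_pow_of_le_one mesh_pos.le mesh_le_one (by norm_num)
  have hmass : ∀ K : ℕ, ∀ t ∈ Set.Icc 0 T,
      |massExcess K Φ t| ≤ C₂ * T * mesh (2 * K + 1) ^ 2 := by
    intro K t ht
    have h0 := h₂ K 0 ⟨le_rfl, hT.le⟩ t ht
    rw [show massExcess K Φ 0 = 0 from sub_self _, sub_zero, sub_zero, abs_of_nonneg ht.1] at h0
    refine h0.trans ?_
    have := mul_le_mul_of_nonneg_left ht.2 (by positivity : 0 ≤ C₂ * mesh (2 * K + 1) ^ 2)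
    linarith
  refine ⟨2 * C₁ + 7 * C₂ * (T + 1), hpos, ?_, ?_, ?_, ?_⟩
  · intro K t ht i j hj
    have a1 := (h₁ K t ht i j hj).1
    have a2 := mul_le_mul (hmass K t ht)
      (abs_one_sub_cos_le (2 * Real.pi * ((j : ℤ) * mesh (2 * K + 1)))) (abs_nonneg _)
      (by positivity)
    rw [← abs_mul] at a2
    have a3 := mul_le_mul_of_nonneg_left (hcube K) hC₁.le
    have a4 : 0 ≤ (C₁ + C₂ * (5 * T + 7)) * mesh (2 * K + 1) ^ 2 := by positivity
    rw [refErr_apply]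
    refine (abs_sub _ _).trans ?_
    linarith
  · intro K t ht t' ht' i j hj
    have a1 := (h₁ K t ht i j hj).2 t' ht'
    have a2 := mul_le_mul (h₂ K t ht t' ht')
      (abs_one_sub_cos_le (2 * Real.pi * ((j : ℤ) * mesh (2 * K + 1)))) (abs_nonneg _)
      (by positivity)
    rw [← abs_mul] at a2
    have a3 := mul_le_mul_of_nonneg_right (mul_le_mul_of_nonneg_left (hcube K) hC₁.le)
      (abs_nonneg (t' - t))
    have a4 : 0 ≤ (C₁ + C₂ * (7 * T + 5)) * mesh (2 * K + 1) ^ 2 * |t' - t| := by positivity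
    rw [refErr_apply, refErr_apply]
    rw [show ∀ a b x y z : ℝ, a - x * z - (b - y * z) = (a - b) - (x - y) * z by intros; ring]
    refine (abs_sub _ _).trans ?_
    linarith
  · intro K t ht i j hj
    have a1 := (h₁ K t ht i j hj).1
    have a2 := (h₁ K t ht (i + 1) j hj).1
    have a3 : 0 ≤ 7 * C₂ * (T + 1) * mesh (2 * K + 1) ^ 3 :=
      mul_nonneg (by positivity) (pow_nonneg mesh_pos.le 3)
    rw [refErr_apply, refErr_apply, sub_sub_sub_cancel_right]
    refine (abs_sub _ _).trans ?_
    linarith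
  · intro K t ht i j hj
    have hm := mesh_pos (N := 2 * K + 1)
    have a1 := (h₁ K t ht i j hj.le).1
    have a2 := (h₁ K t ht i (j + 1) (by omega)).1
    have a3 := abs_cos_sub_cos_le' (2 * Real.pi * ((j : ℤ) * mesh (2 * K + 1)))
      (2 * Real.pi * (((j : ℤ) + 1 : ℤ) * mesh (2 * K + 1)))
    have a4 : |2 * Real.pi * ((j : ℤ) * mesh (2 * K + 1))
        - 2 * Real.pi * (((j : ℤ) + 1 : ℤ) * mesh (2 * K + 1))| ≤ 7 * mesh (2 * K + 1) := by
      rw [show 2 * Real.pi * ((j : ℤ) * mesh (2 * K + 1))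
        - 2 * Real.pi * (((j : ℤ) + 1 : ℤ) * mesh (2 * K + 1))
          = -(2 * Real.pi * mesh (2 * K + 1)) by push_cast; ring, abs_neg,
        abs_of_pos (by positivity)]
      nlinarith [Real.pi_lt_d2]
    have a5 := mul_le_mul (hmass K t ht) (a3.trans a4) (abs_nonneg _) (by positivity)
    rw [← abs_mul] at a5
    have a6 : 0 ≤ 7 * C₂ * mesh (2 * K + 1) ^ 3 := by positivity
    rw [refErr_apply, refErr_apply]
    rw [show ∀ a b x y z : ℝ, a - x * (1 - y) - (b - x * (1 - z)) = (a - b) - x * (z - y) by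
      intros; ring]
    push_cast at a2 a5 ⊢
    refine (abs_sub _ _).trans ?_
    have := abs_sub (projErr K Φ t i (j + 1)) (projErr K Φ t i j)
    linarith

/-! ### Samples of a smooth function -/

theorem PerSmooth.exists_samp_time_bound {G : ℝ × ℝ × ℝ → ℝ} (h : PerSmooth 8 G) (T : ℝ) :
    ∃ C > 0, ∀ (N : ℕ) [NeZero N] (dt t : ℝ), 0 < dt → 0 ≤ t - 2 * dt → t ≤ T →
      ∀ i, ∀ j : ℕ, j ≤ N →
      |bdfDiff dt (samp N G (t - 2 * dt)) (samp N G (t - dt)) (samp N G t) i j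
        - samp N (CHDBC.pd et G) t i j| ≤ C * dt ^ 2 ∧
      |samp N G t i j - 2 * samp N G (t - dt) i j + samp N G (t - 2 * dt) i j| ≤ C * dt ^ 2 := by
  have h1 : PerSmooth 7 (CHDBC.pd et G) := PerSmooth.pd (n := 7) h et
  obtain ⟨C₂, hC₂, hb₂⟩ := (h1.pd et).exists_bound T
  obtain ⟨C₃, hC₃, hb₃⟩ := ((h1.pd et).pd et).exists_bound T
  refine ⟨6 * C₂ + 6 * C₃, by positivity, fun N _ dt t hdt h0 hT i j hj => ?_⟩
  have hy := mul_mesh_mem hj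
  set y := ((j : ℤ) : ℝ) * mesh N with hyd
  have a1 := abs_bdf_le (b := t) (h := dt) (M := C₃)
    (fun s => PerSmooth.hasDerivAt_t (n := 7) h s (gridX i) y)
    (fun s => h1.hasDerivAt_t s (gridX i) y) (fun s => (h1.pd et).hasDerivAt_t s (gridX i) y) hdt
    (fun s hs => hb₃ s ⟨h0.trans hs.1, hs.2.trans hT⟩ _ y hy)
  have a2 := abs_extrapolation_le (b := t) (h := dt) (M := C₂)
    (fun s => PerSmooth.hasDerivAt_t (n := 7) h s (gridX i) y)
    (fun s => h1.hasDerivAt_t s (gridX i) y) hdt.le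
    (fun s hs => hb₂ s ⟨h0.trans hs.1, hs.2.trans hT⟩ _ y hy)
  have p2 : 0 ≤ 6 * C₂ * dt ^ 2 := by positivity
  have p3 : 0 ≤ 6 * C₃ * dt ^ 2 := by positivity
  refine ⟨?_, a2.trans (by linarith)⟩
  have e : bdfDiff dt (samp N G (t - 2 * dt)) (samp N G (t - dt)) (samp N G t) i j
      = (3 * G (t, gridX i, y) - 4 * G (t - dt, gridX i, y) + G (t - 2 * dt, gridX i, y))
        / (2 * dt) := by
    simp only [bdfDiff, samp, Pi.smul_apply, Pi.add_apply, Pi.sub_apply, smul_eq_mul, ← hyd]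
    ring
  rw [e]
  exact a1.trans (by linarith)

/-- Mixed space-time differences are bounded through the mixed derivatives. They measure the
gradient of `P(t) - P(t - dt)`, on which the stabilizing terms act. -/
theorem PerSmooth.exists_samp_diff_bound {G : ℝ × ℝ × ℝ → ℝ} (h : PerSmooth 8 G) (T : ℝ) :
    ∃ C > 0, ∀ (N : ℕ) [NeZero N], ∀ t ∈ Set.Icc 0 T, ∀ t' ∈ Set.Icc 0 T, ∀ i, ∀ j : ℕ,
      (j ≤ N → |(samp N G t' (i + 1) j - samp N G t (i + 1) j)
        - (samp N G t' i j - samp N G t i j)| ≤ C * |t' - t| * mesh N) ∧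
      (j < N → |(samp N G t' i (j + 1) - samp N G t i (j + 1))
        - (samp N G t' i j - samp N G t i j)| ≤ C * |t' - t| * mesh N) := by
  have hx : PerSmooth 7 (CHDBC.pd ex G) := PerSmooth.pd (n := 7) h ex
  have hy : PerSmooth 7 (CHDBC.pd ey G) := PerSmooth.pd (n := 7) h ey
  obtain ⟨C₁, hC₁, hb₁⟩ := (hx.pd et).exists_bound T
  obtain ⟨C₂, hC₂, hb₂⟩ := (hy.pd et).exists_bound T
  refine ⟨C₁ + C₂, by positivity, fun N _ t ht t' ht' i j => ⟨fun hj => ?_, fun hj => ?_⟩⟩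
  all_goals have hm := mesh_pos (N := N)
  · have hym := mul_mesh_mem hj
    have a := abs_sub_le_of_deriv (C := C₁ * |t' - t|) convex_univ
      (f := fun x => G (t', x, ((j : ℤ) : ℝ) * mesh N) - G (t, x, ((j : ℤ) : ℝ) * mesh N))
      (fun x => (PerSmooth.hasDerivAt_x (n := 7) h t' x _).sub
        (PerSmooth.hasDerivAt_x (n := 7) h t x _))
      (fun x _ => abs_sub_le_of_deriv (convex_Icc 0 T) (fun s => hx.hasDerivAt_t s x _)
        (fun s hs => hb₁ s hs x _ hym) ht ht') (Set.mem_univ (gridX i))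
      (Set.mem_univ (gridX i + mesh N))
    rw [add_sub_cancel_left, abs_of_pos hm] at a
    have e := apply_gridX_add_one
      (f := fun x => G (t', x, ((j : ℤ) : ℝ) * mesh N) - G (t, x, ((j : ℤ) : ℝ) * mesh N))
      (fun x => by rw [h.periodic, h.periodic]) i
    have p : 0 ≤ C₂ * |t' - t| * mesh N := by positivity
    simp only [samp]
    rw [e]
    linarith
  · have hj1 := mul_mesh_mem (N := N) (j := j + 1) hj
    have hj0 := mul_mesh_mem hj.le
    have a := abs_sub_le_of_deriv (C := C₂ * |t' - t|) (convex_Icc 0 1)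
      (f := fun y => G (t', gridX i, y) - G (t, gridX i, y))
      (fun y => (PerSmooth.hasDerivAt_y (n := 7) h t' _ y).sub
        (PerSmooth.hasDerivAt_y (n := 7) h t _ y))
      (fun y hy' => abs_sub_le_of_deriv (convex_Icc 0 T) (fun s => hy.hasDerivAt_t s _ y)
        (fun s hs => hb₂ s hs _ y hy') ht ht') hj0 hj1
    have p : 0 ≤ C₁ * |t' - t| * mesh N := by positivity
    rw [show (((j + 1 : ℕ) : ℤ) : ℝ) * mesh N - ((j : ℤ) : ℝ) * mesh N = mesh N by push_cast; ring,
      abs_of_pos hm] at a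
    simp only [samp]
    push_cast at a ⊢
    linarith

/-! ### Energy bounds and boundary fluxes for the consistency estimate -/

section Estimates

set_option linter.unusedSectionVars false

variable {N : ℕ} [NeZero N]

/-- The four parts (horizontal bulk, vertical bulk, top, bottom) contribute `c ^ 2` each. -/
theorem energyForm_le_of_diff {W : Grid N} {c : ℝ}
    (hx : ∀ i, ∀ j : ℕ, j ≤ N → |W (i + 1) j - W i j| ≤ c * mesh N)
    (hy : ∀ i, ∀ j : ℕ, j < N → |W i (j + 1) - W i j| ≤ c * mesh N) :
    energyForm N 1 1 W W ≤ (2 * c) ^ 2 := by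
  have hm := mesh_pos (N := N)
  have hsq : ∀ x : ℝ, |x| ≤ c * mesh N → (x / mesh N) ^ 2 ≤ c ^ 2 := by
    intro x hx
    rw [div_pow, div_le_iff₀ (by positivity), ← mul_pow, ← sq_abs]
    exact pow_le_pow_left₀ (abs_nonneg _) hx 2
  have hrow : ∀ j : ℕ, j ≤ N → dxForm N (fun i => W i j) (fun i => W i j) ≤ c ^ 2 := by
    intro j hj
    rw [dxForm_apply, ipΓ, ← mesh_mul_sum_const (N := N) (c ^ 2)]
    refine mul_le_mul_of_nonneg_left (sum_le_sum fun i _ => ?_) hm.le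
    rw [← sq]
    exact hsq _ (hx i j hj)
  have hcol : ∀ i, colEnergy W i ≤ c ^ 2 := by
    intro i
    have h1 : ∑ j ∈ range N, ((W i (j + 1) - W i j) / mesh N) ^ 2 ≤ ∑ _j ∈ range N, c ^ 2 :=
      sum_le_sum fun j hj => hsq _ (hy i j (mem_range.mp hj))
    rw [sum_const, card_range, nsmul_eq_mul] at h1
    have h2 := mul_le_mul_of_nonneg_left h1 hm.le
    rw [← mul_assoc, mesh_mul, one_mul] at h2
    exact h2
  have h1 : gradSq W ≤ c ^ 2 + c ^ 2 := by
    rw [gradSq_eq]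
    refine add_le_add ?_ ?_
    · rw [← weighted_const (N := N) (c ^ 2)]
      refine mul_le_mul_of_nonneg_left (sum_le_sum fun j hj => ?_) hm.le
      exact mul_le_mul_of_nonneg_left (hrow j (Nat.lt_succ_iff.mp (mem_range.mp hj)))
        (weight_pos j).le
    · rw [← mesh_mul_sum_const (N := N) (c ^ 2)]
      exact mul_le_mul_of_nonneg_left (sum_le_sum fun i _ => hcol i) hm.le
  have h2 : dxForm N (top W) (top W) ≤ c ^ 2 := hrow N le_rfl
  have h3 := hrow 0 (Nat.zero_le N)
  rw [Nat.cast_zero] at h3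
  change dxForm N (bot W) (bot W) ≤ c ^ 2 at h3
  rw [energyForm_self, dxSqΓ_eq]
  linarith

theorem energyForm_le_mul {a b : ℝ} (ha : 0 ≤ a) (hb : 0 ≤ b) (f : Grid N) :
    energyForm N a b f f ≤ (a + b) * energyForm N 1 1 f f := by
  rw [energyForm_self, energyForm_self]
  have h1 := mul_nonneg hb (gradSq_nonneg f)
  have h2 := mul_nonneg ha (dxSqΓ_nonneg f)
  linarith

theorem abs_energyForm_le {a b : ℝ} (ha : 0 ≤ a) (hb : 0 ≤ b) {W : Grid N} {c : ℝ} (hc : 0 ≤ c)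
    (hW : energyForm N 1 1 W W ≤ (2 * c) ^ 2) (v : Grid N) :
    |energyForm N a b W v| ≤ (a + b) * (2 * c) * √(energyForm N 1 1 v v) := by
  refine (abs_form_le (energyForm_comm a b) (energyForm_nonneg ha hb) W v).trans ?_
  have hab : 0 ≤ a + b := add_nonneg ha hb
  calc √(energyForm N a b W W) * √(energyForm N a b v v)
      ≤ √((a + b) * (2 * c) ^ 2) * √((a + b) * energyForm N 1 1 v v) := by
        gcongr
        · exact (energyForm_le_mul ha hb W).trans (by gcongr)
        · exact energyForm_le_mul ha hb v
    _ = (√(a + b) * √(a + b)) * (2 * c) * √(energyForm N 1 1 v v) := by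
        rw [Real.sqrt_mul hab, Real.sqrt_mul hab, Real.sqrt_sq (by positivity)]
        ring
    _ = _ := by rw [Real.mul_self_sqrt hab]

theorem abs_log_sub_log_le {c x y : ℝ} (hc : 0 < c) (hx : c ≤ x) (hy : c ≤ y) :
    |Real.log x - Real.log y| ≤ |x - y| / c := by
  have key : ∀ {x y : ℝ}, c ≤ x → c ≤ y → Real.log x - Real.log y ≤ |x - y| / c := by
    intro x y hx hy
    have hx0 := hc.trans_le hx
    have hy0 := hc.trans_le hy
    rw [← Real.log_div hx0.ne' hy0.ne']
    refine (Real.log_le_sub_one_of_pos (div_pos hx0 hy0)).trans ?_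
    rw [div_sub_one hy0.ne']
    calc (x - y) / y ≤ |x - y| / y := by gcongr; exact le_abs_self _
      _ ≤ |x - y| / c := by gcongr
  rw [abs_le]
  refine ⟨?_, key hx hy⟩
  have := key hy hx
  rw [abs_sub_comm] at this
  linarith

theorem abs_logPot_sub_le {c a b : ℝ} (hc : 0 < c) (ha : c ≤ 1 + a) (ha' : c ≤ 1 - a)
    (hb : c ≤ 1 + b) (hb' : c ≤ 1 - b) : |logPot a - logPot b| ≤ 2 / c * |a - b| := by
  have h1 := abs_log_sub_log_le hc ha hb
  have h2 := abs_log_sub_log_le hc hb' ha'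
  rw [show 1 + a - (1 + b) = a - b by ring] at h1
  rw [show 1 - b - (1 - a) = a - b by ring] at h2
  have e : logPot a - logPot b = (Real.log (1 + a) - Real.log (1 + b))
      + (Real.log (1 - b) - Real.log (1 - a)) := by
    unfold logPot; ring
  rw [e]
  refine (abs_add_le _ _).trans ?_
  calc _ ≤ |a - b| / c + |a - b| / c := add_le_add h1 h2
    _ = _ := by ring

/-- The boundary values `± (2 / h) b` by which `L_h` deviates from the Laplacian. -/
def bdryCorr (g : Grid N) : Grid N := fun i j =>
  (if j = (N : ℤ) then 2 / mesh N * top g i else 0)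
    - (if j = ((0 : ℕ) : ℤ) then 2 / mesh N * bot g i else 0)

/-- The trapezoidal weight turns `2 / h` into a side product of size one, so the `O(1/h)` entries of
`bdryCorr` amount to a boundary flux. -/
theorem ip_bdryCorr (g v : Grid N) :
    ip (bdryCorr g) v = ipΓ (top g) (top v) - ipΓ (bot g) (bot v) := by
  have hm := mesh_pos (N := N)
  have e : bdryCorr g = (fun i j => if j = (N : ℤ) then (2 / mesh N) • top g i else 0)
      - (fun i j => if j = ((0 : ℕ) : ℤ) then (2 / mesh N) • bot g i else 0) := rfl
  have h1 := ip_indicator_row ((2 / mesh N) • top g) v (Or.inr rfl)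
  have h2 := ip_indicator_row ((2 / mesh N) • bot g) v (Or.inl rfl)
  rw [e, ← ipForm_apply, map_sub, LinearMap.sub_apply]
  rw [← ipΓForm_apply, map_smul, LinearMap.smul_apply, smul_eq_mul] at h1 h2
  refine (congrArg₂ (· - ·) h1 h2).trans ?_
  simp only [ipΓForm_apply, Nat.cast_zero]
  unfold top bot
  field_simp

end Estimates

/-- Unlike `μ`, the exact solution has no vanishing normal derivative. Its flux must be subtracted
before `L_h` is consistent on the boundary rows; the surface potentials account for it. -/
theorem PerSmooth.exists_Lh_samp_corrected {G : ℝ × ℝ × ℝ → ℝ} (hG : PerSmooth 4 G) (T : ℝ) :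
    ∃ C > 0, ∀ t ∈ Set.Icc 0 T, ∀ (N : ℕ) [NeZero N], SmallResidual (C * mesh N ^ 2)
      (samp N (CHDBC.lap G) t + Lh (samp N G t) - bdryCorr (samp N (CHDBC.pd ey G) t)) := by
  obtain ⟨C, hC, hb⟩ := hG.exists_Lh_samp T
  refine ⟨C, hC, fun t ht N _ => ?_⟩
  have hm := mesh_pos (N := N)
  have hN := NeZero.ne N
  have hmul : ∀ x : ℝ, |x| ≤ C * mesh N → mesh N * |x| ≤ C * mesh N ^ 2 := by
    intro x hx
    calc mesh N * |x| ≤ mesh N * (C * mesh N) := by gcongr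
      _ = _ := by ring
  refine ⟨fun i j h0 hj => ?_, fun i => hmul _ ?_, fun i => hmul _ ?_⟩
  · refine (le_of_eq ?_).trans ((hb t ht N i).1 j h0 hj)
    have h1 : ¬ ((j : ℤ) = N) := by omega
    have h2 : ¬ ((j : ℤ) = ((0 : ℕ) : ℤ)) := by omega
    simp only [Pi.sub_apply, Pi.add_apply, bdryCorr, h1, h2, if_false]
    congr 1
    ring
  · refine (le_of_eq ?_).trans (hb t ht N i).2.1
    have h2 : ¬ ((N : ℤ) = ((0 : ℕ) : ℤ)) := by omega
    simp only [Pi.sub_apply, Pi.add_apply, bdryCorr, h2, if_false, if_true, top]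
    congr 1
    ring
  · refine (le_of_eq ?_).trans (hb t ht N i).2.2
    have h2 : ¬ ((0 : ℤ) = N) := by omega
    simp only [Pi.sub_apply, Pi.add_apply, bdryCorr, h2, if_false, Nat.cast_zero, if_true, bot]
    congr 1
    ring

/-- The algebra behind the weak residual of the sampled exact solution. -/
theorem weak_residual_identity {N : ℕ} [NeZero N] (ε κ θ₀ A B dt : ℝ)
    (P₀ P₁ P₂ G₂ W₂ lapG gy μ : Grid N) (μT μB : BdryGrid N) (v : Grid N) (hP : P₂ = G₂ + W₂)
    (hμ : ∀ i, ∀ j : ℕ, j ≤ N →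
      μ i j = logGrid G₂ i j - θ₀ * G₂ i j - ε ^ 2 * lapG i j) :
    ip μ v + (ipΓ μT (top v) + ipΓ μB (bot v)) - schemeForm ε κ θ₀ A B dt P₀ P₁ P₂ v
      = ip ((logGrid G₂ - logGrid P₂) + ((-θ₀) • (G₂ - (2 : ℝ) • P₁ + P₀)
          + (-ε ^ 2) • (lapG + Lh G₂ - bdryCorr gy))) v
        + ipΓ (μT - top (logGrid P₂) + θ₀ • top ((2 : ℝ) • P₁ - P₀)
            + (ε * κ) • Dxx (top G₂) - ε ^ 2 • top gy) (top v)
        + ipΓ (μB - bot (logGrid P₂) + θ₀ • bot ((2 : ℝ) • P₁ - P₀)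
            + (ε * κ) • Dxx (bot G₂) + ε ^ 2 • bot gy) (bot v)
        - energyForm N (ε ^ 2) (ε * κ) W₂ v - dt * energyForm N A B (P₂ - P₁) v := by
  have e1 : ip μ v = ip (logGrid G₂ + (-θ₀) • G₂ + (-ε ^ 2) • lapG) v := by
    refine ip_congr fun i j hj => ?_
    rw [hμ i j hj]
    simp only [Pi.add_apply, Pi.smul_apply, smul_eq_mul]
    ring
  have e2 : energyForm N (ε ^ 2) (ε * κ) P₂ v = energyForm N (ε ^ 2) (ε * κ) G₂ v
      + energyForm N (ε ^ 2) (ε * κ) W₂ v := by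
    rw [hP, map_add, LinearMap.add_apply]
  have e3 : gradForm N G₂ v = ip (Lh G₂) v := by
    rw [gradForm_comm, gradForm_apply, ip_comm]
  have e4 : ∀ f g : BdryGrid N, dxForm N f g = - ipΓ (Dxx f) g := by
    intro f g
    rw [dxForm_comm, dxForm_eq, ipΓ_comm, ipΓ, ipΓ]
    simp
  rw [e1, schemeForm, e2, energyForm_apply (ε ^ 2) (ε * κ) G₂, e3, e4, e4, massForm_apply,
    massForm_apply]
  have e5 := ip_bdryCorr gy v
  simp only [← ipForm_apply, ← ipΓForm_apply] at e5 ⊢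
  simp only [map_add, map_sub, map_smul, LinearMap.add_apply, LinearMap.sub_apply,
    LinearMap.smul_apply, smul_eq_mul, e5]
  simp only [← rowLin_N, ← rowLin_zero, map_sub, map_smul, LinearMap.sub_apply,
    LinearMap.smul_apply, smul_eq_mul]
  ring

theorem bdfDiff_add {N : ℕ} (dt : ℝ) (f₀ f₁ f₂ g₀ g₁ g₂ : Grid N) :
    bdfDiff dt (f₀ + g₀) (f₁ + g₁) (f₂ + g₂) = bdfDiff dt f₀ f₁ f₂ + bdfDiff dt g₀ g₁ g₂ := by
  simp only [bdfDiff]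
  module

/-- The backward difference is `3 (f₂ - f₁) - (f₁ - f₀)` over `2 dt`, so the Lipschitz bound in time
costs a factor `(3 + 1) / 2 = 2` and no power of `dt`. -/
theorem RefErrBound.bdfDiff_le {T C : ℝ} {Φ : ℝ → ℝ → ℝ → ℝ} (h : RefErrBound T C Φ) {K : ℕ}
    {dt t : ℝ} (hdt : 0 < dt) (h0 : 0 ≤ t - 2 * dt) (hT : t ≤ T) (i : ZMod (2 * K + 1)) {j : ℕ}
    (hj : j ≤ 2 * K + 1) :
    |bdfDiff dt (refErr K Φ (t - 2 * dt)) (refErr K Φ (t - dt)) (refErr K Φ t) i j|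
      ≤ 2 * C * mesh (2 * K + 1) ^ 2 := by
  have a1 := h.time K (t - dt) ⟨by linarith, by linarith⟩ t ⟨by linarith, hT⟩ i j hj
  have a2 := h.time K (t - 2 * dt) ⟨h0, by linarith⟩ (t - dt) ⟨by linarith, by linarith⟩ i j hj
  rw [show t - (t - dt) = dt by ring, abs_of_pos hdt] at a1
  rw [show t - dt - (t - 2 * dt) = dt by ring, abs_of_pos hdt] at a2
  have e : bdfDiff dt (refErr K Φ (t - 2 * dt)) (refErr K Φ (t - dt)) (refErr K Φ t) i j
      = (3 * (refErr K Φ t i j - refErr K Φ (t - dt) i j)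
        - (refErr K Φ (t - dt) i j - refErr K Φ (t - 2 * dt) i j)) / (2 * dt) := by
    simp only [bdfDiff, Pi.smul_apply, Pi.add_apply, Pi.sub_apply, smul_eq_mul]
    ring
  rw [e, abs_div, abs_of_pos (by positivity : 0 < 2 * dt), div_le_iff₀ (by positivity)]
  refine (abs_sub _ _).trans ?_
  rw [abs_mul, abs_of_pos (by norm_num : (0 : ℝ) < 3)]
  linarith

/-- The corrected exact solution satisfies the scheme up to second order. -/
theorem SmoothSolution.exists_consistent {ε κ θ₀ A B T c : ℝ} {Φ : ℝ → ℝ → ℝ → ℝ}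
    (h : SmoothSolution ε κ θ₀ T c (uncurry3 Φ)) (hε : 0 < ε) (hκ : 0 < κ) (hA : 0 ≤ A)
    (hB : 0 ≤ B) (hT : 0 < T) : ∃ C > 0, ∃ δ > 0, ∀ (K : ℕ) (dt t : ℝ), 0 < dt → dt ≤ δ →
      mesh (2 * K + 1) ≤ δ → 0 ≤ t - 2 * dt → t ≤ T → ∃ μ μT μB,
        Consistent ε κ θ₀ A B dt (C * (dt ^ 2 + mesh (2 * K + 1) ^ 2)) (refGrid K Φ (t - 2 * dt))
          (refGrid K Φ (t - dt)) (refGrid K Φ t) μ μT μB := by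
  have hc := h.pos
  have hS4 : PerSmooth 4 (uncurry3 Φ) := h.smooth.of_le (by norm_num)
  have hmT : PerSmooth 4 (muSide ε κ θ₀ c 1 (uncurry3 Φ)) :=
    (h.smooth.muSide (n := 6) ε κ θ₀ 1 hc).of_le (by norm_num)
  have hmB : PerSmooth 4 (muSide ε κ θ₀ c (-1) (uncurry3 Φ)) :=
    (h.smooth.muSide (n := 6) ε κ θ₀ (-1) hc).of_le (by norm_num)
  obtain ⟨Cw, hW⟩ := h.exists_refErrBound hT
  have hCw := hW.pos
  obtain ⟨Cm, hCm, hmean⟩ := h.exists_mean_samp_bound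
  obtain ⟨Ct, hCt, htime⟩ := h.smooth.exists_samp_time_bound T
  obtain ⟨Cd, hCd, hdiff⟩ := h.smooth.exists_samp_diff_bound T
  obtain ⟨Cl, hCl, hlap⟩ := hS4.exists_Lh_samp_corrected T
  obtain ⟨Cx, hCx, hdxx⟩ := hS4.exists_Dxx_samp T
  obtain ⟨C₁, hC₁, hsT⟩ := hmT.exists_Dxx_samp T
  obtain ⟨C₂, hC₂, hsB⟩ := hmB.exists_Dxx_samp T
  -- The extrapolation uses `refErr` with weights 2 and 1, hence `3 * Cw`; the backward difference
  -- would need only `2 * Cw`.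
  set C₀ : ℝ := Ct + 3 * Cw with hC₀
  have hC₀pos : 0 < C₀ := by positivity
  set Cp : ℝ := 2 / c * Cw + |θ₀| * C₀ with hCp
  have hCp0 : 0 ≤ Cp := by positivity
  -- The weak residual has four sources: the bulk part (factor 6 from `l1Trace_le_of_meanΓ`), the
  -- two sides, the Dirichlet form of `refErr`, and the stabilizing terms.
  set Cq : ℝ := 6 * (Cp + ε ^ 2 * Cl) + 2 * (Cp + ε * κ * Cx)
    + (ε ^ 2 + ε * κ) * (2 * Cw) + (A + B) * (2 * (Cd + 2 * Cw)) with hCq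
  have hCq0 : 0 ≤ Cq := by positivity
  -- The restriction `h ≤ c / Cw`, with `h ≤ 1`, gives `Cw * h ^ 2 ≤ c`, so the corrected solution
  -- stays in the range where the logarithm is Lipschitz.
  refine ⟨C₀ + Cm + C₁ + C₂ + Cq, by positivity, min 1 (c / Cw), by positivity,
    fun K dt t hdt hdtδ hhδ h0 htT => ?_⟩
  have hdt1 : dt ≤ 1 := hdtδ.trans (min_le_left _ _)
  have hm := mesh_pos (N := 2 * K + 1)
  have hm1 := mesh_le_one (N := 2 * K + 1)
  set m := mesh (2 * K + 1) with hmdef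
  set ρ := dt ^ 2 + m ^ 2 with hρ
  have hρ0 : 0 < ρ := by positivity
  have hdtρ : dt ^ 2 ≤ ρ := le_add_of_nonneg_right (sq_nonneg _)
  have hmρ : m ^ 2 ≤ ρ := le_add_of_nonneg_left (sq_nonneg _)
  have ht : t ∈ Set.Icc 0 T := ⟨by linarith, htT⟩
  have ht1 : t - dt ∈ Set.Icc 0 T := ⟨by linarith, by linarith⟩
  have ht2 : t - 2 * dt ∈ Set.Icc 0 T := ⟨h0, by linarith⟩
  set G := uncurry3 Φ with hG
  have eP0 := refGrid_eq K Φ (t - 2 * dt)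
  have eP1 := refGrid_eq K Φ (t - dt)
  have eP2 := refGrid_eq K Φ t
  -- pointwise estimates
  have hsize : ∀ i, ∀ j : ℕ, j ≤ 2 * K + 1 → |refErr K Φ t i j| ≤ Cw * m ^ 2 := hW.size K t ht
  have hsmall : Cw * m ^ 2 ≤ c := by
    have h1 : m ≤ c / Cw := hhδ.trans (min_le_right _ _)
    rw [le_div_iff₀ hCw] at h1
    nlinarith
  have hrangeG : ∀ i, ∀ j : ℕ, j ≤ 2 * K + 1 →
      4 * c ≤ 1 + samp (2 * K + 1) G t i j ∧ 4 * c ≤ 1 - samp (2 * K + 1) G t i j :=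
    fun i j hj => h.range t ht _ _ (mul_mesh_mem hj)
  have hrangeP : ∀ i, ∀ j : ℕ, j ≤ 2 * K + 1 →
      c ≤ 1 + refGrid K Φ t i j ∧ c ≤ 1 - refGrid K Φ t i j := by
    intro i j hj
    have a1 := abs_le.mp ((hsize i j hj).trans hsmall)
    have a2 := hrangeG i j hj
    rw [eP2, Pi.add_apply, Pi.add_apply]
    constructor <;> linarith [a1.1, a1.2, a2.1, a2.2]
  have hbdf : ∀ i, ∀ j : ℕ, j ≤ 2 * K + 1 →
      |bdfDiff dt (refGrid K Φ (t - 2 * dt)) (refGrid K Φ (t - dt)) (refGrid K Φ t) i j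
        - samp (2 * K + 1) (pd et G) t i j| ≤ C₀ * ρ := by
    intro i j hj
    have a1 := (htime (2 * K + 1) dt t hdt h0 htT i j hj).1
    have a2 := hW.bdfDiff_le hdt h0 htT i hj
    have a3 := mul_le_mul_of_nonneg_left hdtρ hCt.le
    have a4 := mul_le_mul_of_nonneg_left hmρ hCw.le
    have a5 : 0 ≤ Cw * ρ := by positivity
    rw [eP0, eP1, eP2, bdfDiff_add, Pi.add_apply, Pi.add_apply, add_sub_right_comm]
    refine (abs_add_le _ _).trans ?_
    rw [hC₀]
    linarith
  have hext : ∀ i, ∀ j : ℕ, j ≤ 2 * K + 1 →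
      |samp (2 * K + 1) G t i j - 2 * refGrid K Φ (t - dt) i j + refGrid K Φ (t - 2 * dt) i j|
        ≤ C₀ * ρ := by
    intro i j hj
    have a1 := abs_le.mp (htime (2 * K + 1) dt t hdt h0 htT i j hj).2
    have a2 := abs_le.mp (hW.size K _ ht1 i j hj)
    have a3 := abs_le.mp (hW.size K _ ht2 i j hj)
    have a4 := mul_le_mul_of_nonneg_left hdtρ hCt.le
    have a5 := mul_le_mul_of_nonneg_left hmρ hCw.le
    rw [eP0, eP1]
    simp only [Pi.add_apply]
    rw [abs_le, hC₀]
    constructor <;> linarith [a1.1, a1.2, a2.1, a2.2, a3.1, a3.2]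
  have hlog : ∀ i, ∀ j : ℕ, j ≤ 2 * K + 1 →
      |logGrid (samp (2 * K + 1) G t) i j - logGrid (refGrid K Φ t) i j| ≤ 2 / c * Cw * ρ := by
    intro i j hj
    have a1 := hrangeG i j hj
    have a2 := hrangeP i j hj
    refine (abs_logPot_sub_le hc (by linarith [a1.1]) (by linarith [a1.2]) a2.1 a2.2).trans ?_
    rw [mul_assoc]
    refine mul_le_mul_of_nonneg_left ?_ (by positivity)
    rw [eP2, Pi.add_apply, Pi.add_apply, sub_add_cancel_left, abs_neg]
    exact (hsize i j hj).trans (mul_le_mul_of_nonneg_left hmρ hCw.le)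
  have hlogρ : ∀ i, ∀ j : ℕ, j ≤ 2 * K + 1 →
      |logGrid (samp (2 * K + 1) G t) i j - logGrid (refGrid K Φ t) i j
        - θ₀ * (samp (2 * K + 1) G t i j - 2 * refGrid K Φ (t - dt) i j
          + refGrid K Φ (t - 2 * dt) i j)| ≤ Cp * ρ := by
    intro i j hj
    refine (abs_sub _ _).trans ?_
    rw [abs_mul]
    have a1 := hlog i j hj
    have a2 := mul_le_mul_of_nonneg_left (hext i j hj) (abs_nonneg θ₀)
    rw [hCp]
    linarith
  have hlogExt : ∀ i, ∀ j : ℕ, j ≤ 2 * K + 1 →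
      logExt c (samp (2 * K + 1) G t i j) = logGrid (samp (2 * K + 1) G t) i j := by
    intro i j hj
    have a1 := hrangeG i j hj
    exact logExt_eq hc (by linarith [a1.1]) (by linarith [a1.2])
  have eN := cast_mul_mesh (2 * K + 1)
  -- The witnesses are the potentials of the exact solution itself, not those of its projection;
  -- projection and correction enter only as perturbations of the weak identity.
  refine ⟨samp (2 * K + 1) (muExt ε θ₀ c G) t, top (samp (2 * K + 1) (muSide ε κ θ₀ c 1 G) t),
    bot (samp (2 * K + 1) (muSide ε κ θ₀ c (-1) G) t), ?_, ?_, ?_, ?_, ?_⟩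
  · intro i j hj
    have := hrangeP i j hj
    constructor <;> linarith [this.1, this.2]
  · have r1 : SmallResidual (C₀ * ρ) (bdfDiff dt (refGrid K Φ (t - 2 * dt))
        (refGrid K Φ (t - dt)) (refGrid K Φ t) - samp (2 * K + 1) (pd et G) t) :=
      SmallResidual.of_le hbdf
    have r2 := (r1.add (hmean (2 * K + 1) t ht))
    rw [← add_assoc, sub_add_cancel] at r2
    refine r2.mono ?_
    have a1 := mul_le_mul_of_nonneg_left hmρ hCm.le
    have a2 : 0 ≤ (C₁ + C₂ + Cq) * ρ := by positivity
    linarith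
  · intro i
    have a1 := hbdf i (2 * K + 1) le_rfl
    have a2 := hsT t ht (2 * K + 1) i (2 * K + 1) le_rfl
    have a3 : samp (2 * K + 1) (pd et G) t i ((2 * K + 1 : ℕ) : ℤ)
        = samp (2 * K + 1) (pd ex (pd ex (muSide ε κ θ₀ c 1 G))) t i ((2 * K + 1 : ℕ) : ℤ) := by
      rw [samp, samp, eN]
      exact h.on_top t ht _
    have a4 := mul_le_mul_of_nonneg_left hmρ hC₁.le
    have a5 : 0 ≤ (Cm + C₂ + Cq) * ρ := by positivity
    rw [a3] at a1
    have a6 := abs_le.mp a1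
    have a7 := abs_le.mp a2
    simp only [top]
    unfold top
    rw [abs_le]
    constructor <;> linarith [a6.1, a6.2, a7.1, a7.2]
  · intro i
    have a1 := hbdf i 0 (Nat.zero_le _)
    have a2 := hsB t ht (2 * K + 1) i 0 (Nat.zero_le _)
    rw [Nat.cast_zero] at a1 a2
    have a3 : samp (2 * K + 1) (pd et G) t i 0
        = samp (2 * K + 1) (pd ex (pd ex (muSide ε κ θ₀ c (-1) G))) t i 0 := by
      rw [samp, samp, Int.cast_zero, zero_mul]
      exact h.on_bot t ht _
    have a4 := mul_le_mul_of_nonneg_left hmρ hC₂.le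
    have a5 : 0 ≤ (Cm + C₁ + Cq) * ρ := by positivity
    rw [a3] at a1
    have a6 := abs_le.mp a1
    have a7 := abs_le.mp a2
    simp only [bot]
    unfold bot
    rw [abs_le]
    constructor <;> linarith [a6.1, a6.2, a7.1, a7.2]
  · intro v hv
    rw [weak_residual_identity ε κ θ₀ A B dt _ _ _ (samp (2 * K + 1) G t) (refErr K Φ t)
      (samp (2 * K + 1) (lap G) t) (samp (2 * K + 1) (pd ey G) t) _ _ _ v eP2
      (fun i j hj => by rw [← hlogExt i j hj]; rfl)]
    set E := √(energyForm (2 * K + 1) 1 1 v v) with hE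
    have hE0 : 0 ≤ E := Real.sqrt_nonneg _
    have q1 : SmallResidual ((Cp + ε ^ 2 * Cl) * ρ)
        ((logGrid (samp (2 * K + 1) G t) - logGrid (refGrid K Φ t))
          + ((-θ₀) • (samp (2 * K + 1) G t - (2 : ℝ) • refGrid K Φ (t - dt)
            + refGrid K Φ (t - 2 * dt))
          + (-ε ^ 2) • (samp (2 * K + 1) (lap G) t + Lh (samp (2 * K + 1) G t)
            - bdryCorr (samp (2 * K + 1) (pd ey G) t)))) := by
      rw [← add_assoc]
      refine SmallResidual.mono (SmallResidual.add (SmallResidual.of_le (c := Cp * ρ)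
        fun i j hj => ?_) ((hlap t ht (2 * K + 1)).smul (-ε ^ 2))) ?_
      · refine (le_of_eq ?_).trans (hlogρ i j hj)
        simp only [Pi.add_apply, Pi.sub_apply, Pi.smul_apply, smul_eq_mul]
        congr 1
        ring
      · rw [abs_neg, abs_of_pos (by positivity : 0 < ε ^ 2)]
        have := mul_le_mul_of_nonneg_left hmρ (by positivity : 0 ≤ ε ^ 2 * Cl)
        linarith
    have b1 := (q1.abs_ip_le v).trans
      (mul_le_mul_of_nonneg_left (l1Trace_le_of_meanΓ hv.2.2) q1.nonneg)
    have hrowsum : ∀ f : BdryGrid (2 * K + 1), meanΓ f = 0 →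
        dxForm (2 * K + 1) f f ≤ energyForm (2 * K + 1) 1 1 v v →
        mesh (2 * K + 1) * ∑ i, |f i| ≤ E := fun f hf hle =>
      (sum_abs_le_sqrt_dxForm hf).trans (Real.sqrt_le_sqrt hle)
    have htop := hrowsum (top v) hv.2.1 (by
      rw [energyForm_self, dxSqΓ_eq]
      linarith [gradSq_nonneg v, dxForm_nonneg (bot v)])
    have hbot := hrowsum (bot v) hv.2.2 (dxForm_bot_le_energy v)
    have hside : ∀ i, ∀ j : ℕ, j ≤ 2 * K + 1 → ∀ s : ℝ,
        s = (logGrid (samp (2 * K + 1) G t) i j - logGrid (refGrid K Φ t) i j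
        - θ₀ * (samp (2 * K + 1) G t i j - 2 * refGrid K Φ (t - dt) i j
          + refGrid K Φ (t - 2 * dt) i j)) + ε * κ * (Dxx (fun k => samp (2 * K + 1) G t k j) i
            - samp (2 * K + 1) (pd ex (pd ex G)) t i j) →
        |s| ≤ (Cp + ε * κ * Cx) * ρ := by
      intro i j hj s hs
      have a1 := hlogρ i j hj
      have a2 := hdxx t ht (2 * K + 1) i j hj
      have a3 := mul_le_mul_of_nonneg_left (a2.trans (mul_le_mul_of_nonneg_left hmρ hCx.le))
        (by positivity : 0 ≤ ε * κ)
      rw [hs]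
      refine (abs_add_le _ _).trans ?_
      rw [abs_mul, abs_of_pos (by positivity : 0 < ε * κ)]
      linarith
    have q2 : ∀ i, |(top (samp (2 * K + 1) (muSide ε κ θ₀ c 1 G) t)
        - top (logGrid (refGrid K Φ t))
        + θ₀ • top ((2 : ℝ) • refGrid K Φ (t - dt) - refGrid K Φ (t - 2 * dt))
        + (ε * κ) • Dxx (top (samp (2 * K + 1) G t))
        - ε ^ 2 • top (samp (2 * K + 1) (pd ey G) t)) i| ≤ (Cp + ε * κ * Cx) * ρ := by
      intro i
      refine hside i (2 * K + 1) le_rfl _ ?_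
      rw [← hlogExt i (2 * K + 1) le_rfl]
      have e1 : top (samp (2 * K + 1) (muSide ε κ θ₀ c 1 G) t) i
          = logExt c (samp (2 * K + 1) G t i ((2 * K + 1 : ℕ) : ℤ))
            - θ₀ * samp (2 * K + 1) G t i ((2 * K + 1 : ℕ) : ℤ)
            - κ * ε * samp (2 * K + 1) (pd ex (pd ex G)) t i ((2 * K + 1 : ℕ) : ℤ)
            + ε ^ 2 * 1 * samp (2 * K + 1) (pd ey G) t i ((2 * K + 1 : ℕ) : ℤ) := rfl
      simp only [Pi.add_apply, Pi.sub_apply, Pi.smul_apply, smul_eq_mul, e1]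
      simp only [top, Pi.sub_apply, Pi.smul_apply, smul_eq_mul]
      unfold top
      ring
    have q3 : ∀ i, |(bot (samp (2 * K + 1) (muSide ε κ θ₀ c (-1) G) t)
        - bot (logGrid (refGrid K Φ t))
        + θ₀ • bot ((2 : ℝ) • refGrid K Φ (t - dt) - refGrid K Φ (t - 2 * dt))
        + (ε * κ) • Dxx (bot (samp (2 * K + 1) G t))
        + ε ^ 2 • bot (samp (2 * K + 1) (pd ey G) t)) i| ≤ (Cp + ε * κ * Cx) * ρ := by
      intro i
      refine hside i 0 (Nat.zero_le _) _ ?_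
      rw [← hlogExt i 0 (Nat.zero_le _)]
      have e1 : bot (samp (2 * K + 1) (muSide ε κ θ₀ c (-1) G) t) i
          = logExt c (samp (2 * K + 1) G t i 0)
            - θ₀ * samp (2 * K + 1) G t i 0
            - κ * ε * samp (2 * K + 1) (pd ex (pd ex G)) t i 0
            + ε ^ 2 * (-1) * samp (2 * K + 1) (pd ey G) t i 0 := rfl
      simp only [Pi.add_apply, Pi.sub_apply, Pi.smul_apply, smul_eq_mul, e1, Nat.cast_zero]
      simp only [bot, Pi.sub_apply, Pi.smul_apply, smul_eq_mul]
      unfold bot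
      ring
    have b2 := (abs_ipΓ_le q2 (top v)).trans (mul_le_mul_of_nonneg_left htop (by positivity))
    have b3 := (abs_ipΓ_le q3 (bot v)).trans (mul_le_mul_of_nonneg_left hbot (by positivity))
    have b4 := abs_energyForm_le (a := ε ^ 2) (b := ε * κ) (by positivity) (by positivity)
      (c := Cw * m ^ 2) (by positivity)
      (energyForm_le_of_diff (hW.diff_x K t ht) (hW.diff_y K t ht)) v
    have hdP : energyForm (2 * K + 1) 1 1 (refGrid K Φ t - refGrid K Φ (t - dt))
        (refGrid K Φ t - refGrid K Φ (t - dt)) ≤ (2 * (Cd * dt + 2 * (Cw * m ^ 2))) ^ 2 := by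
      have habs : |t - (t - dt)| = dt := by rw [sub_sub_cancel, abs_of_pos hdt]
      refine energyForm_le_of_diff (fun i j hj => ?_) (fun i j hj => ?_)
      · have a1 := abs_le.mp ((hdiff (2 * K + 1) _ ht1 _ ht i j).1 hj)
        have a2 := abs_le.mp (hW.diff_x K t ht i j hj)
        have a3 := abs_le.mp (hW.diff_x K _ ht1 i j hj)
        rw [habs] at a1
        rw [eP1, eP2]
        simp only [Pi.add_apply, Pi.sub_apply]
        rw [abs_le]
        constructor <;> linarith [a1.1, a1.2, a2.1, a2.2, a3.1, a3.2]
      · have a1 := abs_le.mp ((hdiff (2 * K + 1) _ ht1 _ ht i j).2 hj)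
        have a2 := abs_le.mp (hW.diff_y K t ht i j hj)
        have a3 := abs_le.mp (hW.diff_y K _ ht1 i j hj)
        rw [habs] at a1
        rw [eP1, eP2]
        simp only [Pi.add_apply, Pi.sub_apply]
        rw [abs_le]
        constructor <;> linarith [a1.1, a1.2, a2.1, a2.2, a3.1, a3.2]
    have b5 := abs_energyForm_le hA hB (by positivity) hdP v
    -- The stabilization is of second order: the increment over one step has gradient `O(dt + h²)`,
    -- and the form carries a further factor `dt ≤ 1`.
    have b6 : dt * (Cd * dt + 2 * (Cw * m ^ 2)) ≤ (Cd + 2 * Cw) * ρ := by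
      have a1 := mul_le_mul_of_nonneg_left hdtρ hCd.le
      have a2 : dt * (Cw * m ^ 2) ≤ 1 * (Cw * ρ) := by gcongr
      linarith
    have b7 : |dt * energyForm (2 * K + 1) A B (refGrid K Φ t - refGrid K Φ (t - dt)) v|
        ≤ (A + B) * (2 * ((Cd + 2 * Cw) * ρ)) * E := by
      rw [abs_mul, abs_of_pos hdt]
      calc _ ≤ dt * ((A + B) * (2 * (Cd * dt + 2 * (Cw * m ^ 2))) * E) := by gcongr
        _ = (A + B) * (2 * (dt * (Cd * dt + 2 * (Cw * m ^ 2)))) * E := by ring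
        _ ≤ _ := by gcongr
    have b8 : (ε ^ 2 + ε * κ) * (2 * (Cw * m ^ 2)) * E
        ≤ (ε ^ 2 + ε * κ) * (2 * (Cw * ρ)) * E := by gcongr
    have b9 : 0 ≤ (C₀ + Cm + C₁ + C₂) * ρ * E := by positivity
    refine (abs_sub _ _).trans ((add_le_add ((abs_sub _ _).trans (add_le_add
      ((abs_add_le _ _).trans (add_le_add ((abs_add_le _ _).trans (add_le_add b1 b2)) b3))
      (b4.trans b8))) b7).trans ?_)
    rw [hCq]
    linarith

/-! ### Starting values and the final error bound -/

/-- By the parallelogram identity, `Q` at `2 ψ₁ - ψ₀` is at most `8 Q(ψ₁) + 2 Q(ψ₀)`. -/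
theorem bdfEnergy_le {V W : Type*} [AddCommGroup V] [Module ℝ V] [AddCommGroup W] [Module ℝ W]
    {Q : LinearMap.BilinForm ℝ V} (hp : ∀ x, 0 ≤ Q x x) (S : LinearMap.BilinForm ℝ W) (dt : ℝ)
    (ψ₀ ψ₁ : V) (e₁ : W) :
    bdfEnergy Q S dt ψ₀ ψ₁ e₁ ≤ (9 * Q ψ₁ ψ₁ + 2 * Q ψ₀ ψ₀) / 4 + dt ^ 2 / 2 * S e₁ e₁ := by
  have h := hp ((2 : ℝ) • ψ₁ + ψ₀)
  simp only [bdfEnergy, map_add, map_sub, map_smul, LinearMap.add_apply, LinearMap.sub_apply,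
    LinearMap.smul_apply, smul_eq_mul] at h ⊢
  linarith

/-- The initial energy in the stability estimate is of fourth order for accurate starting values. -/
theorem start_energy_le {N : ℕ} [NeZero N] {ε κ A B dt Λ C₀ ρ : ℝ} (hε : 0 < ε) (hκ : 0 < κ)
    (hA : 0 ≤ A) (hB : 0 ≤ B) (hdt : 0 < dt) (hdt1 : dt ≤ 1) (hΛ : 0 < Λ)
    (hD : ∀ f : Grid N, energyForm N 1 1 f f ≤ Λ * energyForm N (ε ^ 2) (ε * κ) f f)
    {e₀ e₁ : Grid N} (m₀ : MassFree e₀) (m₁ : MassFree e₁)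
    (h₀ : normNeg e₀ + normNegΓ e₀ ≤ C₀ * ρ) (h₁ : normNeg e₁ + normNegΓ e₁ ≤ C₀ * ρ)
    (hg : dt * energyForm N (ε ^ 2) (ε * κ) e₁ e₁ ≤ C₀ * ρ ^ 2) :
    bdfEnergy (potForm N) (energyForm N A B) dt (potentials e₀) (potentials e₁) e₁
        + dt / 2 * energyForm N (ε ^ 2) (ε * κ) e₁ e₁
      ≤ (11 / 4 * C₀ ^ 2 + ((A + B) * Λ + 1) / 2 * |C₀|) * ρ ^ 2 := by
  have sq : ∀ {e : Grid N}, MassFree e → normNeg e + normNegΓ e ≤ C₀ * ρ →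
      potForm N (potentials e) (potentials e) ≤ C₀ ^ 2 * ρ ^ 2 := fun {e} m h =>
    (potForm_potentials_le m).trans ((pow_le_pow_left₀
      (add_nonneg (normNeg_nonneg e) (normNegΓ_nonneg e)) h 2).trans_eq (mul_pow ..))
  have hE := energyForm_nonneg (N := N) (sq_nonneg ε) (mul_pos hε hκ).le e₁
  have hg' : dt * energyForm N (ε ^ 2) (ε * κ) e₁ e₁ ≤ |C₀| * ρ ^ 2 :=
    hg.trans (mul_le_mul_of_nonneg_right (le_abs_self C₀) (sq_nonneg ρ))
  have hS : energyForm N A B e₁ e₁ ≤ (A + B) * Λ * energyForm N (ε ^ 2) (ε * κ) e₁ e₁ := by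
    rw [mul_assoc]
    exact (energyForm_le_mul hA hB e₁).trans
      (mul_le_mul_of_nonneg_left (hD e₁) (add_nonneg hA hB))
  have hAB : 0 ≤ (A + B) * Λ := mul_nonneg (add_nonneg hA hB) hΛ.le
  -- One factor `dt` is used up by the bound on the starting gradient, the other by `dt ≤ 1`.
  have hS2 : dt ^ 2 / 2 * energyForm N A B e₁ e₁ ≤ (A + B) * Λ / 2 * (|C₀| * ρ ^ 2) := by
    calc dt ^ 2 / 2 * energyForm N A B e₁ e₁
        ≤ dt ^ 2 / 2 * ((A + B) * Λ * energyForm N (ε ^ 2) (ε * κ) e₁ e₁) := by gcongr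
      _ = dt * ((A + B) * Λ / 2 * (dt * energyForm N (ε ^ 2) (ε * κ) e₁ e₁)) := by ring
      _ ≤ 1 * ((A + B) * Λ / 2 * (dt * energyForm N (ε ^ 2) (ε * κ) e₁ e₁)) := by
        gcongr
      _ ≤ (A + B) * Λ / 2 * (|C₀| * ρ ^ 2) := by rw [one_mul]; gcongr
  have := bdfEnergy_le potForm_nonneg (energyForm N A B) dt (potentials e₀) (potentials e₁) e₁
  linarith [sq m₀ h₀, sq m₁ h₁]

theorem energyForm_one_le {N : ℕ} [NeZero N] {a b : ℝ} (ha : 0 < a) (hb : 0 < b) (f : Grid N) :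
    energyForm N 1 1 f f ≤ (1 / a + 1 / b) * energyForm N a b f f := by
  rw [energyForm_self, energyForm_self]
  have h1 : 0 ≤ b / a * dxSqΓ f := mul_nonneg (by positivity) (dxSqΓ_nonneg f)
  have h2 : 0 ≤ a / b * gradSq f := mul_nonneg (by positivity) (gradSq_nonneg f)
  have : (1 / a + 1 / b) * (a * gradSq f + b * dxSqΓ f)
      = 1 * gradSq f + 1 * dxSqΓ f + b / a * dxSqΓ f + a / b * gradSq f := by
    field_simp
    ring
  linarith

/-- From an energy bound of fourth order to the error bound of second order. -/
theorem norm_add_sum_le {N : ℕ} [NeZero N] {a b dt M ρ : ℝ} (ha : 0 ≤ a) (hb : 0 ≤ b)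
    (hdt : 0 ≤ dt) (hM : 0 ≤ M) (hρ : 0 ≤ ρ) (hρ1 : ρ ≤ 1) {e : ℕ → Grid N} {n : ℕ}
    (he : MassFree (e (n + 1)))
    (h : potForm N (potentials (e (n + 1))) (potentials (e (n + 1))) / 4
      + dt / 2 * ∑ k ∈ Icc 1 (n + 1), energyForm N a b (e k) (e k) ≤ M * ρ ^ 2) :
    normNeg (e (n + 1)) + normNegΓ (e (n + 1))
        + dt * ∑ k ∈ Icc 1 n, (a * gradSq (e k) + b * dxSqΓ (e k))
      ≤ (4 * √M + 2 * M + 1) * ρ := by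
  have hnn : ∀ k, 0 ≤ energyForm N a b (e k) (e k) := fun k => energyForm_nonneg ha hb _
  have hQ := potForm_nonneg (potentials (e (n + 1)))
  have hmono : ∑ k ∈ Icc 1 n, (a * gradSq (e k) + b * dxSqΓ (e k))
      ≤ ∑ k ∈ Icc 1 (n + 1), energyForm N a b (e k) (e k) := by
    simp only [← energyForm_self]
    exact sum_le_sum_of_subset_of_nonneg (Icc_subset_Icc_right (Nat.le_succ n)) fun k _ _ => hnn k
  have hsum := mul_nonneg hdt (sum_nonneg fun k (_ : k ∈ Icc 1 (n + 1)) => hnn k)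
  have h1 : √(potForm N (potentials (e (n + 1))) (potentials (e (n + 1)))) ≤ 2 * √M * ρ := by
    rw [Real.sqrt_le_left (by positivity)]
    have : (2 * √M * ρ) ^ 2 = 4 * (M * ρ ^ 2) := by
      rw [mul_pow, mul_pow, Real.sq_sqrt hM]; ring
    linarith
  have h2 := mul_le_mul_of_nonneg_left hmono hdt
  -- The dissipation sum is of order `ρ ^ 2`, but it is added to norms of order `ρ`; `ρ ≤ 1` brings
  -- both to the same order.
  have h3 : M * ρ ^ 2 ≤ M * ρ := mul_le_mul_of_nonneg_left (by nlinarith) hM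
  have h4 := normNeg_add_le he
  linarith

/-- Second order convergence for a consistent reference sequence. -/
theorem error_estimate {N : ℕ} [NeZero N] {ε κ θ₀ A B dt T Λ Cc C₀ ρ : ℝ} (hε : 0 < ε)
    (hκ : 0 < κ) (hA : 0 ≤ A) (hB : 0 ≤ B) (hdt : 0 < dt) (hdt1 : dt ≤ 1) (hT : 0 < T)
    (hΛ : 0 < Λ) (hρ : 0 ≤ ρ) (hρ1 : ρ ≤ 1)
    (hD : ∀ f : Grid N, energyForm N 1 1 f f ≤ Λ * energyForm N (ε ^ 2) (ε * κ) f f)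
    {P φ : ℕ → Grid N} {n : ℕ} (hn : n * dt ≤ T)
    (hP : ∀ k, 1 ≤ k → k ≤ n → ∃ μ μT μB,
      Consistent ε κ θ₀ A B dt (Cc * ρ) (P (k - 1)) (P k) (P (k + 1)) μ μT μB)
    (hφ : ∀ k, 1 ≤ k → k ≤ n → BDF2Step ε κ θ₀ A B dt (φ (k - 1)) (φ k) (φ (k + 1)))
    (hPm : ∀ k, k ≤ n + 1 → MassFree (P k - P 0))
    (m₀ : MassFree (P 0 - φ 0)) (m₁ : MassFree (P 1 - φ 1))
    (h₀ : normNeg (P 0 - φ 0) + normNegΓ (P 0 - φ 0) ≤ C₀ * ρ)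
    (h₁ : normNeg (P 1 - φ 1) + normNegΓ (P 1 - φ 1) ≤ C₀ * ρ)
    (hg : dt * (ε ^ 2 * gradSq (P 1 - φ 1) + ε * κ * dxSqΓ (P 1 - φ 1)) ≤ C₀ * ρ ^ 2) {M : ℝ}
    (hM : M = Real.exp (T * (4 * θ₀ ^ 2 * Λ))
      * (11 / 4 * C₀ ^ 2 + ((A + B) * Λ + 1) / 2 * |C₀| + T * (60 * Cc * √Λ) ^ 2)) :
    MassFree (P (n + 1) - φ (n + 1)) ∧
      normNeg (P (n + 1) - φ (n + 1)) + normNegΓ (P (n + 1) - φ (n + 1))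
          + dt * ∑ k ∈ Icc 1 n, (ε ^ 2 * gradSq (P k - φ k) + ε * κ * dxSqΓ (P k - φ k))
        ≤ (4 * √M + 2 * M + 1) * ρ := by
  obtain ⟨hm, hst⟩ := stability hε hκ hA hB hdt hΛ hD hP hφ hPm m₀ m₁
  rw [← energyForm_self] at hg
  have hE := start_energy_le hε hκ hA hB hdt hdt1 hΛ hD m₀ m₁ h₀ h₁ hg
  have hM0 : 0 ≤ M := by rw [hM]; positivity
  refine ⟨hm, norm_add_sum_le (e := fun k => P k - φ k) (sq_nonneg ε) (mul_pos hε hκ).le hdt.le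
    hM0 hρ hρ1 hm (hst.trans ?_)⟩
  have e : M * ρ ^ 2 = Real.exp (T * (4 * θ₀ ^ 2 * Λ))
      * ((11 / 4 * C₀ ^ 2 + ((A + B) * Λ + 1) / 2 * |C₀|) * ρ ^ 2
        + T * (60 * (Cc * ρ) * √Λ) ^ 2) := by rw [hM]; ring
  rw [e, ← mul_assoc (n : ℝ) dt, ← mul_assoc (n : ℝ) dt]
  refine mul_le_mul (Real.exp_le_exp.mpr ?_) (add_le_add hE ?_) ?_ (Real.exp_pos _).le
  · exact mul_le_mul_of_nonneg_right hn (by positivity)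
  · exact mul_le_mul_of_nonneg_right hn (sq_nonneg _)
  · have hb : 0 ≤ bdfEnergy (potForm N) (energyForm N A B) dt (potentials (P 0 - φ 0))
        (potentials (P 1 - φ 1)) (P 1 - φ 1) :=
      add_nonneg (div_nonneg (add_nonneg (potForm_nonneg _) (potForm_nonneg _)) (by norm_num))
        (mul_nonneg (by positivity) (energyForm_nonneg hA hB _))
    have hc := energyForm_nonneg (sq_nonneg ε) (mul_pos hε hκ).le (P 1 - φ 1)
    positivity

end CHDBC

end

open CHDBC

theorem mainTheorem2 :
    ∃ m : ℕ, ∀ ε κ θ₀ A B T : ℝ, 0 < ε → 0 < κ → 0 ≤ A → 0 ≤ B → 0 < T →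
      ∀ Φ : ℝ → ℝ → ℝ → ℝ, ExactSolution ε κ θ₀ T m Φ →
      ∀ C₀ : ℝ, ∃ C > 0, ∃ δ > 0,
      ∀ (K : ℕ) (dt : ℝ), 0 < dt → dt ≤ δ → mesh (2 * K + 1) ≤ δ →
      ∀ φ : ℕ → Grid (2 * K + 1), AccurateStart ε κ C₀ K Φ dt φ →
      ∀ n : ℕ, 1 ≤ n → ((n : ℝ) + 1) * dt ≤ T →
        (∀ k : ℕ, 1 ≤ k → k ≤ n →
          BDF2Step ε κ θ₀ A B dt (φ (k - 1)) (φ k) (φ (k + 1))) →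
        MassFree (err K Φ dt φ (n + 1)) ∧
        normNeg (err K Φ dt φ (n + 1)) + normNegΓ (err K Φ dt φ (n + 1))
          + dt * ∑ k ∈ Finset.Icc 1 n,
              (ε ^ 2 * gradSq (err K Φ dt φ k) + ε * κ * dxSqΓ (err K Φ dt φ k))
          ≤ C * (dt ^ 2 + mesh (2 * K + 1) ^ 2) := by
  -- Eight derivatives cover five in `x` and one in `t` for the projection error, and also the four
  -- that Taylor expansion needs beyond the two in the chemical potentials.
  refine ⟨8, fun ε κ θ₀ A B T hε hκ hA hB hT Φ hΦ C₀ => ?_⟩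
  obtain ⟨c, hc⟩ := hΦ.smoothSolution
  obtain ⟨Cc, hCc, δ, hδ, hcons⟩ := hc.exists_consistent hε hκ hA hB hT
  have hΛ : 0 < 1 / ε ^ 2 + 1 / (ε * κ) := by positivity
  obtain ⟨M, hM⟩ : ∃ M, M = Real.exp (T * (4 * θ₀ ^ 2 * (1 / ε ^ 2 + 1 / (ε * κ))))
      * (11 / 4 * C₀ ^ 2 + ((A + B) * (1 / ε ^ 2 + 1 / (ε * κ)) + 1) / 2 * |C₀|
        + T * (60 * Cc * √(1 / ε ^ 2 + 1 / (ε * κ))) ^ 2) := ⟨_, rfl⟩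
  have hM0 : 0 ≤ M := by rw [hM]; positivity
  -- The bound `1 / 2` on `dt` and `h` ensures `dt ^ 2 + h ^ 2 ≤ 1` and excludes `K = 0`, where the
  -- profile `1 - cos (2 π y)` vanishes at all grid points and cannot correct the mass.
  refine ⟨4 * √M + 2 * M + 1, by positivity, min δ (1 / 2), by positivity, ?_⟩
  intro K dt hdt hdtδ hmesh φ hs n hn hnT hstep
  have hdt2 := hdtδ.trans (min_le_right _ _)
  have hh := hmesh.trans (min_le_right _ _)
  have hh0 : 0 < mesh (2 * K + 1) := mesh_pos
  have hK : 1 ≤ K := by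
    by_contra! h
    obtain rfl : K = 0 := by omega
    norm_num [mesh] at hh
  have htime : ∀ k : ℕ, k ≤ n + 1 → (k : ℝ) * dt ≤ T := fun k hk =>
    (mul_le_mul_of_nonneg_right (by exact_mod_cast hk) hdt.le).trans hnT
  refine error_estimate (P := fun k => refGrid K Φ (k * dt)) hε hκ hA hB hdt (by linarith) hT hΛ
    (by positivity) (by nlinarith) (energyForm_one_le (pow_pos hε 2) (mul_pos hε hκ))
    (htime n (Nat.le_succ n)) ?_ hstep ?_ hs.mass₀ hs.mass₁ hs.acc₀ hs.acc₁ hs.grad₁ hM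
  · intro k hk hkn
    obtain ⟨l, rfl⟩ := Nat.exists_eq_add_of_le' hk
    -- Consistency is stated at the newest of three time levels, here `t_{k+1}` with `k = l + 1`;
    -- since `k ≥ 1`, the truncated subtraction `k - 1` is a true one.
    have e1 : ((l + 1 + 1 : ℕ) : ℝ) * dt - 2 * dt = ((l + 1 - 1 : ℕ) : ℝ) * dt := by
      rw [Nat.add_sub_cancel]; push_cast; ring
    have e2 : ((l + 1 + 1 : ℕ) : ℝ) * dt - dt = ((l + 1 : ℕ) : ℝ) * dt := by
      push_cast; ring
    have h := hcons K dt ((l + 1 + 1 : ℕ) * dt) hdt (hdtδ.trans (min_le_left _ _))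
      (hmesh.trans (min_le_left _ _)) (by rw [e1]; positivity) (htime _ (by omega))
    rwa [e1, e2] at h
  · intro k hk
    have h := hc.massFree_refGrid hK (t := k * dt) ⟨by positivity, htime k hk⟩
    simpa only [Nat.cast_zero, zero_mul] using h
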